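/- Let $m\ge 1$ and let $v_1,\dots,v_m\in\mathbb Z^2$ (indices modulo $m$) be a legal loop: every $v_i$ is primitive, and for every $i$ the points $0,v_i,v_{i+1}$ are the vertices of a nondegenerate triangle (that is, $v_{i+1}\ne\pm v_i$) containing no lattice point in its interior. Let $u_i\in\mathbb Z^2$ be the outward primitive normal vector of the triangle $\{0,v_i,v_{i+1}\}$ at its side $\{v_i,v_{i+1}\}$: $u_i$ is primitive, $\langle u_i,v_{i+1}-v_i\rangle=0$ and $\langle u_i,v_i\rangle>0$. Then there are a compact oriented smooth $4$-manifold $M$ (Hausdorff, without boundary) and a smooth map $f:M\to\mathbb S^2$ which is a torus fibration with simple nodal singular fibers, in the following sense. There are finitely many points (nodes) in $M$, lying in different fibers, such that over the complement of their images $f$ is a smooth, locally trivial $T^2$-bundle, and such that the fiber through each node $p$ is a simple nodal fiber of sign $+1$ or $-1$: in a positively oriented smooth complex chart $(z,w)$ of $M$ centered at $p$ and a smooth complex coordinate of $\mathbb S^2$ centered at $f(p)$, $f$ is $(z,w)\mapsto zw$ for sign $+1$ and $(z,w)\mapsto z\bar w$ for sign $-1$; $f$ is a submersion at all other points of the fiber;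 and the fiber is a $2$-sphere with two points identified to $p$. Moreover: 1. To each vertex $v_i$ belong exactly $|\det(u_{i-1},u_i)|$ singular fibers, all of sign $\operatorname{sgn}\det(u_{i-1},u_i)$. 2. To each edge $\{v_i,v_{i+1}\}$ belong exactly $|\det(v_i,v_{i+1})|$ singular fibers, all of sign $\operatorname{sgn}\det(v_i,v_{i+1})$. 3. These are all the singular fibers, and different ones lie over different points of $\mathbb S^2$. 4. The correspondence is geometric. Identify $\mathbb S^2$ with $\mathbb C\cup\{\infty\}$. There is a smooth trivialization of $f$ over a neighborhood of $0$ with fiber $(\mathbb R^2)^*/(\mathbb Z^2)^*$. The singular values lie on pairwise distinct rays from $0$, and those belonging to $v_1,\{v_1,v_2\},v_2,\{v_2,v_3\},\dots,v_m,\{v_m,v_1\}$ lie in successive angular sectors in this order. Along the straight segment from $0$ to each singular value, a linear loop in the fiber over $0$ collapses to the node; its class is $u_i$ if the singular fiber belongs to the edge $\{v_i,v_{i+1}\}$, and, if the singular fiber belongs to the vertex $v_i=(a,b)$, the primitive covector $(-b,a)$, which annihilates $v_i$. -/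

import Mathlib

open scoped Manifold ContDiff

/-! ## Legal loops -/

/-- The determinant of the `2 × 2` matrix with columns `a`, `b`. -/
def latticeDet (a b : ℤ × ℤ) : ℤ := a.1 * b.2 - a.2 * b.1

/-- A lattice point as a point of the plane. -/
def latticePoint (a : ℤ × ℤ) : ℝ × ℝ := ((a.1 : ℝ), (a.2 : ℝ))

/-- A lattice vector is primitive if its coordinates are coprime. -/
def IsPrimitiveVector (a : ℤ × ℤ) : Prop := IsCoprime a.1 a.2

/-- The triangle `Conv {0, a, b}`. -/
def originTriangle (a b : ℤ × ℤ) : Set (ℝ × ℝ) :=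
  convexHull ℝ {0, latticePoint a, latticePoint b}

/-- A legal loop `v 0, …, v (m - 1)`, with indices read cyclically: all `v i` are primitive and
`0`, `v i`, `v (i + 1)` are the vertices of a genuine (nondegenerate) triangle without interior
lattice points.  For primitive vectors nondegeneracy says `v (i + 1) ≠ v i` and
`v (i + 1) ≠ - v i`. -/
structure IsLegalLoop {m : ℕ} [NeZero m] (v : Fin m → ℤ × ℤ) : Prop where
  primitive : ∀ i, IsPrimitiveVector (v i)
  nondegenerate : ∀ i, latticeDet (v i) (v (i + 1)) ≠ 0
  no_interior_point : ∀ i, ∀ q : ℤ × ℤ, latticePoint q ∉ interior (originTriangle (v i) (v (i + 1)))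

/-- `u` is the outward primitive normal vector of the triangle `{0, a, b}` at its side `{a, b}`:
it is primitive, constant on the line through `a` and `b`, and larger there than at `0`. -/
structure IsOutwardPrimitiveNormal (u a b : ℤ × ℤ) : Prop where
  primitive : IsPrimitiveVector u
  normal : u.1 * (b.1 - a.1) + u.2 * (b.2 - a.2) = 0
  outward : 0 < u.1 * a.1 + u.2 * a.2

/-! ## The base, the fibre and the orientation of the total space

The total space is a manifold modelled on the real four-dimensional vector space `ℂ × ℂ`. -/

/-- The two-sphere. -/
abbrev TwoSphere : Type := Metric.sphere (0 : EuclideanSpace ℝ (Fin 3)) 1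

/-- The two-torus. -/
abbrev TwoTorus : Type := Circle × Circle

/-- Inverse stereographic projection, a diffeomorphism from the plane onto the two-sphere minus the
north pole. -/
noncomputable def planeToSphere (z : ℂ) : TwoSphere :=
  ⟨!₂[2 * z.re / (1 + z.re ^ 2 + z.im ^ 2), 2 * z.im / (1 + z.re ^ 2 + z.im ^ 2),
      (z.re ^ 2 + z.im ^ 2 - 1) / (1 + z.re ^ 2 + z.im ^ 2)], by
    have h : 1 + z.re ^ 2 + z.im ^ 2 ≠ 0 := by positivity
    rw [mem_sphere_zero_iff_norm, EuclideanSpace.norm_eq, Real.sqrt_eq_one]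
    simp only [Fin.sum_univ_three, Real.norm_eq_abs, sq_abs]
    simp
    field_simp
    ring⟩

section TotalSpace

variable {M : Type*} [TopologicalSpace M] [ChartedSpace (ℂ × ℂ) M]

/-- All coordinate changes between charts of the given atlas preserve orientation; the atlas then
orients `M`. -/
def HasOrientedAtlas (M : Type*) [TopologicalSpace M] [ChartedSpace (ℂ × ℂ) M] : Prop :=
  ∀ e ∈ atlas (ℂ × ℂ) M, ∀ e' ∈ atlas (ℂ × ℂ) M, ∀ x ∈ (e.symm.trans e').source,
    0 < (fderiv ℝ (e' ∘ e.symm) x).det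

/-- A smooth local coordinate system `(z, w)` on `M` which is positive for the orientation given by
the atlas (where `ℂ × ℂ` carries its complex orientation). -/
def IsPositiveChart (e : OpenPartialHomeomorph M (ℂ × ℂ)) : Prop :=
  e ∈ IsManifold.maximalAtlas 𝓘(ℝ, ℂ × ℂ) ∞ M ∧
    ∀ e' ∈ atlas (ℂ × ℂ) M, ∀ x ∈ (e'.symm.trans e).source, 0 < (fderiv ℝ (e ∘ e'.symm) x).det

/-- A smooth local complex coordinate on the two-sphere. -/
def IsSphereCoordinate (c : OpenPartialHomeomorph TwoSphere ℂ) : Prop :=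
  ContMDiffOn (𝓡 2) 𝓘(ℝ, ℂ) ∞ c c.source ∧ ContMDiffOn 𝓘(ℝ, ℂ) (𝓡 2) ∞ c.symm c.target

/-! ## Torus fibrations with simple nodal fibres -/

/-- `p` is a node of sign `ε` of `f`: in a positive smooth chart `(z, w)` centred at `p` and a
smooth complex coordinate centred at `f p`, the map is `z w` if `ε = 1` and `z * conj w` if
`ε = -1`.  (Reversing the orientation of the coordinate of the sphere does not change the sign:
conjugate `z` and `w`, and swap them if `ε = -1`.) -/
def IsNode (f : M → TwoSphere) (p : M) (ε : ℤ) : Prop :=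
  ∃ (e : OpenPartialHomeomorph M (ℂ × ℂ)) (c : OpenPartialHomeomorph TwoSphere ℂ),
    IsPositiveChart e ∧ IsSphereCoordinate c ∧
    p ∈ e.source ∧ e p = 0 ∧ c (f p) = 0 ∧ (∀ x ∈ e.source, f x ∈ c.source) ∧
    ((ε = 1 ∧ ∀ x ∈ e.source, c (f x) = (e x).1 * (e x).2) ∨
      (ε = -1 ∧ ∀ x ∈ e.source, c (f x) = (e x).1 * starRingEnd ℂ (e x).2))

/-- The fibre of `f` through `p` is a simple nodal fibre of sign `ε`: `p` is a node of sign `ε`, `f`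
is a submersion at all other points of the fibre, and the fibre is a two-sphere with two points
glued together, the common image being `p`. -/
structure IsSimpleNodalFiber (f : M → TwoSphere) (p : M) (ε : ℤ) : Prop where
  node : IsNode f p ε
  submersion : ∀ x, f x = f p → x ≠ p →
    Function.Surjective (mfderiv 𝓘(ℝ, ℂ × ℂ) (𝓡 2) f x)
  nodal_sphere : ∃ (ν : TwoSphere → M) (a b : TwoSphere), Continuous ν ∧
    Set.range ν = f ⁻¹' {f p} ∧ a ≠ b ∧ ν a = p ∧ ν b = p ∧
    ∀ x y, ν x = ν y → x = y ∨ (x = a ∧ y = b) ∨ (x = b ∧ y = a)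

/-- `Φ` is a smooth trivialization of `f` over the open set `U` as a bundle of two-tori. -/
structure IsTorusTrivialization (f : M → TwoSphere) (U : Set TwoSphere)
    (Φ : OpenPartialHomeomorph (TwoSphere × TwoTorus) M) : Prop where
  isOpen_base : IsOpen U
  source_eq : Φ.source = U ×ˢ Set.univ
  target_eq : Φ.target = f ⁻¹' U
  over_base : ∀ b ∈ U, ∀ t, f (Φ (b, t)) = b
  smooth : ContMDiffOn ((𝓡 2).prod ((𝓡 1).prod (𝓡 1))) 𝓘(ℝ, ℂ × ℂ) ∞ Φ Φ.source
  smooth_symm : ContMDiffOn 𝓘(ℝ, ℂ × ℂ) ((𝓡 2).prod ((𝓡 1).prod (𝓡 1))) ∞ Φ.symm Φ.target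

/-- `f` is a smooth torus fibration over the two-sphere whose singular fibres are simple nodal
fibres with signs `±1`, with `C` as the set of nodes: the fibres through the points of `C` are
simple nodal, and off their images `f` is a smooth two-torus bundle. -/
structure IsNodalTorusFibration (f : M → TwoSphere) (C : Set M) : Prop where
  smooth : ContMDiff 𝓘(ℝ, ℂ × ℂ) (𝓡 2) ∞ f
  finite : C.Finite
  nodal : ∀ p ∈ C, IsSimpleNodalFiber f p 1 ∨ IsSimpleNodalFiber f p (-1)
  bundle : ∀ b, b ∉ f '' C → ∃ (U : Set TwoSphere)
    (Φ : OpenPartialHomeomorph (TwoSphere × TwoTorus) M), b ∈ U ∧ IsTorusTrivialization f U Φ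

/-! ## The correspondence with the vertices and edges of a legal loop -/

/-- Names for the singular fibres: `|det (u (i-1), u i)|` of them for the vertex `v i`, and
`|det (v i, v (i+1))|` of them for the edge `{v i, v (i+1)}`. -/
abbrev SingularFiberIndex {m : ℕ} [NeZero m] (v u : Fin m → ℤ × ℤ) : Type :=
  (Σ i : Fin m, Fin (latticeDet (u (i - 1)) (u i)).natAbs) ⊕
    (Σ i : Fin m, Fin (latticeDet (v i) (v (i + 1))).natAbs)

/-- The lattice class which vanishes at the singular fibre with a given name.  Over the triangles the
fibre is `(ℝ²)* / (ℤ²)*`.  The monodromy of the integral affine structure around a singular point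
attached to the vertex `v i` (resp. to the edge `{v i, v (i+1)}`) fixes the direction of `v i`
(resp. of `v (i+1) - v i`), and the vanishing class is the primitive covector that annihilates this
direction. -/
def vanishingCovector {m : ℕ} [NeZero m] (v u : Fin m → ℤ × ℤ) : SingularFiberIndex v u → ℤ × ℤ
  | Sum.inl k => (-(v k.1).2, (v k.1).1)
  | Sum.inr k => u k.1

/-- Fractions of a full turn at which the singular values with a given name lie, as seen from the
point of the base that corresponds to the origin: the vertices and edges are met in the cyclic order
`v 0, {v 0, v 1}, v 1, {v 1, v 2}, …`. -/
def angularSector {m : ℕ} [NeZero m] (v u : Fin m → ℤ × ℤ) : SingularFiberIndex v u → Set ℝ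
  | Sum.inl k => Set.Ioo ((k.1 : ℝ) / m) (((k.1 : ℝ) + 1 / 2) / m)
  | Sum.inr k => Set.Ioo (((k.1 : ℝ) + 1 / 2) / m) (((k.1 : ℝ) + 1) / m)

/-- The loop `ℓ` in the fibre over `c 0` collapses to the point `p` along the path `c` in the base:
there is a disc, made of one loop in each fibre over the path, with boundary `ℓ` and centre `p`. -/
def CollapsesAlong (f : M → TwoSphere) (c : unitInterval → TwoSphere) (ℓ : Circle → M) (p : M) :
    Prop :=
  ∃ γ : unitInterval × Circle → M, Continuous γ ∧ (∀ t θ, f (γ (t, θ)) = c t) ∧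
    (∀ θ, γ (0, θ) = ℓ θ) ∧ ∀ θ, γ (1, θ) = p

/-- The singular fibres of `f`, with nodes `p k`, belong to the vertices and edges of the loop as in
the affine surface glued from the triangles `{0, v i, v (i+1)}` and the outer parallelograms:
there is a trivialization of `f` near the point of the base that corresponds to the origin, the
singular values lie on distinct rays from this point, in the cyclic order of the vertices and edges,
and along the segment from the origin to a singular value the lattice class prescribed by the
vertex or edge vanishes. -/
def IsMarkedByLoop {m : ℕ} [NeZero m] (v u : Fin m → ℤ × ℤ) (f : M → TwoSphere)
    (p : SingularFiberIndex v u → M) : Prop :=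
  ∃ (U : Set TwoSphere) (Φ : OpenPartialHomeomorph (TwoSphere × TwoTorus) M)
    (r x : SingularFiberIndex v u → ℝ),
    planeToSphere 0 ∈ U ∧ IsTorusTrivialization f U Φ ∧
    (∀ k, 0 < r k) ∧ Function.Injective x ∧ (∀ k, x k ∈ angularSector v u k) ∧
    (∀ k, f (p k) = planeToSphere (r k * Complex.exp (2 * Real.pi * x k * Complex.I))) ∧
    ∀ k, CollapsesAlong f
      (fun t => planeToSphere ((t : ℝ) * (r k * Complex.exp (2 * Real.pi * x k * Complex.I))))
      (fun θ => Φ (planeToSphere 0,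
        (θ ^ (vanishingCovector v u k).1, θ ^ (vanishingCovector v u k).2)))
      (p k)

end TotalSpace

/-!
The total space is glued from explicit open pieces of `ℂ × ℂ`, each of which carries its own model of
the fibration.

*Pieces.*  There are two flat pieces: over the plane cut along the rays that lead from the singular
values to infinity, and over the plane around infinity cut along the rays that lead from the singular
values to the origin, the fibration is a product with the torus `ℝ² / ℤ²`.  They are compared by a
locally constant matrix in `SL₂(ℤ)`, the columns of which are the `frame` of a `MonodromyDatum`.
Near a singular value, the fibration is the family of Tate curves `ℂˣ / q ^ ℤ`, in the form
`{(z, w) | z w = q}` with `(z, w) ∼ (q z, z⁻¹)`; the fibre over `q = 0` is a sphere with two points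
identified.  Writing `log z = 2 π i α + β log q` turns the Tate curve into the torus with
coordinates `α` and `β`, and continuing `log q` around `q = 0` produces the Picard–Lefschetz
transvection in the vanishing cycle, the direction of `α` (`exists_branch`, `isTransition_flat_nodal`).  A node of sign
`-1` arises by replacing `w` by its conjugate.

*Gluing.*  The quotient is realized as the set of all labels of points of the pieces
(`LabelledGluing`), a label being the point of the base together with the point of the fibre.  A
labelled gluing in which equal labels are related by orientation preserving germs of diffeomorphisms
is a smooth manifold with an oriented atlas, so that only such germs have to be produced.  The
projection to the base is smooth with compact fibres, and both the Hausdorff property and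
compactness can be tested over small open subsets of the base.

*Monodromy of a legal loop.*  It remains to find a family of lattice bases, constant on the
sectors between the singular rays, which is changed by the prescribed transvections at these rays and
returns to itself after a full turn.  In a legal loop the side `{v i, v (i + 1)}` has lattice
distance one from the origin (`IsOutwardPrimitiveNormal.height_eq_one`).  With `J (a, b) = (-b, a)`
this gives
`J (v (i + 1)) = J (v i) - det (v i, v (i + 1)) • u i` and
`u i = u (i - 1) + det (u (i - 1), u i) • J (v i)`.
Hence the basis `(J (v i), u (i - 1))` is carried to `(J (v i), u i)` by the transvections of the
vertex `v i`, then to `(J (v (i + 1)), u i)` by those of the edge, and so on around the loop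
(`loopFrame_jump`, `loopFrame_zero`).

*Collapse.*  The vanishing cycle `|z| = const` is moved, while it approaches the singular value, to
the neck of the Tate curve, where it shrinks to the node (`collapsesAlong`).
-/

open scoped Topology

/-! ### Oriented four-manifolds glued from open subsets of `ℂ × ℂ` -/

/-- `b` is the image of `a` under a germ of orientation preserving diffeomorphism of `ℂ × ℂ` which
carries the labelling `L` near `a` to the labelling `L'` near `b`. -/
def IsTransition {S : Type} (L L' : ℂ × ℂ → S) (a b : ℂ × ℂ) : Prop :=
  ∃ g : ℂ × ℂ → ℂ × ℂ, g a = b ∧ ContDiffAt ℝ ∞ g a ∧ 0 < (fderiv ℝ g a).det ∧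
    ∀ᶠ x in 𝓝 a, L' (g x) = L x

lemma IsTransition.symm {S : Type} {L L' : ℂ × ℂ → S} {a b : ℂ × ℂ}
    (h : IsTransition L L' a b) : IsTransition L' L b a := by
  obtain ⟨g, rfl, hg, hdet, hL⟩ := h
  have hne : (∞ : WithTop ℕ∞) ≠ 0 := by simp
  set A := (fderiv ℝ g a).toContinuousLinearEquivOfDetNeZero hdet.ne' with hA
  have hd : HasFDerivAt g (A : ℂ × ℂ →L[ℝ] ℂ × ℂ) a := by
    rw [hA, ContinuousLinearMap.coe_toContinuousLinearEquivOfDetNeZero]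
    exact (hg.differentiableAt hne).hasFDerivAt
  have hs : HasStrictFDerivAt g (A : ℂ × ℂ →L[ℝ] ℂ × ℂ) a := hg.hasStrictFDerivAt' hd hne
  refine ⟨hg.localInverse hd hne, hg.localInverse_apply_image hd hne, hg.to_localInverse hd hne,
    ?_, ?_⟩
  · have h1 : HasFDerivAt (hg.localInverse hd hne) (A.symm : ℂ × ℂ →L[ℝ] ℂ × ℂ) (g a) :=
      hs.to_localInverse.hasFDerivAt
    rw [h1.fderiv]
    have h2 : (A.symm : ℂ × ℂ →L[ℝ] ℂ × ℂ).det * (A : ℂ × ℂ →L[ℝ] ℂ × ℂ).det = 1 := by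
      rw [ContinuousLinearMap.det, ContinuousLinearMap.det, ← LinearMap.det_comp]
      convert LinearMap.det_id
      ext x <;> simp
    have h3 : 0 < (A : ℂ × ℂ →L[ℝ] ℂ × ℂ).det := by rw [← hd.fderiv]; exact hdet
    by_contra hcon
    nlinarith
  · filter_upwards [hs.localInverse_tendsto.eventually hL, hs.eventually_right_inverse] with y h1 h2
    change L (hs.localInverse g A a y) = L' y
    rw [← h1, h2]

/-- Gluing data for an oriented four-manifold: open pieces `dom i` of `ℂ × ℂ`, and a labelling of
their points such that two points are to be identified if and only if their labels agree. -/
structure LabelledGluing (ι S : Type) where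
  /-- The pieces. -/
  dom : ι → Set (ℂ × ℂ)
  /-- The label of a point of a piece. -/
  label : ι → ℂ × ℂ → S
  isOpen_dom : ∀ i, IsOpen (dom i)
  nonempty : ∃ i, (dom i).Nonempty
  locally_injective : ∀ i, ∀ a ∈ dom i, ∃ V ∈ 𝓝 a, Set.InjOn (label i) V
  isTransition : ∀ i j, ∀ a ∈ dom i, ∀ b ∈ dom j, label i a = label j b →
    IsTransition (label i) (label j) a b

namespace LabelledGluing

variable {ι S : Type} (G : LabelledGluing ι S)

/-- The glued space, realized as the set of labels in use.  (It is not declared as a subtype, since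
it does not carry the topology induced from `S`.) -/
@[ext]
structure Space : Type where
  /-- The label of a point of the glued space. -/
  val : S
  exists_label_eq : ∃ i, ∃ a ∈ G.dom i, G.label i a = val

instance : Nonempty G.Space := by
  obtain ⟨i, a, ha⟩ := G.nonempty
  exact ⟨⟨_, i, a, ha, rfl⟩⟩

open Classical in
/-- The gluing map from a piece to the glued space, with a junk value off the piece. -/
noncomputable def point (i : ι) (a : ℂ × ℂ) : G.Space :=
  if h : a ∈ G.dom i then ⟨G.label i a, i, a, h, rfl⟩ else Classical.arbitrary _

variable {G}

lemma val_point {i : ι} {a : ℂ × ℂ} (h : a ∈ G.dom i) : (G.point i a).val = G.label i a := by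
  rw [point, dif_pos h]

lemma point_eq_point_iff {i j : ι} {a b : ℂ × ℂ} (ha : a ∈ G.dom i) (hb : b ∈ G.dom j) :
    G.point i a = G.point j b ↔ G.label i a = G.label j b := by
  rw [← val_point ha, ← val_point hb]
  exact Space.ext_iff

lemma exists_eq_point (x : G.Space) : ∃ i, ∃ a ∈ G.dom i, G.point i a = x := by
  obtain ⟨s, i, a, ha, rfl⟩ := x
  exact ⟨i, a, ha, Space.ext (val_point ha)⟩

/-- A set is open if its traces on all the pieces are. -/
instance : TopologicalSpace G.Space where
  IsOpen U := ∀ i, IsOpen (G.dom i ∩ G.point i ⁻¹' U)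
  isOpen_univ i := by simpa using G.isOpen_dom i
  isOpen_inter U V hU hV i := by
    have : G.dom i ∩ G.point i ⁻¹' (U ∩ V) =
        (G.dom i ∩ G.point i ⁻¹' U) ∩ (G.dom i ∩ G.point i ⁻¹' V) := by
      ext; simp; tauto
    rw [this]
    exact (hU i).inter (hV i)
  isOpen_sUnion F hF i := by
    rw [Set.preimage_sUnion, Set.inter_iUnion₂]
    exact isOpen_biUnion fun U hU => hF U hU i

lemma continuousOn_point (i : ι) : ContinuousOn (G.point i) (G.dom i) :=
  (continuousOn_open_iff (G.isOpen_dom i)).2 fun _ hU => hU i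

lemma isOpen_image_point {i : ι} {W : Set (ℂ × ℂ)} (hW : IsOpen W) (hWi : W ⊆ G.dom i) :
    IsOpen (G.point i '' W) := by
  intro j
  rw [isOpen_iff_mem_nhds]
  rintro b ⟨hb, a, ha, hab⟩
  obtain ⟨g, rfl, hg, -, hL⟩ := G.isTransition j i b hb a (hWi ha)
    ((point_eq_point_iff hb (hWi ha)).1 hab.symm)
  filter_upwards [hL, (G.isOpen_dom j).mem_nhds hb,
    hg.continuousAt.preimage_mem_nhds (hW.mem_nhds ha)] with x hx hxj hxW
  exact ⟨hxj, g x, hxW, (point_eq_point_iff (hWi hxW) hxj).2 hx⟩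

lemma injOn_point {i : ι} {V : Set (ℂ × ℂ)} (hVi : V ⊆ G.dom i)
    (hinj : Set.InjOn (G.label i) V) : Set.InjOn (G.point i) V :=
  fun _ hx _ hy h => hinj hx hy ((point_eq_point_iff (hVi hx) (hVi hy)).1 h)

/-- The inverse of the gluing map on an open set where that map is injective. -/
noncomputable def chart (i : ι) (V : Set (ℂ × ℂ)) (hV : IsOpen V) (hVi : V ⊆ G.dom i)
    (hinj : Set.InjOn (G.label i) V) : OpenPartialHomeomorph G.Space (ℂ × ℂ) :=
  (OpenPartialHomeomorph.ofContinuousOpenRestrict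
    ((injOn_point hVi hinj).toPartialEquiv (G.point i) V)
    ((continuousOn_point i).mono hVi)
    (by
      intro U hU
      have h := isOpen_image_point (G := G) (hV.isOpenMap_subtype_val U hU)
        ((Subtype.coe_image_subset V U).trans hVi)
      convert h using 1
      exact Set.image_comp (G.point i) Subtype.val U) hV).symm

section chart

variable {i : ι} {V : Set (ℂ × ℂ)} (hV : IsOpen V) (hVi : V ⊆ G.dom i)
  (hinj : Set.InjOn (G.label i) V)

lemma chart_target : (chart i V hV hVi hinj).target = V := rfl

lemma chart_source : (chart i V hV hVi hinj).source = G.point i '' V := rfl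

lemma chart_symm_apply (a : ℂ × ℂ) : (chart i V hV hVi hinj).symm a = G.point i a := rfl

lemma chart_point {a : ℂ × ℂ} (ha : a ∈ V) : chart i V hV hVi hinj (G.point i a) = a :=
  (chart i V hV hVi hinj).right_inv ha

end chart

/-- The atlas of all inverses of the gluing maps. -/
def gluedAtlas (G : LabelledGluing ι S) : Set (OpenPartialHomeomorph G.Space (ℂ × ℂ)) :=
  {e | ∃ i V hV hVi hinj, e = chart (G := G) i V hV hVi hinj}

lemma exists_chart {i : ι} {a : ℂ × ℂ} (ha : a ∈ G.dom i) :
    ∃ V, a ∈ V ∧ ∃ (hV : IsOpen V) (hVi : V ⊆ G.dom i) (hinj : Set.InjOn (G.label i) V),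
      chart i V hV hVi hinj ∈ gluedAtlas G := by
  obtain ⟨W, hW, hinj⟩ := G.locally_injective i a ha
  obtain ⟨V, hVW, hV, haV⟩ := mem_nhds_iff.1 (Filter.inter_mem hW ((G.isOpen_dom i).mem_nhds ha))
  exact ⟨V, haV, hV, fun x hx => (hVW hx).2, hinj.mono fun x hx => (hVW hx).1, _, _, _, _, _, rfl⟩

lemma exists_mem_gluedAtlas (x : G.Space) : ∃ e ∈ gluedAtlas G, x ∈ e.source := by
  obtain ⟨i, a, ha, rfl⟩ := exists_eq_point x
  obtain ⟨V, haV, hV, hVi, hinj, h⟩ := exists_chart ha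
  exact ⟨_, h, a, haV, rfl⟩

noncomputable instance : ChartedSpace (ℂ × ℂ) G.Space where
  atlas := gluedAtlas G
  chartAt x := (exists_mem_gluedAtlas x).choose
  mem_chart_source x := (exists_mem_gluedAtlas x).choose_spec.2
  chart_mem_atlas x := (exists_mem_gluedAtlas x).choose_spec.1

/-- Coordinate changes of the glued space are smooth and preserve the orientation. -/
lemma contDiffAt_coordChange {e e' : OpenPartialHomeomorph G.Space (ℂ × ℂ)}
    (he : e ∈ gluedAtlas G) (he' : e' ∈ gluedAtlas G) {x : ℂ × ℂ}
    (hx : x ∈ (e.symm.trans e').source) :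
    ContDiffAt ℝ ∞ (e' ∘ e.symm) x ∧ 0 < (fderiv ℝ (e' ∘ e.symm) x).det := by
  obtain ⟨i, V, hV, hVi, hinj, rfl⟩ := he
  obtain ⟨j, W, hW, hWj, hinj', rfl⟩ := he'
  rw [OpenPartialHomeomorph.trans_source, OpenPartialHomeomorph.symm_source, chart_target,
    chart_source] at hx
  obtain ⟨hxV, y, hyW, hxy⟩ := hx
  rw [chart_symm_apply] at hxy
  obtain ⟨g, rfl, hg, hdet, hL⟩ := G.isTransition i j x (hVi hxV) y (hWj hyW)
    ((point_eq_point_iff (hVi hxV) (hWj hyW)).1 hxy.symm)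
  have key : chart j W hW hWj hinj' ∘ (chart i V hV hVi hinj).symm =ᶠ[𝓝 x] g := by
    filter_upwards [hL, hV.mem_nhds hxV, hg.continuousAt.preimage_mem_nhds (hW.mem_nhds hyW)]
      with z hz hzV hzW
    have : G.point i z = G.point j (g z) :=
      (point_eq_point_iff (hVi hzV) (hWj hzW)).2 hz.symm
    rw [Function.comp_apply, chart_symm_apply, this, chart_point hW hWj hinj' hzW]
  exact ⟨hg.congr_of_eventuallyEq key, by rwa [key.fderiv_eq]⟩

instance : IsManifold 𝓘(ℝ, ℂ × ℂ) ∞ G.Space := by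
  refine isManifold_of_contDiffOn _ _ _ fun e e' he he' => ?_
  intro x hx
  simp only [modelWithCornersSelf_coe, modelWithCornersSelf_coe_symm, Set.range_id,
    Set.preimage_id, Set.inter_univ, Function.id_comp, Function.comp_id] at hx ⊢
  exact (contDiffAt_coordChange he he' hx).1.contDiffWithinAt

lemma hasOrientedAtlas : HasOrientedAtlas G.Space :=
  fun _ he _ he' _ hx => (contDiffAt_coordChange he he' hx).2

lemma isPositiveChart {e : OpenPartialHomeomorph G.Space (ℂ × ℂ)} (he : e ∈ gluedAtlas G) :
    IsPositiveChart e :=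
  ⟨IsManifold.subset_maximalAtlas he, fun e' he' _ hx => hasOrientedAtlas e' he' e he _ hx⟩

lemma contMDiffAt_point {i : ι} {a : ℂ × ℂ} (ha : a ∈ G.dom i) :
    ContMDiffAt 𝓘(ℝ, ℂ × ℂ) 𝓘(ℝ, ℂ × ℂ) ∞ (G.point i) a := by
  obtain ⟨V, haV, hV, hVi, hinj, h⟩ := exists_chart ha
  exact contMDiffAt_symm_of_mem_maximalAtlas (I := 𝓘(ℝ, ℂ × ℂ)) (n := ∞)
    (IsManifold.subset_maximalAtlas h) haV

/-- Smoothness of a map on the glued space can be tested on the pieces. -/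
lemma contMDiffAt_of_comp_point {E' H' N : Type*} [NormedAddCommGroup E'] [NormedSpace ℝ E']
    [TopologicalSpace H'] {I' : ModelWithCorners ℝ E' H'} [TopologicalSpace N] [ChartedSpace H' N]
    {h : G.Space → N} {i : ι} {a : ℂ × ℂ} (ha : a ∈ G.dom i)
    (hh : ContMDiffAt 𝓘(ℝ, ℂ × ℂ) I' ∞ (fun x => h (G.point i x)) a) :
    ContMDiffAt 𝓘(ℝ, ℂ × ℂ) I' ∞ h (G.point i a) := by
  obtain ⟨V, haV, hV, hVi, hinj, he⟩ := exists_chart ha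
  have h1 : ContMDiffAt 𝓘(ℝ, ℂ × ℂ) 𝓘(ℝ, ℂ × ℂ) ∞ (chart i V hV hVi hinj) (G.point i a) :=
    contMDiffAt_of_mem_maximalAtlas (I := 𝓘(ℝ, ℂ × ℂ)) (n := ∞)
      (IsManifold.subset_maximalAtlas he) ⟨a, haV, rfl⟩
  have h2 := ContMDiffAt.comp (G.point i a) (g := fun x => h (G.point i x))
    (f := chart i V hV hVi hinj) (by rwa [chart_point hV hVi hinj haV]) h1
  refine h2.congr_of_eventuallyEq ?_
  filter_upwards [(isOpen_image_point hV hVi).mem_nhds ⟨a, haV, rfl⟩]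
  rintro _ ⟨x, hx, rfl⟩
  simp [chart_point hV hVi hinj hx]

end LabelledGluing

/-! ### Orientation behaviour of germs of maps of `ℂ × ℂ` -/

/-- The map `g` is smooth at `a`, and its real Jacobian determinant there has the sign `ε`. -/
def HasJacobianSign (ε : ℤ) (g : ℂ × ℂ → ℂ × ℂ) (a : ℂ × ℂ) : Prop :=
  ContDiffAt ℝ ∞ g a ∧ 0 < (ε : ℝ) * (fderiv ℝ g a).det

lemma HasJacobianSign.comp {ε ε' : ℤ} {g f : ℂ × ℂ → ℂ × ℂ} {a : ℂ × ℂ}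
    (hg : HasJacobianSign ε g (f a)) (hf : HasJacobianSign ε' f a) :
    HasJacobianSign (ε * ε') (fun x => g (f x)) a := by
  refine ⟨hg.1.comp a hf.1, ?_⟩
  have hne : (∞ : WithTop ℕ∞) ≠ 0 := by simp
  have h := fderiv_comp a (hg.1.differentiableAt hne) (hf.1.differentiableAt hne)
  rw [Function.comp_def] at h
  rw [h, ContinuousLinearMap.det, ContinuousLinearMap.toLinearMap_comp, LinearMap.det_comp]
  have := mul_pos hg.2 hf.2
  simp only [ContinuousLinearMap.det] at this
  push_cast
  linarith

lemma det_triangular (A B D : ℂ →L[ℝ] ℂ) :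
    ((A.comp (ContinuousLinearMap.fst ℝ ℂ ℂ)).prod (B.comp (ContinuousLinearMap.fst ℝ ℂ ℂ) +
      D.comp (ContinuousLinearMap.snd ℝ ℂ ℂ))).det = A.det * D.det := by
  have hb := Complex.basisOneI
  rw [ContinuousLinearMap.det, ContinuousLinearMap.det, ContinuousLinearMap.det,
    ← LinearMap.det_toMatrix (hb.prod hb), ← LinearMap.det_toMatrix hb,
    ← LinearMap.det_toMatrix hb, ← Matrix.det_fromBlocks_zero₁₂ _ (LinearMap.toMatrix hb hb B) _]
  congr 1
  ext i j
  rcases i with i | i <;> rcases j with j | j <;> simp [LinearMap.toMatrix_apply]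

/-- A holomorphic germ with injective derivative preserves the orientation. -/
lemma hasJacobianSign_of_holomorphic {g : ℂ × ℂ → ℂ × ℂ} {a : ℂ × ℂ}
    {L : ℂ × ℂ →L[ℂ] ℂ × ℂ} (hs : ContDiffAt ℝ ∞ g a) (hg : HasFDerivAt g L a)
    (hL : ∀ v, L v = 0 → v = 0) : HasJacobianSign 1 g a := by
  refine ⟨hs, ?_⟩
  rw [(hg.restrictScalars ℝ).fderiv]
  have h : LinearMap.det (L : ℂ × ℂ →ₗ[ℂ] ℂ × ℂ) ≠ 0 := by
    intro h0
    obtain ⟨v, hv, hv0⟩ := (Submodule.ne_bot_iff _).1 (LinearMap.bot_lt_ker_of_det_eq_zero h0).ne'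
    exact hv0 (hL v hv)
  have h2 : (L.restrictScalars ℝ).det = Complex.normSq (LinearMap.det (L : ℂ × ℂ →ₗ[ℂ] ℂ × ℂ)) := by
    rw [← Algebra.norm_complex_apply, ← LinearMap.det_restrictScalars]
    rfl
  rw [h2]
  simpa using h

lemma det_restrictScalars_toSpanSingleton (c : ℂ) :
    ((ContinuousLinearMap.toSpanSingleton ℂ c).restrictScalars ℝ).det = Complex.normSq c := by
  have hb := Complex.basisOneI
  rw [ContinuousLinearMap.det, ← LinearMap.det_toMatrix Complex.basisOneI, Matrix.det_fin_two]
  simp [LinearMap.toMatrix_apply, Complex.normSq_apply]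

lemma hasJacobianSign_triangular {h : ℂ → ℂ} {k : ℂ × ℂ → ℂ} {a : ℂ × ℂ} {h' : ℂ}
    (hhs : ContDiffAt ℝ ∞ h a.1) (hks : ContDiffAt ℝ ∞ k a)
    (hh : HasDerivAt h h' a.1) (hh' : h' ≠ 0) {B D : ℂ →L[ℝ] ℂ}
    (hk : HasFDerivAt k (B.comp (ContinuousLinearMap.fst ℝ ℂ ℂ) +
      D.comp (ContinuousLinearMap.snd ℝ ℂ ℂ)) a) {ε : ℤ} (hD : 0 < (ε : ℝ) * D.det) :
    HasJacobianSign ε (fun x => (h x.1, k x)) a := by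
  refine ⟨(hhs.comp a contDiffAt_fst).prodMk hks, ?_⟩
  have h1 : HasFDerivAt (fun x : ℂ × ℂ => h x.1)
      (((ContinuousLinearMap.toSpanSingleton ℂ h').restrictScalars ℝ).comp
        (ContinuousLinearMap.fst ℝ ℂ ℂ)) a :=
    (hh.hasFDerivAt.restrictScalars ℝ).comp a hasFDerivAt_fst
  rw [(h1.prodMk hk).fderiv, det_triangular, det_restrictScalars_toSpanSingleton]
  have : 0 < Complex.normSq h' := by simpa using hh'
  nlinarith [mul_pos this hD]

/-- The real linear map of the plane that sends `1` to `a` and `I` to `b`. -/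
noncomputable def frameMap (a b : ℂ) : ℂ →L[ℝ] ℂ :=
  Complex.reCLM.smulRight a + Complex.imCLM.smulRight b

lemma frameMap_apply (a b y : ℂ) : frameMap a b y = y.re * a + y.im * b := by
  simp [frameMap]

lemma det_frameMap (a b : ℂ) : (frameMap a b).det = a.re * b.im - a.im * b.re := by
  rw [ContinuousLinearMap.det, ← LinearMap.det_toMatrix Complex.basisOneI, Matrix.det_fin_two]
  simp [LinearMap.toMatrix_apply, frameMap_apply]
  ring

/-- The identity or complex conjugation, according to the sign `ε`. -/
noncomputable def signConj (ε : ℤ) (w : ℂ) : ℂ := if ε = 1 then w else starRingEnd ℂ w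

lemma signConj_signConj (ε : ℤ) (w : ℂ) : signConj ε (signConj ε w) = w := by
  unfold signConj; split_ifs <;> simp

lemma norm_signConj (ε : ℤ) (w : ℂ) : ‖signConj ε w‖ = ‖w‖ := by
  unfold signConj; split_ifs <;> simp

lemma signConj_zero (ε : ℤ) : signConj ε 0 = 0 := by
  unfold signConj; split_ifs <;> simp

lemma contDiff_signConj (ε : ℤ) : ContDiff ℝ ∞ (signConj ε) := by
  unfold signConj
  split_ifs
  · exact contDiff_id
  · exact Complex.conjCLE.contDiff

lemma continuous_signConj (ε : ℤ) : Continuous (signConj ε) := (contDiff_signConj ε).continuous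

lemma hasJacobianSign_signConj {ε : ℤ} (hε : ε = 1 ∨ ε = -1) (a : ℂ × ℂ) :
    HasJacobianSign ε (fun x => (x.1, signConj ε x.2)) a := by
  refine hasJacobianSign_triangular (h := fun z => z) (h' := 1) contDiffAt_id
    ((contDiff_signConj ε).contDiffAt.comp a contDiffAt_snd) (hasDerivAt_id _) one_ne_zero
    (B := 0) (D := frameMap 1 (signConj ε Complex.I)) ?_ ?_
  · have h : (fun x : ℂ × ℂ => signConj ε x.2) = fun x => frameMap 1 (signConj ε Complex.I) x.2 := by
      ext x
      rcases hε with rfl | rfl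
      · simp [signConj, frameMap_apply]
      · apply Complex.ext <;> simp [signConj, frameMap_apply]
    change HasFDerivAt (fun x : ℂ × ℂ => signConj ε x.2) _ a
    rw [h]
    rw [ContinuousLinearMap.zero_comp, zero_add]
    exact (frameMap 1 (signConj ε Complex.I)).hasFDerivAt.comp a hasFDerivAt_snd
  · rw [det_frameMap]
    rcases hε with rfl | rfl <;> simp [signConj]

/-! ### Stereographic coordinates on the two-sphere -/

/-- The third coordinate of the centre of the stereographic projection `i`: the projection `false`
is centred at the north pole and the projection `true` at the south pole. -/
def poleSign (i : Bool) : ℝ := if i then -1 else 1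

lemma poleSign_sq (i : Bool) : poleSign i ^ 2 = 1 := by cases i <;> simp [poleSign]

lemma poleSign_mul_self (i : Bool) : poleSign i * poleSign i = 1 := by cases i <;> simp [poleSign]

/-- The two inverse stereographic projections.  They are related by `b ↦ b⁻¹`, see
`stereo_false_eq_stereo_true_iff`. -/
noncomputable def stereo (i : Bool) (z : ℂ) : TwoSphere :=
  ⟨!₂[2 * z.re / (1 + z.re ^ 2 + z.im ^ 2), poleSign i * (2 * z.im / (1 + z.re ^ 2 + z.im ^ 2)),
      poleSign i * ((z.re ^ 2 + z.im ^ 2 - 1) / (1 + z.re ^ 2 + z.im ^ 2))], by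
    have h : 1 + z.re ^ 2 + z.im ^ 2 ≠ 0 := by positivity
    rw [mem_sphere_zero_iff_norm, EuclideanSpace.norm_eq, Real.sqrt_eq_one]
    simp only [Fin.sum_univ_three, Real.norm_eq_abs, sq_abs]
    simp [mul_pow, poleSign_sq]
    field_simp
    ring⟩

lemma stereo_false (z : ℂ) : stereo false z = planeToSphere z := by
  apply Subtype.ext
  simp [stereo, planeToSphere, poleSign]

/-- Stereographic projection, inverse to `stereo i` off the centre of projection. -/
noncomputable def stereoInv (i : Bool) (p : TwoSphere) : ℂ :=
  ⟨p.1 0 / (1 - poleSign i * p.1 2), poleSign i * p.1 1 / (1 - poleSign i * p.1 2)⟩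

lemma stereo_zero (i : Bool) (z : ℂ) :
    (stereo i z).1 0 = 2 * z.re / (1 + z.re ^ 2 + z.im ^ 2) := rfl

lemma stereo_one (i : Bool) (z : ℂ) :
    (stereo i z).1 1 = poleSign i * (2 * z.im / (1 + z.re ^ 2 + z.im ^ 2)) := rfl

lemma stereo_two (i : Bool) (z : ℂ) :
    (stereo i z).1 2 = poleSign i * ((z.re ^ 2 + z.im ^ 2 - 1) / (1 + z.re ^ 2 + z.im ^ 2)) := rfl

lemma one_sub_stereo_two (i : Bool) (z : ℂ) :
    1 - poleSign i * (stereo i z).1 2 = 2 / (1 + z.re ^ 2 + z.im ^ 2) := by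
  have h : 1 + z.re ^ 2 + z.im ^ 2 ≠ 0 := by positivity
  rw [stereo_two, ← mul_assoc, poleSign_mul_self]
  field_simp
  ring

lemma one_sub_stereo_two_ne (i : Bool) (z : ℂ) : 1 - poleSign i * (stereo i z).1 2 ≠ 0 := by
  rw [one_sub_stereo_two]; positivity

lemma stereoInv_stereo (i : Bool) (z : ℂ) : stereoInv i (stereo i z) = z := by
  have h : 1 + z.re ^ 2 + z.im ^ 2 ≠ 0 := by positivity
  apply Complex.ext
  · simp only [stereoInv, one_sub_stereo_two, stereo_zero]
    field_simp
  · simp only [stereoInv, one_sub_stereo_two, stereo_one, ← mul_assoc, poleSign_mul_self]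
    field_simp

lemma stereo_injective (i : Bool) : Function.Injective (stereo i) :=
  Function.LeftInverse.injective (stereoInv_stereo i)

lemma sphere_equation (p : TwoSphere) : p.1 0 ^ 2 + p.1 1 ^ 2 + p.1 2 ^ 2 = 1 := by
  have h := p.2
  rw [mem_sphere_zero_iff_norm, EuclideanSpace.norm_eq, Real.sqrt_eq_one] at h
  simpa [Fin.sum_univ_three] using h

lemma stereo_stereoInv (i : Bool) {p : TwoSphere} (hp : 1 - poleSign i * p.1 2 ≠ 0) :
    stereo i (stereoInv i p) = p := by
  have h := sphere_equation p
  have hs := poleSign_sq i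
  have hd : 1 + (stereoInv i p).re ^ 2 + (stereoInv i p).im ^ 2 = 2 / (1 - poleSign i * p.1 2) := by
    simp only [stereoInv]
    field_simp
    linear_combination h + (p.1 1 ^ 2 + p.1 2 ^ 2) * hs
  have hm : (stereoInv i p).re ^ 2 + (stereoInv i p).im ^ 2 - 1
      = 2 / (1 - poleSign i * p.1 2) - 2 := by rw [← hd]; ring
  apply Subtype.ext
  ext j
  fin_cases j
  · change (stereo i (stereoInv i p)).1 0 = p.1 0
    rw [stereo_zero, hd]
    simp only [stereoInv]
    field_simp
  · change (stereo i (stereoInv i p)).1 1 = p.1 1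
    rw [stereo_one, hd]
    simp only [stereoInv]
    field_simp
    linear_combination p.1 1 * hs
  · change (stereo i (stereoInv i p)).1 2 = p.1 2
    rw [stereo_two, hd, hm]
    field_simp
    linear_combination p.1 2 * hs

lemma exists_eq_stereo (p : TwoSphere) :
    (∃ b, p = stereo false b) ∨ p = stereo true 0 := by
  by_cases hp : 1 - poleSign false * p.1 2 = 0
  · right
    have h2 : p.1 2 = 1 := by simp [poleSign] at hp; linarith
    have h := sphere_equation p
    rw [← stereo_stereoInv true (p := p) (by rw [h2]; norm_num [poleSign])]
    congr 1
    have h0 : p.1 0 = 0 := by nlinarith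
    have h1 : p.1 1 = 0 := by nlinarith
    apply Complex.ext <;> simp [stereoInv, h0, h1]
  · exact Or.inl ⟨_, (stereo_stereoInv false hp).symm⟩

lemma stereo_true_zero_ne (b : ℂ) : stereo true 0 ≠ stereo false b := by
  intro h
  apply one_sub_stereo_two_ne false b
  rw [← h, stereo_two]
  simp [poleSign]

/-- Exchanging the two poles amounts to the inversion of the stereographic coordinate. -/
lemma stereo_not {z : ℂ} (hz : z ≠ 0) (i : Bool) : stereo (!i) z⁻¹ = stereo i z := by
  have hn : z.re ^ 2 + z.im ^ 2 ≠ 0 := by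
    have := Complex.normSq_pos.2 hz
    rw [Complex.normSq_apply] at this
    nlinarith
  have h : 1 + z.re ^ 2 + z.im ^ 2 ≠ 0 := by positivity
  have hd : 1 + (z⁻¹).re ^ 2 + (z⁻¹).im ^ 2
      = (1 + z.re ^ 2 + z.im ^ 2) / (z.re ^ 2 + z.im ^ 2) := by
    rw [Complex.inv_re, Complex.inv_im, Complex.normSq_apply, ← pow_two, ← pow_two]
    field_simp
    ring
  have hm : (z⁻¹).re ^ 2 + (z⁻¹).im ^ 2 - 1
      = (1 + z.re ^ 2 + z.im ^ 2) / (z.re ^ 2 + z.im ^ 2) - 2 := by rw [← hd]; ring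
  have hp : poleSign (!i) = - poleSign i := by cases i <;> simp [poleSign]
  apply Subtype.ext
  ext j
  fin_cases j
  · change (stereo (!i) z⁻¹).1 0 = (stereo i z).1 0
    rw [stereo_zero, stereo_zero, hd, Complex.inv_re, Complex.normSq_apply, ← pow_two, ← pow_two]
    field_simp
  · change (stereo (!i) z⁻¹).1 1 = (stereo i z).1 1
    rw [stereo_one, stereo_one, hd, Complex.inv_im, Complex.normSq_apply, ← pow_two, ← pow_two, hp]
    field_simp
  · change (stereo (!i) z⁻¹).1 2 = (stereo i z).1 2
    rw [stereo_two, stereo_two, hd, hm, hp]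
    field_simp
    ring

lemma stereo_false_eq_stereo_true_iff {b b' : ℂ} :
    stereo false b = stereo true b' ↔ b * b' = 1 := by
  constructor
  · intro h
    have hb' : b' ≠ 0 := by
      rintro rfl
      exact stereo_true_zero_ne b h.symm
    rw [← stereo_not hb' true] at h
    rw [stereo_injective _ h, inv_mul_cancel₀ hb']
  · intro h
    have hb' : b' ≠ 0 := right_ne_zero_of_mul_eq_one h
    rw [← stereo_not hb' true, eq_inv_of_mul_eq_one_left h, Bool.not_true]

lemma contMDiff_stereo (i : Bool) : ContMDiff 𝓘(ℝ, ℂ) (𝓡 2) ∞ (stereo i) := by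
  have := Fact.mk (@finrank_euclideanSpace_fin ℝ _ (2 + 1))
  refine ContMDiff.codRestrict_sphere (n := 2)
    (f := fun z => (stereo i z : EuclideanSpace ℝ (Fin 3))) ?_ fun z => (stereo i z).2
  rw [contMDiff_iff_contDiff, contDiff_euclidean]
  have hre : ContDiff ℝ ∞ Complex.re := Complex.reCLM.contDiff
  have him : ContDiff ℝ ∞ Complex.im := Complex.imCLM.contDiff
  have hd : ContDiff ℝ ∞ fun z : ℂ => 1 + z.re ^ 2 + z.im ^ 2 :=
    (contDiff_const.add (hre.pow 2)).add (him.pow 2)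
  have hne : ∀ z : ℂ, 1 + z.re ^ 2 + z.im ^ 2 ≠ 0 := fun z => by positivity
  intro j
  fin_cases j
  · exact (contDiff_const.mul hre).div hd hne
  · exact contDiff_const.mul ((contDiff_const.mul him).div hd hne)
  · exact contDiff_const.mul ((((hre.pow 2).add (him.pow 2)).sub contDiff_const).div hd hne)

lemma continuous_stereo (i : Bool) : Continuous (stereo i) := (contMDiff_stereo i).continuous

lemma contMDiffAt_stereoInv (i : Bool) {p : TwoSphere} (hp : 1 - poleSign i * p.1 2 ≠ 0) :
    ContMDiffAt (𝓡 2) 𝓘(ℝ, ℂ) ∞ (stereoInv i) p := by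
  have := Fact.mk (@finrank_euclideanSpace_fin ℝ _ (2 + 1))
  have hc : ∀ j : Fin 3, ContDiff ℝ ∞ fun v : EuclideanSpace ℝ (Fin 3) => v j :=
    fun j => contDiff_euclidean.1 contDiff_id j
  have hd : ContDiff ℝ ∞ fun v : EuclideanSpace ℝ (Fin 3) => 1 - poleSign i * v 2 :=
    contDiff_const.sub (contDiff_const.mul (hc 2))
  have h : ContDiffAt ℝ ∞ (fun v : EuclideanSpace ℝ (Fin 3) =>
      ((v 0 / (1 - poleSign i * v 2) : ℝ) : ℂ) +
        ((poleSign i * v 1 / (1 - poleSign i * v 2) : ℝ) : ℂ) * Complex.I) p.1 := by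
    refine ContDiffAt.add ?_ (ContDiffAt.mul ?_ contDiffAt_const)
    · exact Complex.ofRealCLM.contDiff.contDiffAt.comp p.1
        ((hc 0).contDiffAt.div hd.contDiffAt hp)
    · exact Complex.ofRealCLM.contDiff.contDiffAt.comp p.1
        ((contDiff_const.mul (hc 1)).contDiffAt.div hd.contDiffAt hp)
  have h2 := h.contMDiffAt.comp p (contMDiff_coe_sphere (n := 2) p)
  refine h2.congr_of_eventuallyEq (Filter.Eventually.of_forall fun q => ?_)
  apply Complex.ext <;> simp [stereoInv, -Complex.ofReal_div]

lemma contMDiffAt_stereoInv_stereo (i : Bool) (b : ℂ) :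
    ContMDiffAt (𝓡 2) 𝓘(ℝ, ℂ) ∞ (stereoInv i) (stereo i b) :=
  contMDiffAt_stereoInv i (one_sub_stereo_two_ne i b)

lemma isOpen_image_stereo (i : Bool) {U : Set ℂ} (hU : IsOpen U) : IsOpen (stereo i '' U) := by
  rw [isOpen_iff_mem_nhds]
  rintro _ ⟨b, hb, rfl⟩
  have hc : Continuous fun p : TwoSphere => 1 - poleSign i * p.1 2 := by fun_prop
  filter_upwards [(contMDiffAt_stereoInv_stereo i b).continuousAt.preimage_mem_nhds
      (by rw [stereoInv_stereo]; exact hU.mem_nhds hb),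
    (hc.continuousAt (x := stereo i b)).eventually_ne (one_sub_stereo_two_ne i b)] with p hp hp'
  exact ⟨_, hp, stereo_stereoInv i hp'⟩

/-! ### The exponential map of the two-torus -/

/-- A lattice point as a Gaussian integer. -/
def gaussian (m : ℤ × ℤ) : ℂ := (m.1 : ℂ) + m.2 * Complex.I

lemma gaussian_re (m : ℤ × ℤ) : (gaussian m).re = m.1 := by simp [gaussian]

lemma gaussian_im (m : ℤ × ℤ) : (gaussian m).im = m.2 := by simp [gaussian]

/-- The universal covering of the two-torus by the plane.  The coordinates are exchanged; this makes
the orientation of `ℂ` the one for which the vanishing cycles have the prescribed signs. -/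
noncomputable def torusExp (y : ℂ) : TwoTorus :=
  (Circle.exp (2 * Real.pi * y.im), Circle.exp (2 * Real.pi * y.re))

lemma torusExp_add (y y' : ℂ) : torusExp (y + y') = torusExp y * torusExp y' := by
  simp [torusExp, mul_add, Circle.exp_add]

lemma torusExp_eq_one_iff (y : ℂ) :
    torusExp y = 1 ↔ ∃ m : ℤ × ℤ, y = gaussian m := by
  have h2 : ∀ x : ℝ, Circle.exp (2 * Real.pi * x) = 1 ↔ ∃ n : ℤ, x = n := by
    intro x
    rw [Circle.exp_eq_one]
    have : Real.pi ≠ 0 := Real.pi_ne_zero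
    refine exists_congr fun n => ⟨fun h => ?_, fun h => by rw [h]; ring⟩
    have : (2 * Real.pi) * x = (2 * Real.pi) * n := by linarith
    exact mul_left_cancel₀ (by positivity) this
  rw [torusExp, Prod.mk_eq_one, h2, h2]
  constructor
  · rintro ⟨⟨a, ha⟩, b, hb⟩
    exact ⟨(b, a), Complex.ext (by simp [hb, gaussian_re]) (by simp [ha, gaussian_im])⟩
  · rintro ⟨m, rfl⟩
    exact ⟨⟨m.2, gaussian_im m⟩, m.1, gaussian_re m⟩

lemma torusExp_eq_iff (y y' : ℂ) :
    torusExp y = torusExp y' ↔ ∃ m : ℤ × ℤ, y - y' = gaussian m := by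
  rw [← torusExp_eq_one_iff]
  have h : torusExp y = torusExp (y - y') * torusExp y' := by rw [← torusExp_add]; simp
  rw [h]
  exact mul_eq_right

lemma contMDiff_torusExp : ContMDiff 𝓘(ℝ, ℂ) ((𝓡 1).prod (𝓡 1)) ∞ torusExp := by
  refine ContMDiff.prodMk ?_ ?_
  · exact contMDiff_circleExp.comp
      (contDiff_const.mul Complex.imCLM.contDiff : ContDiff ℝ ∞ fun y : ℂ => _ * y.im).contMDiff
  · exact contMDiff_circleExp.comp
      (contDiff_const.mul Complex.reCLM.contDiff : ContDiff ℝ ∞ fun y : ℂ => _ * y.re).contMDiff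

lemma continuous_torusExp : Continuous torusExp := contMDiff_torusExp.continuous

/-- The lift of the circle to the line which is smooth near `Circle.exp θ` and has the value `θ`
there. -/
noncomputable def circleLift (θ : ℝ) (z : Circle) : ℝ :=
  θ + Complex.arg ((z * (Circle.exp θ)⁻¹ : Circle) : ℂ)

lemma exp_circleLift (θ : ℝ) (z : Circle) : Circle.exp (circleLift θ z) = z := by
  rw [circleLift, Circle.exp_add, Circle.exp_arg]
  simp

lemma contMDiffAt_circleLift (θ : ℝ) :
    ContMDiffAt (𝓡 1) 𝓘(ℝ, ℝ) ∞ (circleLift θ) (Circle.exp θ) := by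
  have h1 : ContMDiffAt (𝓡 1) 𝓘(ℝ, ℂ) ∞ (fun z : Circle => ((z * (Circle.exp θ)⁻¹ : Circle) : ℂ))
      (Circle.exp θ) := by
    have := finrank_real_complex_fact'
    have h : ContMDiff (𝓡 1) 𝓘(ℝ, ℂ) ∞ (fun z : Circle => (z : ℂ)) :=
      contMDiff_coe_sphere (n := 1)
    have h' := (contDiff_id.mul contDiff_const :
      ContDiff ℝ ∞ fun z : ℂ => z * ((Circle.exp θ)⁻¹ : Circle)).contMDiff.comp h
    simpa [Function.comp_def] using h'.contMDiffAt (x := Circle.exp θ)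
  have h2 : ContDiffAt ℝ ∞ (fun z : ℂ => θ + Complex.imCLM (Complex.log z))
      ((Circle.exp θ * (Circle.exp θ)⁻¹ : Circle) : ℂ) := by
    refine contDiffAt_const.add (Complex.imCLM.contDiff.contDiffAt.comp _ ?_)
    refine ContDiffAt.restrict_scalars ℝ (Complex.contDiffAt_log ?_)
    simp
  have h3 := h2.contMDiffAt.comp (Circle.exp θ) h1
  refine h3.congr_of_eventuallyEq (Filter.Eventually.of_forall fun z => ?_)
  simp [circleLift, Complex.log_im]

/-- The lift of the torus to the plane which is smooth near `torusExp y` and has the value `y`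
there. -/
noncomputable def torusLift (y : ℂ) (t : TwoTorus) : ℂ :=
  (circleLift (2 * Real.pi * y.re) t.2 / (2 * Real.pi) : ℝ) +
    (circleLift (2 * Real.pi * y.im) t.1 / (2 * Real.pi) : ℝ) * Complex.I

lemma torusExp_torusLift (y : ℂ) (t : TwoTorus) : torusExp (torusLift y t) = t := by
  have hp : Real.pi ≠ 0 := Real.pi_ne_zero
  have h : ∀ x : ℝ, 2 * Real.pi * (x / (2 * Real.pi)) = x := fun x => by field_simp
  ext <;> simp [torusExp, torusLift, -Complex.ofReal_div, h, exp_circleLift]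

lemma contMDiffAt_torusLift (y : ℂ) :
    ContMDiffAt ((𝓡 1).prod (𝓡 1)) 𝓘(ℝ, ℂ) ∞ (torusLift y) (torusExp y) := by
  have h1 : ContMDiffAt ((𝓡 1).prod (𝓡 1)) 𝓘(ℝ, ℝ) ∞
      (fun t : TwoTorus => circleLift (2 * Real.pi * y.im) t.1) (torusExp y) :=
    ContMDiffAt.comp (torusExp y) (g := circleLift (2 * Real.pi * y.im)) (f := Prod.fst)
      (contMDiffAt_circleLift (2 * Real.pi * y.im)) contMDiffAt_fst
  have h2 : ContMDiffAt ((𝓡 1).prod (𝓡 1)) 𝓘(ℝ, ℝ) ∞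
      (fun t : TwoTorus => circleLift (2 * Real.pi * y.re) t.2) (torusExp y) :=
    ContMDiffAt.comp (torusExp y) (g := circleLift (2 * Real.pi * y.re)) (f := Prod.snd)
      (contMDiffAt_circleLift (2 * Real.pi * y.re)) contMDiffAt_snd
  have h3 : ContDiff ℝ ∞ fun x : ℝ × ℝ =>
      ((x.1 / (2 * Real.pi) : ℝ) : ℂ) + ((x.2 / (2 * Real.pi) : ℝ) : ℂ) * Complex.I :=
    (Complex.ofRealCLM.contDiff.comp (contDiff_fst.div_const _)).add
      ((Complex.ofRealCLM.contDiff.comp (contDiff_snd.div_const _)).mul contDiff_const)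
  exact h3.contMDiff.contMDiffAt.comp (torusExp y) (h2.prodMk_space h1)

/-- Unimodular frames respect the lattice. -/
lemma frameMap_gaussian_eq_gaussian_iff {a b : ℤ × ℤ} (h : latticeDet a b = 1 ∨ latticeDet a b = -1)
    (y : ℂ) : (∃ m, frameMap (gaussian a) (gaussian b) y = gaussian m) ↔ ∃ m, y = gaussian m := by
  have hsq : ((a.1 : ℝ) * b.2 - a.2 * b.1) * (latticeDet a b : ℝ) = 1 := by
    have h' : (latticeDet a b : ℝ) = (a.1 : ℝ) * b.2 - a.2 * b.1 := by simp [latticeDet]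
    rw [← h']
    rcases h with h | h <;> simp [h]
  constructor
  · rintro ⟨m, hm⟩
    have hre := congrArg Complex.re hm
    have him := congrArg Complex.im hm
    simp only [frameMap_apply, Complex.add_re, Complex.add_im, Complex.re_ofReal_mul,
      Complex.im_ofReal_mul, gaussian_re, gaussian_im] at hre him
    refine ⟨(latticeDet a b * latticeDet m b, latticeDet a b * latticeDet a m), Complex.ext ?_ ?_⟩
    · rw [gaussian_re]
      simp only [latticeDet, Int.cast_mul, Int.cast_sub] at hsq ⊢
      linear_combination (-y.re) * hsq + ((a.1 : ℝ) * b.2 - a.2 * b.1) * (b.2 * hre - b.1 * him)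
    · rw [gaussian_im]
      simp only [latticeDet, Int.cast_mul, Int.cast_sub] at hsq ⊢
      linear_combination (-y.im) * hsq + ((a.1 : ℝ) * b.2 - a.2 * b.1) * (a.1 * him - a.2 * hre)
  · rintro ⟨m, rfl⟩
    refine ⟨(m.1 * a.1 + m.2 * b.1, m.1 * a.2 + m.2 * b.2), Complex.ext ?_ ?_⟩ <;>
      simp [frameMap_apply, gaussian_re, gaussian_im]

lemma torusExp_frameMap_eq_iff {a b : ℤ × ℤ} (h : latticeDet a b = 1 ∨ latticeDet a b = -1)
    (y y' : ℂ) : torusExp (frameMap (gaussian a) (gaussian b) y) =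
      torusExp (frameMap (gaussian a) (gaussian b) y') ↔ torusExp y = torusExp y' := by
  rw [torusExp_eq_iff, torusExp_eq_iff, ← map_sub, frameMap_gaussian_eq_gaussian_iff h]

lemma torusExp_add_gaussian (y : ℂ) (m : ℤ × ℤ) : torusExp (y + gaussian m) = torusExp y := by
  rw [torusExp_eq_iff]; exact ⟨m, by ring⟩

/-- The covering of the torus is injective on small sets. -/
lemma eq_of_torusExp_eq {y y' : ℂ} (h : torusExp y = torusExp y') (hd : dist y y' < 1) :
    y = y' := by
  obtain ⟨m, hm⟩ := (torusExp_eq_iff y y').1 h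
  rw [Complex.dist_eq, hm] at hd
  have h1 := (Complex.abs_re_le_norm (gaussian m)).trans_lt hd
  have h2 := (Complex.abs_im_le_norm (gaussian m)).trans_lt hd
  rw [gaussian_re] at h1
  rw [gaussian_im] at h2
  have h3 : m.1 = 0 := Int.abs_lt_one_iff.1 (by exact_mod_cast h1)
  have h4 : m.2 = 0 := Int.abs_lt_one_iff.1 (by exact_mod_cast h2)
  rw [← sub_eq_zero, hm]
  simp [gaussian, h3, h4]

/-! ### The pieces of the total space and the identifications between them -/

/-- The Picard–Lefschetz transformation with vanishing cycle `c` and sign `ε`. -/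
def picardLefschetz (ε : ℤ) (c x : ℤ × ℤ) : ℤ × ℤ :=
  (x.1 + ε * latticeDet c x * c.1, x.2 + ε * latticeDet c x * c.2)

/-- The combinatorial data of a torus fibration over the two-sphere with one nodal fibre over each of
the points `dir k` of the unit circle.  Off the rays through these points, the trivialization near
the origin (extended along the rays from `0`) and the one near infinity differ by the unimodular
matrix with columns `frame b`, which is multiplied by a Picard–Lefschetz transformation when `b`
crosses a ray. -/
structure MonodromyDatum (K : Type) where
  /-- The singular values. -/
  dir : K → ℂ
  norm_dir : ∀ k, ‖dir k‖ = 1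
  /-- The signs of the nodes. -/
  sign : K → ℤ
  sign_eq : ∀ k, sign k = 1 ∨ sign k = -1
  /-- The vanishing cycles. -/
  cycle : K → ℤ × ℤ
  /-- Complements of the vanishing cycles to bases of the lattice. -/
  cocycle : K → ℤ × ℤ
  det_cycle : ∀ k, latticeDet (cycle k) (cocycle k) = sign k
  /-- The coordinate `q` of the base near `dir k` is given by `b = dir k * exp (- scale * q)`. -/
  scale : ℝ
  scale_pos : 0 < scale
  scale_le : scale ≤ 1
  disjoint : ∀ k l q q', ‖q‖ < 1 / 8 → ‖q'‖ < 1 / 8 →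
    dir k * Complex.exp (-(scale * q)) = dir l * Complex.exp (-(scale * q')) → k = l
  /-- The columns of the transition matrix between the flat pieces. -/
  frame : ℂ → (ℤ × ℤ) × (ℤ × ℤ)
  det_frame : ∀ b, latticeDet (frame b).1 (frame b).2 = 1
  frame_eventually : ∀ b, b ≠ 0 → (∀ k, ∀ r : ℝ, 0 < r → b ≠ r * dir k) →
    ∀ᶠ b' in 𝓝 b, frame b' = frame b
  frame_of_nonneg : ∀ k q, ‖q‖ < 1 / 8 → 0 ≤ q.im →
    frame (dir k * Complex.exp (-(scale * q))) = frame (dir k)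
  frame_of_neg : ∀ k q, ‖q‖ < 1 / 8 → q.im < 0 →
    frame (dir k * Complex.exp (-(scale * q))) =
      (picardLefschetz (sign k) (cycle k) (frame (dir k)).1,
        picardLefschetz (sign k) (cycle k) (frame (dir k)).2)

namespace MonodromyDatum

variable {K : Type} (D : MonodromyDatum K)

/-- The singular values in the two stereographic coordinates. -/
noncomputable def flatDir (i : Bool) (k : K) : ℂ :=
  if i then starRingEnd ℂ (D.dir k) else D.dir k

/-- The point of the base with coordinate `q` near the singular value `k`, in the stereographic
coordinate `i`. -/
noncomputable def basePoint (i : Bool) (k : K) (q : ℂ) : ℂ :=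
  D.flatDir i k * Complex.exp (-(poleSign i * D.scale * q))

lemma conj_dir (k : K) : starRingEnd ℂ (D.dir k) = (D.dir k)⁻¹ := by
  rw [Complex.inv_def, Complex.normSq_eq_norm_sq, D.norm_dir]
  simp

lemma dir_ne_zero (k : K) : D.dir k ≠ 0 := by
  intro h
  have := D.norm_dir k
  simp [h] at this

lemma norm_flatDir (i : Bool) (k : K) : ‖D.flatDir i k‖ = 1 := by
  unfold flatDir; split_ifs <;> simp [D.norm_dir]

lemma flatDir_mul_conj (i : Bool) (k : K) : D.flatDir i k * starRingEnd ℂ (D.flatDir i k) = 1 := by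
  rw [Complex.mul_conj, Complex.normSq_eq_norm_sq, norm_flatDir]
  simp

lemma flatDir_ne_zero (i : Bool) (k : K) : D.flatDir i k ≠ 0 :=
  left_ne_zero_of_mul_eq_one (D.flatDir_mul_conj i k)

lemma basePoint_mul_conj (i : Bool) (k : K) (q : ℂ) :
    D.basePoint i k q * starRingEnd ℂ (D.flatDir i k) =
      Complex.exp (-(poleSign i * D.scale * q)) := by
  rw [basePoint, mul_right_comm, flatDir_mul_conj, one_mul]

lemma basePoint_zero (i : Bool) (k : K) : D.basePoint i k 0 = D.flatDir i k := by
  simp [basePoint]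

lemma basePoint_false (k : K) (q : ℂ) :
    D.basePoint false k q = D.dir k * Complex.exp (-(D.scale * q)) := by
  simp [basePoint, flatDir, poleSign]

lemma basePoint_true (k : K) (q : ℂ) : D.basePoint true k q = (D.basePoint false k q)⁻¹ := by
  simp [basePoint, flatDir, poleSign, conj_dir, ← Complex.exp_neg, mul_comm]

lemma basePoint_ne_zero (i : Bool) (k : K) (q : ℂ) : D.basePoint i k q ≠ 0 :=
  mul_ne_zero (D.flatDir_ne_zero i k) (Complex.exp_ne_zero _)

lemma stereo_basePoint (i : Bool) (k : K) (q : ℂ) :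
    stereo i (D.basePoint i k q) = stereo false (D.basePoint false k q) := by
  cases i
  · rfl
  · rw [basePoint_true]
    exact stereo_not (D.basePoint_ne_zero false k q) false

lemma stereo_eq_iff (i : Bool) (k : K) (q b : ℂ) :
    stereo i b = stereo false (D.basePoint false k q) ↔ b = D.basePoint i k q := by
  rw [← D.stereo_basePoint i]
  exact (stereo_injective i).eq_iff

/-- A flat piece: a star-shaped part of the plane, times the universal covering of the torus. -/
def flatDom (i : Bool) : Set (ℂ × ℂ) :=
  {x | ∀ k, 1 - x.1 * starRingEnd ℂ (D.flatDir i k) ∈ Complex.slitPlane}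

lemma isOpen_flatDom [Finite K] (i : Bool) : IsOpen (D.flatDom i) := by
  have : D.flatDom i = ⋂ k, (fun x : ℂ × ℂ => 1 - x.1 * starRingEnd ℂ (D.flatDir i k)) ⁻¹'
      Complex.slitPlane := by ext; simp [flatDom]
  rw [this]
  exact isOpen_iInter_of_finite fun k => Complex.isOpen_slitPlane.preimage (by fun_prop)

lemma ne_mul_flatDir {i : Bool} {x : ℂ × ℂ} (hx : x ∈ D.flatDom i) (k : K) {r : ℝ} (hr : 1 ≤ r) :
    x.1 ≠ r * D.flatDir i k := by
  intro h
  have := hx k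
  rw [h, mul_assoc, flatDir_mul_conj, mul_one, ← Complex.ofReal_one, ← Complex.ofReal_sub,
    Complex.ofReal_mem_slitPlane] at this
  linarith

/-- The frame with respect to which a flat piece is trivialized. -/
noncomputable def flatFrame (i : Bool) (b : ℂ) : (ℤ × ℤ) × (ℤ × ℤ) :=
  if i then D.frame b⁻¹ else ((1, 0), (0, 1))

/-- The real linear map with columns a pair of lattice vectors. -/
noncomputable def latticeMap (f : (ℤ × ℤ) × (ℤ × ℤ)) : ℂ →L[ℝ] ℂ :=
  frameMap (gaussian f.1) (gaussian f.2)

lemma det_flatFrame (i : Bool) (b : ℂ) :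
    latticeDet (D.flatFrame i b).1 (D.flatFrame i b).2 = 1 := by
  unfold flatFrame
  split_ifs
  · exact D.det_frame _
  · rfl

lemma latticeMap_flatFrame_false (b y : ℂ) : latticeMap (D.flatFrame false b) y = y := by
  apply Complex.ext <;> simp [latticeMap, flatFrame, frameMap_apply, gaussian]

/-- Labels of the points of the flat pieces: the point of the base, and the point of the fibre in the
trivialization near the origin. -/
noncomputable def flatLabel (i : Bool) (x : ℂ × ℂ) : TwoSphere × TwoTorus × ℂ :=
  (stereo i x.1, torusExp (latticeMap (D.flatFrame i x.1) x.2), 0)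

lemma flatLabel_eq_iff (i : Bool) (x y : ℂ × ℂ) :
    D.flatLabel i x = D.flatLabel i y ↔ x.1 = y.1 ∧ torusExp x.2 = torusExp y.2 := by
  simp only [flatLabel, Prod.mk.injEq, (stereo_injective i).eq_iff, and_true]
  refine and_congr_right fun h => ?_
  rw [h]
  exact torusExp_frameMap_eq_iff (Or.inl (D.det_flatFrame i y.1)) _ _

/-- The point of the plane with coordinates `α`, `β` in the basis adapted to the singular value
`k`. -/
noncomputable def adapted (k : K) (α β : ℝ) : ℂ :=
  α * gaussian (D.cycle k) + β * gaussian (D.cocycle k)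

/-- The coordinate along the vanishing cycle. -/
noncomputable def cycleCoord (k : K) (y : ℂ) : ℝ :=
  D.sign k * (y.re * (D.cocycle k).2 - y.im * (D.cocycle k).1)

/-- The coordinate transverse to the vanishing cycle. -/
noncomputable def cocycleCoord (k : K) (y : ℂ) : ℝ :=
  D.sign k * ((D.cycle k).1 * y.im - (D.cycle k).2 * y.re)

lemma sign_mul_det (k : K) : (D.sign k : ℝ) *
    ((D.cycle k).1 * (D.cocycle k).2 - (D.cycle k).2 * (D.cocycle k).1) = 1 := by
  have h : (latticeDet (D.cycle k) (D.cocycle k) : ℝ) =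
      (D.cycle k).1 * (D.cocycle k).2 - (D.cycle k).2 * (D.cocycle k).1 := by simp [latticeDet]
  rw [← h, D.det_cycle]
  rcases D.sign_eq k with h | h <;> simp [h]

lemma adapted_coords (k : K) (y : ℂ) :
    D.adapted k (D.cycleCoord k y) (D.cocycleCoord k y) = y := by
  have h := D.sign_mul_det k
  apply Complex.ext
  · simp only [adapted, cycleCoord, cocycleCoord, Complex.add_re, Complex.re_ofReal_mul, gaussian_re]
    linear_combination y.re * h
  · simp only [adapted, cycleCoord, cocycleCoord, Complex.add_im, Complex.im_ofReal_mul, gaussian_im]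
    linear_combination y.im * h

lemma torusExp_adapted_eq_iff (k : K) (α β α' β' : ℝ) :
    torusExp (D.adapted k α β) = torusExp (D.adapted k α' β') ↔
      ∃ m : ℤ × ℤ, α = α' + m.1 ∧ β = β' + m.2 := by
  have h : ∀ α β : ℝ, D.adapted k α β =
      frameMap (gaussian (D.cycle k)) (gaussian (D.cocycle k)) ⟨α, β⟩ := fun α β => by
    rw [frameMap_apply, adapted]
  rw [h, h, torusExp_frameMap_eq_iff (by rw [D.det_cycle]; exact D.sign_eq k), torusExp_eq_iff]
  refine exists_congr fun m => ?_
  rw [Complex.ext_iff, gaussian_re, gaussian_im, Complex.sub_re, Complex.sub_im]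
  exact and_congr ⟨fun h => by linarith, fun h => by linarith⟩
    ⟨fun h => by linarith, fun h => by linarith⟩

/-- The part of `ℂ × ℂ` that covers a neighbourhood of a nodal fibre. -/
def nodalDom : Set (ℂ × ℂ) := {x | ‖x.1‖ < 2 ∧ ‖x.2‖ < 2 ∧ ‖x.1 * x.2‖ < 1 / 8}

lemma isOpen_nodalDom : IsOpen nodalDom := by
  have h1 : IsOpen {x : ℂ × ℂ | ‖x.1‖ < 2} := isOpen_lt (by fun_prop) continuous_const
  have h2 : IsOpen {x : ℂ × ℂ | ‖x.2‖ < 2} := isOpen_lt (by fun_prop) continuous_const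
  have h3 : IsOpen {x : ℂ × ℂ | ‖x.1 * x.2‖ < 1 / 8} := isOpen_lt (by fun_prop) continuous_const
  exact h1.inter (h2.inter h3)

/-- The transverse coordinate of the point `z` of the Tate curve `ℂˣ / q ^ ℤ`. -/
noncomputable def tateBeta (z q : ℂ) : ℝ := (Complex.log z).re / (Complex.log q).re

/-- The coordinate along the vanishing cycle of the point `z` of the Tate curve `ℂˣ / q ^ ℤ`, so that
`log z = 2 π i α + β log q`. -/
noncomputable def tateAlpha (z q : ℂ) : ℝ :=
  ((Complex.log z).im - tateBeta z q * (Complex.log q).im) / (2 * Real.pi)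

open Classical in
/-- Labels near a nodal fibre, in the holomorphic model `q = z w`.  For `q ≠ 0`, they are those of the
flat pieces; for `q = 0`, the value `z + w⁻¹` (where `0⁻¹ = 0`) identifies the two axes by
`(z, 0) ∼ (0, z⁻¹)`. -/
noncomputable def tateLabel (k : K) (x : ℂ × ℂ) : TwoSphere × TwoTorus × ℂ :=
  if x.1 * x.2 = 0 then (stereo false (D.dir k), 1, x.1 + x.2⁻¹)
  else (stereo false (D.basePoint false k (x.1 * x.2)),
    torusExp (D.adapted k (tateAlpha x.1 (x.1 * x.2)) (tateBeta x.1 (x.1 * x.2))), 0)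

/-- The passage from the positively oriented coordinates to the holomorphic model. -/
noncomputable def tateCoord (k : K) (x : ℂ × ℂ) : ℂ × ℂ := (x.1, signConj (D.sign k) x.2)

/-- Labels near a nodal fibre. -/
noncomputable def nodalLabel (k : K) (x : ℂ × ℂ) : TwoSphere × TwoTorus × ℂ :=
  D.tateLabel k (D.tateCoord k x)

lemma tateCoord_tateCoord (k : K) (x : ℂ × ℂ) : D.tateCoord k (D.tateCoord k x) = x := by
  simp [tateCoord, signConj_signConj]

lemma tateCoord_mem {k : K} {x : ℂ × ℂ} (hx : x ∈ nodalDom) : D.tateCoord k x ∈ nodalDom := by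
  obtain ⟨h1, h2, h3⟩ := hx
  refine ⟨h1, ?_, ?_⟩
  · simpa [tateCoord, norm_signConj] using h2
  · simpa [tateCoord, norm_signConj] using h3

lemma continuous_tateCoord (k : K) : Continuous (D.tateCoord k) :=
  continuous_fst.prodMk ((continuous_signConj _).comp continuous_snd)

lemma hasJacobianSign_tateCoord (k : K) (a : ℂ × ℂ) :
    HasJacobianSign (D.sign k) (D.tateCoord k) a := hasJacobianSign_signConj (D.sign_eq k) a

lemma tateLabel_fst (k : K) (x : ℂ × ℂ) :
    (D.tateLabel k x).1 = stereo false (D.basePoint false k (x.1 * x.2)) := by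
  unfold tateLabel
  split_ifs with h
  · rw [h, basePoint_zero]; rfl
  · rfl

lemma norm_exp_lt_one_iff (w : ℂ) : ‖Complex.exp w‖ < 1 ↔ w.re < 0 := by
  rw [Complex.norm_exp, Real.exp_lt_one_iff]

/-- The label of a point of the Tate curve in terms of arbitrary branches of the logarithms. -/
lemma tateLabel_exp (k : K) {ξ L : ℂ} {α β : ℝ} {n : ℤ} (hL : L.re < 0)
    (hn : L = Complex.log (Complex.exp L) + 2 * Real.pi * n * Complex.I)
    (hξ : ξ = 2 * Real.pi * α * Complex.I + β * L) :
    D.tateLabel k (Complex.exp ξ, Complex.exp (L - ξ)) =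
      (stereo false (D.basePoint false k (Complex.exp L)),
        torusExp (D.adapted k (α + n * β) β), 0) := by
  have hq : Complex.exp ξ * Complex.exp (L - ξ) = Complex.exp L := by
    rw [← Complex.exp_add]; congr 1; ring
  have hpi : (Real.pi : ℝ) ≠ 0 := Real.pi_ne_zero
  rw [tateLabel]
  simp only [hq]
  rw [if_neg (Complex.exp_ne_zero L)]
  obtain ⟨j, hj⟩ : ∃ j : ℤ, ξ = Complex.log (Complex.exp ξ) + j * (2 * Real.pi * Complex.I) :=
    Complex.exp_eq_exp_iff_exists_int.1 (Complex.exp_log (Complex.exp_ne_zero ξ)).symm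
  have hre : (Complex.log (Complex.exp ξ)).re = ξ.re := by
    have := congrArg Complex.re hj
    simp at this
    simp [Complex.log_re, Complex.norm_exp]
  have hLre : (Complex.log (Complex.exp L)).re = L.re := by
    simp [Complex.log_re, Complex.norm_exp]
  have hβ : tateBeta (Complex.exp ξ) (Complex.exp L) = β := by
    rw [tateBeta, hre, hLre, hξ]
    simp [hL.ne]
  have him : (Complex.log (Complex.exp ξ)).im = ξ.im - j * (2 * Real.pi) := by
    have := congrArg Complex.im hj
    simp only [Complex.add_im, Complex.mul_im, Complex.mul_re, Complex.I_re, Complex.I_im,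
      Complex.ofReal_re, Complex.ofReal_im, Complex.intCast_re, Complex.intCast_im, Complex.re_ofNat,
      Complex.im_ofNat] at this
    linarith
  have hLim : (Complex.log (Complex.exp L)).im = L.im - n * (2 * Real.pi) := by
    have := congrArg Complex.im hn
    simp only [Complex.add_im, Complex.mul_im, Complex.mul_re, Complex.I_re, Complex.I_im,
      Complex.ofReal_re, Complex.ofReal_im, Complex.intCast_re, Complex.intCast_im, Complex.re_ofNat,
      Complex.im_ofNat] at this
    linarith
  have hξim : ξ.im = 2 * Real.pi * α + β * L.im := by
    rw [hξ]; simp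
  have hα : tateAlpha (Complex.exp ξ) (Complex.exp L) = α + n * β + ((-j : ℤ) : ℝ) := by
    rw [tateAlpha, hβ, him, hLim, hξim]
    push_cast
    field_simp
    ring
  rw [hα, hβ]
  congr 2
  exact (D.torusExp_adapted_eq_iff k _ _ _ _).2 ⟨(-j, 0), by simp, by simp⟩

/-- Every point of a smooth Tate curve has the form required by `tateLabel_exp`, for the principal
branch of `log q`. -/
lemma exists_tate_coords {z w : ℂ} (hzw : z * w ≠ 0) (hq : ‖z * w‖ < 1) :
    ∃ (ξ : ℂ) (α β : ℝ), Complex.exp ξ = z ∧ Complex.exp (Complex.log (z * w) - ξ) = w ∧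
      ξ = 2 * Real.pi * α * Complex.I + β * Complex.log (z * w) ∧ (Complex.log (z * w)).re < 0 := by
  have hpi : (Real.pi : ℝ) ≠ 0 := Real.pi_ne_zero
  have hre : (Complex.log (z * w)).re < 0 := by
    rw [Complex.log_re]
    exact Real.log_neg (norm_pos_iff.2 hzw) hq
  refine ⟨Complex.log z, tateAlpha z (z * w), tateBeta z (z * w),
    Complex.exp_log (left_ne_zero_of_mul hzw), ?_, ?_, hre⟩
  · rw [Complex.exp_sub, Complex.exp_log hzw, Complex.exp_log (left_ne_zero_of_mul hzw)]
    field_simp [left_ne_zero_of_mul hzw]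
  · apply Complex.ext
    · simp [tateBeta, hre.ne]
    · simp [tateAlpha, -Complex.ofReal_div]
      field_simp
      ring

lemma tateLabel_of_coords (k : K) {z w ξ : ℂ} {α β : ℝ} (hzw : z * w ≠ 0)
    (h1 : Complex.exp ξ = z) (h2 : Complex.exp (Complex.log (z * w) - ξ) = w)
    (h3 : ξ = 2 * Real.pi * α * Complex.I + β * Complex.log (z * w))
    (h4 : (Complex.log (z * w)).re < 0) :
    D.tateLabel k (z, w) = (stereo false (D.basePoint false k (z * w)),
      torusExp (D.adapted k α β), 0) := by
  have := D.tateLabel_exp k (n := 0) h4 (by rw [Complex.exp_log hzw]; simp) h3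
  rw [h1, h2, Complex.exp_log hzw] at this
  simpa using this

/-- The identification of the two ends of the axes of a nodal piece, `(z, w) ∼ (q z, z⁻¹)`. -/
noncomputable def tateShift (x : ℂ × ℂ) : ℂ × ℂ := (x.1 * x.2 * x.1, x.1⁻¹)

lemma tateLabel_tateShift (k : K) {x : ℂ × ℂ} (hx : x.1 ≠ 0) (hq : ‖x.1 * x.2‖ < 1) :
    D.tateLabel k (tateShift x) = D.tateLabel k x := by
  obtain ⟨z, w⟩ := x
  simp only at hx hq
  by_cases hzw : z * w = 0
  · have hw : w = 0 := (mul_eq_zero.1 hzw).resolve_left hx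
    simp [tateLabel, tateShift, hw]
  · obtain ⟨ξ, α, β, h1, h2, h3, h4⟩ := exists_tate_coords hzw hq
    rw [D.tateLabel_of_coords k hzw h1 h2 h3 h4]
    have h5 : (tateShift (z, w)).1 * (tateShift (z, w)).2 = z * w := by
      simp only [tateShift]; field_simp
    have h6 : tateShift (z, w) = (z * w * z, z⁻¹) := rfl
    simp only [h6] at h5 ⊢
    rw [D.tateLabel_of_coords k (ξ := ξ + Complex.log (z * w)) (α := α) (β := β + 1) (by rwa [h5])
      (by rw [Complex.exp_add, h1, Complex.exp_log hzw]; ring)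
      (by rw [h5, sub_add_cancel_right, Complex.exp_neg, h1])
      (by rw [h5, h3]; push_cast; ring) (by rwa [h5])]
    rw [h5]
    congr 2
    exact (D.torusExp_adapted_eq_iff k _ _ _ _).2 ⟨(0, 1), by simp, by simp⟩

/-- Two points of a nodal piece (in the holomorphic model) are identified if they are equal or one is
the shift of the other. -/
def TateRel (x x' : ℂ × ℂ) : Prop :=
  x = x' ∨ (x.1 * x.2 = x'.1 * x'.2 ∧ x.1 * x'.2 = 1) ∨ (x.1 * x.2 = x'.1 * x'.2 ∧ x'.1 * x.2 = 1)

lemma tateShift_eq {x x' : ℂ × ℂ} (h : x.1 * x.2 = x'.1 * x'.2) (h1 : x.1 * x'.2 = 1) :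
    tateShift x = x' := by
  have hx : x.1 ≠ 0 := left_ne_zero_of_mul_eq_one h1
  have hx' : x'.2 = x.1⁻¹ := eq_inv_of_mul_eq_one_right h1
  apply Prod.ext
  · simp only [tateShift, h]
    rw [mul_assoc, mul_comm x'.2, h1, mul_one]
  · exact hx'.symm

lemma scale_mul_norm_lt {q : ℂ} (hq : ‖q‖ < 1 / 8) : ‖(D.scale : ℂ) * q‖ < 1 / 8 := by
  rw [norm_mul, Complex.norm_real, Real.norm_of_nonneg D.scale_pos.le]
  nlinarith [norm_nonneg q, D.scale_le, D.scale_pos]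

lemma eq_of_exp_eq_exp {a b : ℂ} (ha : ‖a‖ < 1 / 8) (hb : ‖b‖ < 1 / 8)
    (h : Complex.exp a = Complex.exp b) : a = b := by
  have hpi := Real.pi_gt_three
  have h1 := (Complex.abs_im_le_norm a).trans_lt ha
  have h2 := (Complex.abs_im_le_norm b).trans_lt hb
  rw [abs_lt] at h1 h2
  exact Complex.exp_inj_of_neg_pi_lt_of_le_pi (by linarith) (by linarith) (by linarith)
    (by linarith) h

lemma eq_of_basePoint_eq {k : K} {q q' : ℂ} (hq : ‖q‖ < 1 / 8) (hq' : ‖q'‖ < 1 / 8)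
    (h : D.basePoint false k q = D.basePoint false k q') : q = q' := by
  rw [basePoint_false, basePoint_false] at h
  have h1 := eq_of_exp_eq_exp (by rw [norm_neg]; exact D.scale_mul_norm_lt hq)
    (by rw [norm_neg]; exact D.scale_mul_norm_lt hq') (mul_left_cancel₀ (D.dir_ne_zero k) h)
  exact mul_left_cancel₀ (by exact_mod_cast D.scale_pos.ne') (neg_injective h1)

/-- The bounds on `z` and `w` only leave room for neighbouring fundamental domains of the Tate
curve. -/
lemma tateRel_of_label_eq {k : K} {x x' : ℂ × ℂ} (hx : x ∈ nodalDom) (hx' : x' ∈ nodalDom)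
    (h : D.tateLabel k x = D.tateLabel k x') : TateRel x x' := by
  obtain ⟨z, w⟩ := x
  obtain ⟨z', w'⟩ := x'
  obtain ⟨hz, hw, hq⟩ := hx
  obtain ⟨hz', hw', hq'⟩ := hx'
  simp only at hz hw hq hz' hw' hq'
  have hqq : z * w = z' * w' := by
    have h1 := congrArg Prod.fst h
    rw [tateLabel_fst, tateLabel_fst] at h1
    exact D.eq_of_basePoint_eq hq hq' (stereo_injective _ h1)
  by_cases hzw : z * w = 0
  · have hzw' : z' * w' = 0 := hqq ▸ hzw
    simp only [tateLabel, hzw, hzw', if_true, Prod.mk.injEq, true_and] at h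
    simp only [TateRel, hqq, true_and, Prod.mk.injEq]
    rcases mul_eq_zero.1 hzw with rfl | rfl <;> rcases mul_eq_zero.1 hzw' with rfl | rfl
    · left
      simpa using h
    · by_cases hw0 : w = 0
      · left
        simp only [hw0, inv_zero, add_zero] at h ⊢
        exact ⟨h, trivial⟩
      · right; right
        rw [zero_add, inv_zero, add_zero] at h
        rw [← h, inv_mul_cancel₀ hw0]
    · by_cases hw0 : w' = 0
      · left
        simp only [hw0, inv_zero, add_zero] at h ⊢
        exact ⟨h, trivial⟩
      · right; left
        rw [zero_add, inv_zero, add_zero] at h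
        rw [h, inv_mul_cancel₀ hw0]
    · left
      simpa using h
  · obtain ⟨ξ, α, β, h1, h2, h3, h4⟩ := exists_tate_coords hzw (by linarith)
    obtain ⟨ξ', α', β', h1', h2', h3', -⟩ := exists_tate_coords (hqq ▸ hzw) (by linarith)
    rw [D.tateLabel_of_coords k hzw h1 h2 h3 h4,
      D.tateLabel_of_coords k (hqq ▸ hzw) h1' h2' h3' (hqq ▸ h4)] at h
    simp only [Prod.mk.injEq, and_true] at h
    obtain ⟨m, hα, hβ⟩ := (D.torusExp_adapted_eq_iff k _ _ _ _).1 h.2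
    rw [← hqq] at h2' h3'
    set L := Complex.log (z * w) with hLdef
    have hLn : Real.exp L.re < 1 / 8 := by
      rw [← Complex.norm_exp, hLdef, Complex.exp_log hzw]; exact hq
    have e1 : z * w' = Complex.exp (L * (1 + m.2) + m.1 * (2 * Real.pi * Complex.I)) := by
      rw [← h1, ← h2', ← Complex.exp_add, h3, h3', hα, hβ]
      congr 1
      push_cast
      ring
    have e2 : z' * w = Complex.exp (L * (1 - m.2) + (-m.1 : ℤ) * (2 * Real.pi * Complex.I)) := by
      rw [← h1', ← h2, ← Complex.exp_add, h3, h3', hα, hβ]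
      congr 1
      push_cast
      ring
    rw [Complex.exp_periodic.int_mul] at e1 e2
    have big : ∀ n : ℤ, n ≤ -1 → 4 < Real.exp (L.re * n) := by
      intro n hn
      have hn' : (n : ℝ) ≤ -1 := by exact_mod_cast hn
      have h5 : Real.exp (-L.re) ≤ Real.exp (L.re * n) := Real.exp_le_exp.2 (by nlinarith)
      have h6 : Real.exp (-L.re) * Real.exp L.re = 1 := by rw [← Real.exp_add]; simp
      nlinarith [Real.exp_pos (-L.re)]
    have n1 : ‖z * w'‖ = Real.exp (L.re * ((1 + m.2 : ℤ) : ℝ)) := by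
      rw [e1, Complex.norm_exp]; simp
    have n2 : ‖z' * w‖ = Real.exp (L.re * ((1 - m.2 : ℤ) : ℝ)) := by
      rw [e2, Complex.norm_exp]; simp
    have b1 : ‖z * w'‖ < 4 := by rw [norm_mul]; nlinarith [norm_nonneg z, norm_nonneg w']
    have b2 : ‖z' * w‖ < 4 := by rw [norm_mul]; nlinarith [norm_nonneg z', norm_nonneg w]
    have c1 : -2 < m.2 := by
      by_contra hcon
      exact absurd (big (1 + m.2) (by omega)) (by rw [← n1]; exact b1.not_gt)
    have c2 : m.2 < 2 := by
      by_contra hcon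
      exact absurd (big (1 - m.2) (by omega)) (by rw [← n2]; exact b2.not_gt)
    rcases (by omega : m.2 = 0 ∨ m.2 = -1 ∨ m.2 = 1) with h0 | h0 | h0
    · left
      have hz' : z = z' := by
        have hw'0 : w' ≠ 0 := right_ne_zero_of_mul (hqq ▸ hzw)
        apply mul_right_cancel₀ hw'0
        rw [e1, h0, ← hqq]
        simp [hLdef, Complex.exp_log hzw]
      subst hz'
      rw [mul_left_cancel₀ (left_ne_zero_of_mul hzw) hqq]
    · right; left
      exact ⟨hqq, by simp only; rw [e1, h0]; simp⟩
    · right; right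
      exact ⟨hqq, by simp only; rw [e2, h0]; simp⟩

lemma tateLabel_eq_of_tateRel {k : K} {x x' : ℂ × ℂ} (hx : x ∈ nodalDom) (hx' : x' ∈ nodalDom)
    (h : TateRel x x') : D.tateLabel k x = D.tateLabel k x' := by
  rcases h with rfl | ⟨h, h1⟩ | ⟨h, h1⟩
  · rfl
  · rw [← tateShift_eq h h1, D.tateLabel_tateShift k (left_ne_zero_of_mul_eq_one h1)
      (hx.2.2.trans (by norm_num))]
  · rw [← tateShift_eq h.symm h1, D.tateLabel_tateShift k (left_ne_zero_of_mul_eq_one h1)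
      (hx'.2.2.trans (by norm_num))]

end MonodromyDatum

namespace MonodromyDatum

variable {K : Type} (D : MonodromyDatum K)

lemma isTransition_of_hasJacobianSign {S : Type} {L L' : ℂ × ℂ → S} {a b : ℂ × ℂ}
    {g : ℂ × ℂ → ℂ × ℂ} (hg : HasJacobianSign 1 g a) (hab : g a = b)
    (h : ∀ᶠ x in 𝓝 a, L' (g x) = L x) : IsTransition L L' a b :=
  ⟨g, hab, hg.1, by simpa using hg.2, h⟩

lemma hasJacobianSign_id (a : ℂ × ℂ) : HasJacobianSign 1 (fun x => x) a :=
  hasJacobianSign_of_holomorphic (L := ContinuousLinearMap.id ℂ (ℂ × ℂ)) contDiffAt_id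
    (hasFDerivAt_id a) fun _ h => h

lemma isTransition_flat_same (i : Bool) {a b : ℂ × ℂ} (h : D.flatLabel i a = D.flatLabel i b) :
    IsTransition (D.flatLabel i) (D.flatLabel i) a b := by
  obtain ⟨h1, h2⟩ := (D.flatLabel_eq_iff i a b).1 h
  obtain ⟨m, hm⟩ := (torusExp_eq_iff _ _).1 h2.symm
  refine isTransition_of_hasJacobianSign (g := fun x => x + (0, gaussian m)) ?_ ?_ ?_
  · exact hasJacobianSign_of_holomorphic (L := ContinuousLinearMap.id ℂ (ℂ × ℂ))
      (contDiffAt_id.add contDiffAt_const) ((hasFDerivAt_id a).add_const _) fun _ h => h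
  · apply Prod.ext
    · simp [h1]
    · simp [← hm]
  · refine Filter.Eventually.of_forall fun x => (D.flatLabel_eq_iff i _ _).2 ⟨by simp, ?_⟩
    exact torusExp_add_gaussian _ _

/-- The transition matrix between the flat pieces is locally constant and of determinant one, and the
inversion of the base coordinate is holomorphic. -/
lemma isTransition_flat_true_false {a b : ℂ × ℂ} (ha : a ∈ D.flatDom true)
    (hb : b ∈ D.flatDom false) (h : D.flatLabel true a = D.flatLabel false b) :
    IsTransition (D.flatLabel true) (D.flatLabel false) a b := by
  simp only [flatLabel, Prod.mk.injEq, and_true, latticeMap_flatFrame_false] at h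
  obtain ⟨h1, h2⟩ := h
  have hab : b.1 * a.1 = 1 := stereo_false_eq_stereo_true_iff.1 h1.symm
  have ha0 : a.1 ≠ 0 := right_ne_zero_of_mul_eq_one hab
  have hb0 : b.1 ≠ 0 := left_ne_zero_of_mul_eq_one hab
  have hba : b.1 = a.1⁻¹ := eq_inv_of_mul_eq_one_left hab
  obtain ⟨m, hm⟩ := (torusExp_eq_iff _ _).1 h2.symm
  have hev : ∀ᶠ b' in 𝓝 b.1, D.frame b' = D.frame b.1 := by
    refine D.frame_eventually b.1 hb0 fun k r hr hbr => ?_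
    rcases le_total 1 r with h1r | h1r
    · exact D.ne_mul_flatDir hb k h1r (by simpa [flatDir] using hbr)
    · refine D.ne_mul_flatDir ha k ((one_le_inv₀ hr).2 h1r) ?_
      have : a.1 = b.1⁻¹ := by rw [hba, inv_inv]
      rw [this, hbr]
      simp [flatDir, conj_dir, mul_comm]
  have hflat : D.flatFrame true a.1 = D.frame b.1 := by simp [flatFrame, hba]
  have hdet : 0 < (latticeMap (D.flatFrame true a.1)).det := by
    have := D.det_flatFrame true a.1
    rw [latticeMap, det_frameMap]
    simp only [gaussian_re, gaussian_im]
    have h2 : (0 : ℝ) < latticeDet (D.flatFrame true a.1).1 (D.flatFrame true a.1).2 := by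
      rw [this]; norm_num
    simpa [latticeDet] using h2
  refine isTransition_of_hasJacobianSign
    (g := fun x => (x.1⁻¹, latticeMap (D.flatFrame true a.1) x.2 + gaussian m)) ?_ ?_ ?_
  · refine hasJacobianSign_triangular (h := fun z => z⁻¹) (contDiffAt_inv ℝ ha0)
      (((ContinuousLinearMap.contDiff _).contDiffAt.comp a contDiffAt_snd).add contDiffAt_const)
      (hasDerivAt_inv ha0) (by simpa using ha0) (B := 0)
      (D := latticeMap (D.flatFrame true a.1)) ?_ (by simpa using hdet)
    rw [ContinuousLinearMap.zero_comp, zero_add]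
    exact ((latticeMap (D.flatFrame true a.1)).hasFDerivAt.comp a hasFDerivAt_snd).add_const _
  · apply Prod.ext
    · exact hba.symm
    · simp [← hm]
  · have hcont : ContinuousAt (fun x : ℂ × ℂ => x.1⁻¹) a := continuousAt_fst.inv₀ ha0
    have hev' : ∀ᶠ x in 𝓝 a, D.frame x.1⁻¹ = D.frame b.1 :=
      hcont.eventually (p := fun y => D.frame y = D.frame b.1) (by simpa [hba] using hev)
    filter_upwards [hev', continuousAt_fst.eventually_ne ha0] with x hx hx0
    simp only [flatLabel, latticeMap_flatFrame_false, Prod.mk.injEq, and_true]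
    constructor
    · rw [← stereo_not hx0 true]; rfl
    · rw [torusExp_add_gaussian, hflat, ← hx]
      simp [flatFrame]

lemma hasJacobianSign_tateShift {x : ℂ × ℂ} (hx : x.1 ≠ 0) : HasJacobianSign 1 tateShift x := by
  have h1 : HasFDerivAt (𝕜 := ℂ) (fun y : ℂ × ℂ => y.1) (ContinuousLinearMap.fst ℂ ℂ ℂ) x :=
    hasFDerivAt_fst
  have h2 : HasFDerivAt (𝕜 := ℂ) (fun y : ℂ × ℂ => y.2) (ContinuousLinearMap.snd ℂ ℂ ℂ) x :=
    hasFDerivAt_snd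
  have h3 := (hasDerivAt_inv hx).hasFDerivAt.comp x h1
  refine hasJacobianSign_of_holomorphic ?_ (((h1.mul h2).mul h1).prodMk h3) ?_
  · exact ((contDiffAt_fst.mul contDiffAt_snd).mul contDiffAt_fst).prodMk (contDiffAt_fst.inv hx)
  · rintro ⟨v, w⟩ h
    simp [hx] at h
    obtain ⟨h, rfl⟩ := h
    simpa [hx] using h

lemma isTransition_tateCoord {k : K} {a b : ℂ × ℂ} {g : ℂ × ℂ → ℂ × ℂ}
    (hg : HasJacobianSign 1 g (D.tateCoord k a))
    (hgab : g (D.tateCoord k a) = D.tateCoord k b)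
    (h : ∀ᶠ x in 𝓝 (D.tateCoord k a), D.tateLabel k (g x) = D.tateLabel k x) :
    IsTransition (D.nodalLabel k) (D.nodalLabel k) a b := by
  refine isTransition_of_hasJacobianSign
    (g := fun x => D.tateCoord k (g (D.tateCoord k x))) ?_ ?_ ?_
  · have h1 := HasJacobianSign.comp (f := fun x => g (D.tateCoord k x))
      (D.hasJacobianSign_tateCoord k (g (D.tateCoord k a))) (hg.comp (D.hasJacobianSign_tateCoord k a))
    rcases D.sign_eq k with hs | hs <;> simpa [hs] using h1
  · rw [hgab, tateCoord_tateCoord]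
  · filter_upwards [(D.continuous_tateCoord k).continuousAt.eventually h] with x hx
    rw [nodalLabel, tateCoord_tateCoord, hx, nodalLabel]

lemma isTransition_nodal_of_shift {k : K} {a b : ℂ × ℂ} (ha : a ∈ nodalDom)
    (h : (D.tateCoord k a).1 * (D.tateCoord k a).2 = (D.tateCoord k b).1 * (D.tateCoord k b).2)
    (h1 : (D.tateCoord k a).1 * (D.tateCoord k b).2 = 1) :
    IsTransition (D.nodalLabel k) (D.nodalLabel k) a b := by
  have h0 : (D.tateCoord k a).1 ≠ 0 := left_ne_zero_of_mul_eq_one h1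
  refine D.isTransition_tateCoord (hasJacobianSign_tateShift h0) (tateShift_eq h h1) ?_
  filter_upwards [continuousAt_fst.eventually_ne h0,
    isOpen_nodalDom.mem_nhds (D.tateCoord_mem (k := k) ha)] with x hx hx'
  exact D.tateLabel_tateShift k hx (hx'.2.2.trans (by norm_num))

lemma nodalLabel_fst (k : K) (x : ℂ × ℂ) : (D.nodalLabel k x).1 =
    stereo false (D.basePoint false k ((D.tateCoord k x).1 * (D.tateCoord k x).2)) :=
  D.tateLabel_fst k _

lemma isTransition_nodal {k l : K} {a b : ℂ × ℂ} (ha : a ∈ nodalDom) (hb : b ∈ nodalDom)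
    (h : D.nodalLabel k a = D.nodalLabel l b) :
    IsTransition (D.nodalLabel k) (D.nodalLabel l) a b := by
  have ha' := D.tateCoord_mem (k := k) ha
  have hb' := D.tateCoord_mem (k := l) hb
  have hkl : k = l := by
    have h1 := congrArg Prod.fst h
    rw [nodalLabel_fst, nodalLabel_fst] at h1
    have h2 := stereo_injective _ h1
    rw [basePoint_false, basePoint_false] at h2
    exact D.disjoint _ _ _ _ ha'.2.2 hb'.2.2 h2
  subst hkl
  rcases D.tateRel_of_label_eq ha' hb' h with h | ⟨h, h1⟩ | ⟨h, h1⟩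
  · exact D.isTransition_tateCoord (hasJacobianSign_id _) h (Filter.Eventually.of_forall fun _ => rfl)
  · exact D.isTransition_nodal_of_shift ha h h1
  · exact (D.isTransition_nodal_of_shift hb h.symm h1).symm

/-- The branch of `log q` on a flat piece which is obtained by continuation from the side of positive
imaginary part of `q`, as a function of the stereographic coordinate `b`. -/
noncomputable def flatLog (i : Bool) (k : K) (b : ℂ) : ℂ :=
  Complex.log (-(Complex.log (b * starRingEnd ℂ (D.flatDir i k)) / D.scale)) +
    if i then Real.pi * Complex.I else 0

lemma poleSign_mul_mem_slitPlane {i : Bool} {k : K} {q y : ℂ}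
    (hb : (D.basePoint i k q, y) ∈ D.flatDom i) : (poleSign i : ℂ) * q ∈ Complex.slitPlane := by
  have h := hb k
  simp only [basePoint_mul_conj] at h
  by_contra hcon
  rw [Complex.mem_slitPlane_iff, not_or, not_lt, not_not] at hcon
  have hq : (poleSign i : ℂ) * q = ((poleSign i : ℂ) * q).re := by
    apply Complex.ext <;> simp [hcon.2]
  have h2 : -((poleSign i : ℂ) * D.scale * q) = ((-(D.scale * ((poleSign i : ℂ) * q).re) : ℝ) : ℂ) := by
    rw [mul_right_comm, hq]
    push_cast
    simp
    ring
  rw [h2, ← Complex.ofReal_exp, ← Complex.ofReal_one, ← Complex.ofReal_sub,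
    Complex.ofReal_mem_slitPlane] at h
  have h3 := Real.one_le_exp (x := -(D.scale * ((poleSign i : ℂ) * q).re))
    (by nlinarith [D.scale_pos])
  linarith

lemma log_basePoint (i : Bool) (k : K) {q : ℂ} (hq : ‖q‖ < 1 / 8) :
    Complex.log (D.basePoint i k q * starRingEnd ℂ (D.flatDir i k)) =
      -(poleSign i * D.scale * q) := by
  have hpi := Real.pi_gt_three
  rw [basePoint_mul_conj]
  have h : ‖-((poleSign i : ℂ) * D.scale * q)‖ < 1 / 8 := by
    rw [norm_neg, mul_assoc, norm_mul]
    have : ‖(poleSign i : ℂ)‖ = 1 := by cases i <;> simp [poleSign]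
    rw [this, one_mul]
    exact D.scale_mul_norm_lt hq
  have h1 := (Complex.abs_im_le_norm _).trans_lt h
  rw [abs_lt] at h1
  exact Complex.log_exp (by linarith) (by linarith)

lemma flatLog_basePoint (i : Bool) (k : K) {q : ℂ} (hq : ‖q‖ < 1 / 8) :
    D.flatLog i k (D.basePoint i k q) =
      Complex.log (poleSign i * q) + if i then Real.pi * Complex.I else 0 := by
  have := D.scale_pos.ne'
  rw [flatLog, log_basePoint _ _ _ hq]
  congr 2
  have : (D.scale : ℂ) ≠ 0 := by exact_mod_cast this
  field_simp

lemma log_neg_add_pi {q : ℂ} (hq : -q ∈ Complex.slitPlane) :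
    Complex.log (-q) + Real.pi * Complex.I =
      Complex.log q + 2 * Real.pi * ((if 0 ≤ q.im then 0 else 1 : ℤ) : ℂ) * Complex.I := by
  have hre : (Complex.log (-q)).re = (Complex.log q).re := by simp [Complex.log_re]
  apply Complex.ext
  · simp only [Complex.add_re, hre]
    split_ifs <;> simp
  · simp only [Complex.add_im, Complex.log_im]
    split_ifs with h
    · rcases h.lt_or_eq with h | h
      · rw [Complex.arg_neg_eq_arg_sub_pi_of_im_pos h]; simp
      · have hre : q.re < 0 := by
          rcases Complex.mem_slitPlane_iff.1 hq with h1 | h1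
          · simpa using h1
          · simp [← h] at h1
        have hqr : q = (q.re : ℂ) := by apply Complex.ext <;> simp [← h]
        rw [hqr, Complex.arg_ofReal_of_neg hre, ← Complex.ofReal_neg,
          Complex.arg_ofReal_of_nonneg (by linarith)]
        simp
    · rw [Complex.arg_neg_eq_arg_add_pi_of_im_neg (not_le.1 h)]
      simp
      ring

/-- The value of a flat frame near the singular value `k` which is used to express the adapted
coordinates. -/
noncomputable def baseFrame (i : Bool) (k : K) : (ℤ × ℤ) × (ℤ × ℤ) :=
  if i then D.frame (D.dir k) else ((1, 0), (0, 1))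

lemma det_latticeMap_baseFrame (i : Bool) (k : K) : (latticeMap (D.baseFrame i k)).det = 1 := by
  have h : latticeDet (D.baseFrame i k).1 (D.baseFrame i k).2 = 1 := by
    unfold baseFrame
    split_ifs
    · exact D.det_frame _
    · rfl
  rw [latticeMap, det_frameMap]
  simp only [gaussian_re, gaussian_im]
  rw [latticeDet] at h
  exact_mod_cast h

lemma latticeMap_picardLefschetz (k : K) (f : (ℤ × ℤ) × (ℤ × ℤ)) (y : ℂ) :
    latticeMap (picardLefschetz (D.sign k) (D.cycle k) f.1,
      picardLefschetz (D.sign k) (D.cycle k) f.2) y =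
    D.adapted k (D.cycleCoord k (latticeMap f y) + D.cocycleCoord k (latticeMap f y))
      (D.cocycleCoord k (latticeMap f y)) := by
  have h1 : latticeMap (picardLefschetz (D.sign k) (D.cycle k) f.1,
      picardLefschetz (D.sign k) (D.cycle k) f.2) y =
      latticeMap f y + D.cocycleCoord k (latticeMap f y) * gaussian (D.cycle k) := by
    apply Complex.ext <;>
    · simp [latticeMap, frameMap_apply, picardLefschetz, gaussian_re, gaussian_im, cocycleCoord,
        latticeDet]
      ring
  have h2 : ∀ α β t : ℝ, D.adapted k (α + t) β =
      D.adapted k α β + t * gaussian (D.cycle k) := fun α β t => by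
    simp only [adapted]
    push_cast
    ring
  rw [h1, h2, adapted_coords]

/-- Compatibility of the frames with the branches of `log q`: both the frame of the piece around
infinity and the branch of the logarithm change when the ray through the singular value is
crossed. -/
lemma exists_branch (i : Bool) (k : K) {q y : ℂ} (hq : ‖q‖ < 1 / 8)
    (hb : (D.basePoint i k q, y) ∈ D.flatDom i) :
    ∃ n : ℤ, D.flatLog i k (D.basePoint i k q) =
        Complex.log q + 2 * Real.pi * n * Complex.I ∧
      ∀ y, latticeMap (D.flatFrame i (D.basePoint i k q)) y =
        D.adapted k (D.cycleCoord k (latticeMap (D.baseFrame i k) y) +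
          n * D.cocycleCoord k (latticeMap (D.baseFrame i k) y))
          (D.cocycleCoord k (latticeMap (D.baseFrame i k) y)) := by
  have hs := D.poleSign_mul_mem_slitPlane hb
  rw [D.flatLog_basePoint i k hq]
  cases i with
  | false =>
    refine ⟨0, by simp [poleSign], fun y => ?_⟩
    simp only [Int.cast_zero, zero_mul, add_zero, adapted_coords]
    simp [flatFrame, baseFrame]
  | true =>
    have hp : ((poleSign true : ℝ) : ℂ) * q = -q := by simp [poleSign]
    rw [hp] at hs ⊢
    have hf : D.flatFrame true (D.basePoint true k q) =
        D.frame (D.dir k * Complex.exp (-(D.scale * q))) := by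
      simp [flatFrame, basePoint_true, basePoint_false]
    refine ⟨if 0 ≤ q.im then 0 else 1, by simpa using log_neg_add_pi hs, fun y => ?_⟩
    rw [hf]
    split_ifs with h
    · rw [D.frame_of_nonneg k q hq h]
      simp only [Int.cast_zero, zero_mul, add_zero, adapted_coords]
      simp [baseFrame]
    · rw [D.frame_of_neg k q hq (not_le.1 h), latticeMap_picardLefschetz]
      simp [baseFrame]

end MonodromyDatum

namespace MonodromyDatum

variable {K : Type} (D : MonodromyDatum K)

/-- The coordinates adapted to the singular value `k`, as a linear map of the plane. -/
noncomputable def adaptedMap (k : K) : ℂ →L[ℝ] ℂ :=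
  frameMap (D.sign k * ((D.cocycle k).2 - (D.cycle k).2 * Complex.I))
    (D.sign k * (-(D.cocycle k).1 + (D.cycle k).1 * Complex.I))

lemma adaptedMap_re (k : K) (y : ℂ) : (D.adaptedMap k y).re = D.cycleCoord k y := by
  simp [adaptedMap, frameMap_apply, cycleCoord]
  ring

lemma adaptedMap_im (k : K) (y : ℂ) : (D.adaptedMap k y).im = D.cocycleCoord k y := by
  simp [adaptedMap, frameMap_apply, cocycleCoord]
  ring

lemma det_adaptedMap (k : K) : (D.adaptedMap k).det = D.sign k := by
  have h := D.sign_mul_det k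
  rw [adaptedMap, det_frameMap]
  simp
  linear_combination (D.sign k : ℝ) * h

lemma flatLog_mem_slitPlane {i : Bool} {k : K} {q y : ℂ} (hq : ‖q‖ < 1 / 8)
    (hb : (D.basePoint i k q, y) ∈ D.flatDom i) :
    D.basePoint i k q * starRingEnd ℂ (D.flatDir i k) ∈ Complex.slitPlane ∧
    -(Complex.log (D.basePoint i k q * starRingEnd ℂ (D.flatDir i k)) / D.scale) ∈
      Complex.slitPlane := by
  have hpi := Real.pi_gt_three
  constructor
  · rw [Complex.mem_slitPlane_iff_arg, ← Complex.log_im, D.log_basePoint i k hq]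
    refine ⟨?_, mul_ne_zero (D.basePoint_ne_zero i k q) ?_⟩
    · have h : ‖-((poleSign i : ℂ) * D.scale * q)‖ < 1 / 8 := by
        rw [norm_neg, mul_assoc, norm_mul]
        have : ‖(poleSign i : ℂ)‖ = 1 := by cases i <;> simp [poleSign]
        rw [this, one_mul]
        exact D.scale_mul_norm_lt hq
      have h1 := (Complex.abs_im_le_norm _).trans_lt h
      rw [abs_lt] at h1
      intro hcon
      linarith
    · simpa using D.flatDir_ne_zero i k
  · rw [D.log_basePoint i k hq]
    have : (D.scale : ℂ) ≠ 0 := by exact_mod_cast D.scale_pos.ne'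
    convert D.poleSign_mul_mem_slitPlane hb using 1
    field_simp

lemma contDiffAt_flatLog {i : Bool} {k : K} {q y : ℂ} (hq : ‖q‖ < 1 / 8)
    (hb : (D.basePoint i k q, y) ∈ D.flatDom i) :
    ContDiffAt ℝ ∞ (D.flatLog i k) (D.basePoint i k q) := by
  obtain ⟨h1, h2⟩ := D.flatLog_mem_slitPlane hq hb
  refine ContDiffAt.restrict_scalars ℝ (𝕜' := ℂ) ?_
  refine ContDiffAt.add ?_ contDiffAt_const
  have e1 : ContDiffAt ℂ ∞ (fun b => b * starRingEnd ℂ (D.flatDir i k)) (D.basePoint i k q) :=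
    contDiffAt_id.mul contDiffAt_const
  have e2 := ContDiffAt.comp (D.basePoint i k q) (g := Complex.log)
    (Complex.contDiffAt_log h1) e1
  exact ContDiffAt.comp (D.basePoint i k q) (g := Complex.log) (Complex.contDiffAt_log h2)
    (e2.div_const (D.scale : ℂ)).neg

lemma exists_hasDerivAt_flatLog {i : Bool} {k : K} {q y : ℂ} (hq : ‖q‖ < 1 / 8)
    (hb : (D.basePoint i k q, y) ∈ D.flatDom i) :
    ∃ L' : ℂ, L' ≠ 0 ∧ HasDerivAt (D.flatLog i k) L' (D.basePoint i k q) := by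
  obtain ⟨h1, h2⟩ := D.flatLog_mem_slitPlane hq hb
  have h := (((((hasDerivAt_id (D.basePoint i k q)).mul_const
    (starRingEnd ℂ (D.flatDir i k))).clog h1).div_const (D.scale : ℂ)).neg.clog h2).add_const
      (if i then Real.pi * Complex.I else 0 : ℂ)
  refine ⟨_, ?_, h⟩
  have h3 : (D.scale : ℂ) ≠ 0 := by exact_mod_cast D.scale_pos.ne'
  refine div_ne_zero (neg_ne_zero.2 (div_ne_zero (div_ne_zero ?_ (Complex.slitPlane_ne_zero h1)) h3))
    (Complex.slitPlane_ne_zero h2)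
  simpa using D.flatDir_ne_zero i k

lemma hasJacobianSign_exp (a : ℂ × ℂ) :
    HasJacobianSign 1 (fun x => (Complex.exp x.2, Complex.exp (x.1 - x.2))) a := by
  have h1 : HasFDerivAt (𝕜 := ℂ) (fun y : ℂ × ℂ => y.1) (ContinuousLinearMap.fst ℂ ℂ ℂ) a :=
    hasFDerivAt_fst
  have h2 : HasFDerivAt (𝕜 := ℂ) (fun y : ℂ × ℂ => y.2) (ContinuousLinearMap.snd ℂ ℂ ℂ) a :=
    hasFDerivAt_snd
  refine hasJacobianSign_of_holomorphic ?_ (h2.cexp.prodMk (h1.sub h2).cexp) ?_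
  · exact contDiffAt_snd.cexp.prodMk (contDiffAt_fst.sub contDiffAt_snd).cexp
  · rintro ⟨v, w⟩ h
    simp [Complex.exp_ne_zero] at h
    obtain ⟨rfl, h⟩ := h
    simpa using h

/-- The passage from a flat piece to the logarithms of `q` and `z` on a nodal piece, translated by
`m` in the transverse direction. -/
noncomputable def flatToLog (i : Bool) (k : K) (m : ℤ) (x : ℂ × ℂ) : ℂ × ℂ :=
  (D.flatLog i k x.1,
    2 * Real.pi * (D.cycleCoord k (latticeMap (D.baseFrame i k) x.2) : ℂ) * Complex.I +
      ((D.cocycleCoord k (latticeMap (D.baseFrame i k) x.2) - m : ℝ) : ℂ) * D.flatLog i k x.1)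

lemma hasJacobianSign_flatToLog {i : Bool} {k : K} {q : ℂ} (m : ℤ) {a : ℂ × ℂ} (hq : ‖q‖ < 1 / 8)
    (ha : a ∈ D.flatDom i) (haq : a.1 = D.basePoint i k q)
    (hre : (D.flatLog i k a.1).re < 0) :
    HasJacobianSign (D.sign k) (D.flatToLog i k m) a := by
  obtain ⟨b, y⟩ := a
  simp only at haq
  subst haq
  obtain ⟨L', hL', hL⟩ := D.exists_hasDerivAt_flatLog hq ha
  have hLs := D.contDiffAt_flatLog hq ha
  set N : ℂ →L[ℝ] ℂ := (D.adaptedMap k).comp (latticeMap (D.baseFrame i k)) with hN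
  have hNre : ∀ y, D.cycleCoord k (latticeMap (D.baseFrame i k) y) = (N y).re := fun y =>
    (D.adaptedMap_re k _).symm
  have hNim : ∀ y, D.cocycleCoord k (latticeMap (D.baseFrame i k) y) = (N y).im := fun y =>
    (D.adaptedMap_im k _).symm
  have hNdet : N.det = D.sign k := by
    rw [hN, ContinuousLinearMap.det, ContinuousLinearMap.toLinearMap_comp, LinearMap.det_comp]
    change (D.adaptedMap k).det * (latticeMap (D.baseFrame i k)).det = _
    rw [det_adaptedMap, det_latticeMap_baseFrame, mul_one]
  unfold flatToLog
  simp only [hNre, hNim]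
  set q₀ := D.basePoint i k q
  set β : ℂ := (((N y).im - m : ℝ) : ℂ)
  have hNd : HasFDerivAt (fun x : ℂ × ℂ => N x.2) (N.comp (ContinuousLinearMap.snd ℝ ℂ ℂ)) (q₀, y) :=
    N.hasFDerivAt.comp (q₀, y) hasFDerivAt_snd
  have hre' := (Complex.ofRealCLM.comp Complex.reCLM).hasFDerivAt.comp (q₀, y) hNd
  have him' := (Complex.ofRealCLM.comp Complex.imCLM).hasFDerivAt.comp (q₀, y) hNd
  have hLd : HasFDerivAt (fun x : ℂ × ℂ => D.flatLog i k x.1)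
      (((ContinuousLinearMap.toSpanSingleton ℂ L').restrictScalars ℝ).comp
        (ContinuousLinearMap.fst ℝ ℂ ℂ)) (q₀, y) :=
    HasFDerivAt.comp (q₀, y) (g := D.flatLog i k) (f := Prod.fst)
      (hL.hasFDerivAt.restrictScalars ℝ) hasFDerivAt_fst
  have hd := ((hre'.const_mul (2 * Real.pi : ℂ)).mul_const Complex.I).add
    ((him'.sub_const (m : ℂ)).mul hLd)
  refine hasJacobianSign_triangular (h := D.flatLog i k) hLs ?_ hL hL'
    (B := β • (ContinuousLinearMap.toSpanSingleton ℂ L').restrictScalars ℝ)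
    (D := (frameMap (2 * Real.pi * Complex.I) (D.flatLog i k q₀)).comp N) ?_ ?_
  · have h1 : ContDiffAt ℝ ∞ (fun x : ℂ × ℂ => N x.2) (q₀, y) :=
      N.contDiff.contDiffAt.comp (q₀, y) contDiffAt_snd
    have h2 : ContDiffAt ℝ ∞ (fun x : ℂ × ℂ => ((N x.2).re : ℂ)) (q₀, y) :=
      (Complex.ofRealCLM.comp Complex.reCLM).contDiff.contDiffAt.comp (q₀, y) h1
    have h3 : ContDiffAt ℝ ∞ (fun x : ℂ × ℂ => (((N x.2).im - m : ℝ) : ℂ)) (q₀, y) := by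
      have := ((Complex.ofRealCLM.comp Complex.imCLM).contDiff.contDiffAt.comp (q₀, y) h1).sub
        (contDiffAt_const (c := (m : ℂ)))
      simpa [Function.comp_def] using this
    exact ((contDiffAt_const.mul h2).mul contDiffAt_const).add
      (h3.mul (hLs.comp (q₀, y) contDiffAt_fst))
  · have hfun : (fun x : ℂ × ℂ => 2 * (Real.pi : ℂ) * ((N x.2).re : ℂ) * Complex.I +
        (((N x.2).im - m : ℝ) : ℂ) * D.flatLog i k x.1) = fun x : ℂ × ℂ =>
        2 * (Real.pi : ℂ) * (Complex.ofRealCLM.comp Complex.reCLM) (N x.2) * Complex.I +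
        ((Complex.ofRealCLM.comp Complex.imCLM) (N x.2) - (m : ℂ)) * D.flatLog i k x.1 := by
      ext x; simp
    rw [hfun]
    refine HasFDerivAt.congr_fderiv hd ?_
    ext v <;> simp [frameMap_apply, β]
    ring
  · rw [ContinuousLinearMap.det, ContinuousLinearMap.toLinearMap_comp, LinearMap.det_comp]
    change 0 < (D.sign k : ℝ) * ((frameMap (2 * Real.pi * Complex.I) (D.flatLog i k q₀)).det * N.det)
    rw [hNdet, det_frameMap]
    have hs : (D.sign k : ℝ) * D.sign k = 1 := by
      rcases D.sign_eq k with h | h <;> simp [h]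
    have : (D.sign k : ℝ) * (((2 * Real.pi * Complex.I : ℂ).re * (D.flatLog i k q₀).im -
        (2 * Real.pi * Complex.I : ℂ).im * (D.flatLog i k q₀).re) * D.sign k) =
        -(2 * Real.pi * (D.flatLog i k q₀).re) := by
      simp
      linear_combination (2 * Real.pi * (D.flatLog i k q₀).re) * hs
    rw [this]
    have := Real.pi_pos
    simp only at hre
    nlinarith

/-- The change of coordinates between a flat piece and a nodal piece preserves the labels. -/
lemma tateLabel_flatToLog {i : Bool} {k : K} {q : ℂ} (m : ℤ) {x : ℂ × ℂ} (hq : ‖q‖ < 1 / 8)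
    (hx : x ∈ D.flatDom i) (hxq : x.1 = D.basePoint i k q) :
    (D.flatLog i k x.1).re < 0 ∧ D.tateLabel k (Complex.exp (D.flatToLog i k m x).2,
      Complex.exp ((D.flatToLog i k m x).1 - (D.flatToLog i k m x).2)) = D.flatLabel i x := by
  obtain ⟨b, y⟩ := x
  simp only at hxq
  subst hxq
  obtain ⟨n, hn, hy⟩ := D.exists_branch i k hq hx
  have hq0 : q ≠ 0 := right_ne_zero_of_mul
    (Complex.slitPlane_ne_zero (D.poleSign_mul_mem_slitPlane hx))
  have hexp : Complex.exp (D.flatLog i k (D.basePoint i k q)) = q := by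
    have : 2 * Real.pi * n * Complex.I = n * (2 * Real.pi * Complex.I) := by ring
    rw [hn, this, Complex.exp_periodic.int_mul, Complex.exp_log hq0]
  have hre : (D.flatLog i k (D.basePoint i k q)).re < 0 := by
    rw [← norm_exp_lt_one_iff, hexp]
    linarith
  refine ⟨hre, ?_⟩
  simp only [flatToLog]
  rw [D.tateLabel_exp k hre (n := n) (by rw [hexp, hn]) rfl, hexp, flatLabel]
  simp only [hy, stereo_basePoint]
  congr 2
  exact (D.torusExp_adapted_eq_iff k _ _ _ _).2 ⟨(-(n * m), -m), by push_cast; ring, by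
    push_cast; ring⟩

/-- A flat piece and a nodal piece are identified by the logarithmic coordinates of the Tate curve, with
the branch of `log z` that belongs to the given pair of points. -/
lemma isTransition_flat_nodal [Finite K] {i : Bool} {k : K} {a b : ℂ × ℂ} (ha : a ∈ D.flatDom i)
    (hb : b ∈ nodalDom) (h : D.flatLabel i a = D.nodalLabel k b) :
    IsTransition (D.flatLabel i) (D.nodalLabel k) a b := by
  obtain ⟨z, w, hzw⟩ : ∃ z w, D.tateCoord k b = (z, w) := ⟨_, _, rfl⟩
  have hb' := D.tateCoord_mem (k := k) hb
  rw [hzw] at hb'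
  have hq : ‖z * w‖ < 1 / 8 := hb'.2.2
  have haq : a.1 = D.basePoint i k (z * w) := by
    have h1 := congrArg Prod.fst h
    rw [nodalLabel_fst, hzw] at h1
    exact (D.stereo_eq_iff i k _ _).1 h1
  have ha' : (D.basePoint i k (z * w), a.2) ∈ D.flatDom i := haq ▸ ha
  have hq0 : z * w ≠ 0 := right_ne_zero_of_mul
    (Complex.slitPlane_ne_zero (D.poleSign_mul_mem_slitPlane ha'))
  obtain ⟨n, hn, hy⟩ := D.exists_branch i k hq ha'
  obtain ⟨ξ, α, β, h1, h2, h3, h4⟩ := exists_tate_coords hq0 (by linarith)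
  rw [nodalLabel, hzw, D.tateLabel_of_coords k hq0 h1 h2 h3 h4, flatLabel, haq, hy] at h
  simp only [Prod.mk.injEq, and_true] at h
  obtain ⟨m, hα, hβ⟩ := (D.torusExp_adapted_eq_iff k _ _ _ _).1 h.2
  refine isTransition_of_hasJacobianSign (g := fun x => D.tateCoord k
    (Complex.exp (D.flatToLog i k m.2 x).2,
      Complex.exp ((D.flatToLog i k m.2 x).1 - (D.flatToLog i k m.2 x).2))) ?_ ?_ ?_
  · have hsign := HasJacobianSign.comp (f := fun x => (Complex.exp (D.flatToLog i k m.2 x).2,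
      Complex.exp ((D.flatToLog i k m.2 x).1 - (D.flatToLog i k m.2 x).2)))
      (D.hasJacobianSign_tateCoord k _) (HasJacobianSign.comp (f := D.flatToLog i k m.2)
        (hasJacobianSign_exp _)
        (D.hasJacobianSign_flatToLog m.2 hq ha haq (D.tateLabel_flatToLog m.2 hq ha haq).1))
    rcases D.sign_eq k with hs | hs <;> simpa [hs] using hsign
  · rw [← D.tateCoord_tateCoord k b, hzw]
    congr 1
    set A := D.cycleCoord k (latticeMap (D.baseFrame i k) a.2)
    have e : (D.flatToLog i k m.2 a).2 = ξ + ((m.1 - n * m.2 : ℤ) : ℂ) * (2 * Real.pi * Complex.I) := by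
      simp only [flatToLog, haq]
      rw [hn, hβ, h3]
      have hα' : D.cycleCoord k (latticeMap (D.baseFrame i k) a.2) =
          α + m.1 - n * (β + m.2) := by rw [← hβ]; linarith
      rw [hα']
      push_cast
      ring
    have e' : (D.flatToLog i k m.2 a).1 = Complex.log (z * w) + n * (2 * Real.pi * Complex.I) := by
      simp only [flatToLog, haq]
      rw [hn]
      ring
    rw [Complex.exp_sub, e, e', Complex.exp_periodic.int_mul, Complex.exp_periodic.int_mul,
      ← Complex.exp_sub, h1, h2]
  · -- the coordinate `q` as a function on the flat piece near `a`
    set Q : ℂ × ℂ → ℂ := fun x =>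
      -(poleSign i * Complex.log (x.1 * starRingEnd ℂ (D.flatDir i k)) / D.scale) with hQ
    have hscale : (D.scale : ℂ) ≠ 0 := by exact_mod_cast D.scale_pos.ne'
    have hp : (poleSign i : ℂ) * poleSign i = 1 := by exact_mod_cast poleSign_mul_self i
    have hslit : a.1 * starRingEnd ℂ (D.flatDir i k) ∈ Complex.slitPlane := by
      rw [haq]; exact (D.flatLog_mem_slitPlane hq ha').1
    have hQc : ContinuousAt Q a := by
      refine ContinuousAt.neg (ContinuousAt.div_const (ContinuousAt.mul continuousAt_const ?_) _)
      exact ContinuousAt.clog (continuousAt_fst.mul continuousAt_const) hslit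
    have hQa : Q a = z * w := by
      simp only [hQ, haq, D.log_basePoint i k hq]
      field_simp
      linear_combination (z * w) * hp
    have hev : ∀ᶠ x in 𝓝 a, ‖Q x‖ < 1 / 8 :=
      hQc.norm.eventually_lt continuousAt_const (by rw [hQa]; exact hq)
    filter_upwards [hev, (D.isOpen_flatDom i).mem_nhds ha,
      continuousAt_fst.eventually_ne (haq ▸ D.basePoint_ne_zero i k _ : a.1 ≠ 0)] with x hx hxi hx0
    rw [nodalLabel, tateCoord_tateCoord]
    refine (D.tateLabel_flatToLog m.2 hx hxi ?_).2
    have h5 : -((poleSign i : ℂ) * D.scale * Q x) =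
        Complex.log (x.1 * starRingEnd ℂ (D.flatDir i k)) := by
      simp only [hQ]
      field_simp
      linear_combination (Complex.log (x.1 * starRingEnd ℂ (D.flatDir i k))) * hp
    rw [basePoint, h5, Complex.exp_log (mul_ne_zero hx0 (by simpa using D.flatDir_ne_zero i k)),
      mul_left_comm, flatDir_mul_conj, mul_one]

end MonodromyDatum

/-! ### The total space -/

namespace MonodromyDatum

variable {K : Type} {D : MonodromyDatum K}

lemma stereo_ne_of_mem_flatDom {i : Bool} {x : ℂ × ℂ} (hx : x ∈ D.flatDom i) (k : K) :
    stereo i x.1 ≠ stereo false (D.dir k) := by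
  intro h
  have h1 : D.dir k = D.basePoint false k 0 := by rw [basePoint_zero]; rfl
  rw [h1, D.stereo_eq_iff, basePoint_zero] at h
  exact D.ne_mul_flatDir hx k le_rfl (by simp [h])

lemma basePoint_eq {k l : K} {q q' : ℂ} (hq : ‖q‖ < 1 / 8) (hq' : ‖q'‖ < 1 / 8)
    (h : D.basePoint false k q = D.basePoint false l q') : k = l ∧ q = q' := by
  have hkl : k = l := by
    rw [basePoint_false, basePoint_false] at h
    exact D.disjoint _ _ _ _ hq hq' h
  subst hkl
  exact ⟨rfl, D.eq_of_basePoint_eq hq hq' h⟩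

lemma surjective_latticeMap {f : (ℤ × ℤ) × (ℤ × ℤ)} (hf : latticeDet f.1 f.2 = 1) :
    Function.Surjective (latticeMap f) := by
  intro t
  have h : ((f.1.1 : ℝ) * f.2.2 - f.1.2 * f.2.1) = 1 := by
    rw [latticeDet] at hf
    exact_mod_cast hf
  refine ⟨⟨t.re * f.2.2 - t.im * f.2.1, f.1.1 * t.im - f.1.2 * t.re⟩, Complex.ext ?_ ?_⟩
  · simp [latticeMap, frameMap_apply, gaussian_re]
    linear_combination t.re * h
  · simp [latticeMap, frameMap_apply, gaussian_im]
    linear_combination t.im * h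

/-- The base is covered by the bases of the two flat pieces, except for the singular values. -/
lemma singular_or_flat (p : TwoSphere) :
    (∃ k, p = stereo false (D.dir k)) ∨ ∃ i b, p = stereo i b ∧ (b, 0) ∈ D.flatDom i := by
  rcases exists_eq_stereo p with ⟨b, rfl⟩ | rfl
  · by_cases hb : (b, 0) ∈ D.flatDom false
    · exact Or.inr ⟨false, b, rfl, hb⟩
    · simp only [flatDom, Set.mem_ofPred_eq, not_forall] at hb
      obtain ⟨k, hk⟩ := hb
      rw [Complex.mem_slitPlane_iff, not_or, not_lt, not_not] at hk
      obtain ⟨r, hr⟩ : ∃ r : ℝ, b * starRingEnd ℂ (D.flatDir false k) = r :=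
        ⟨_, Complex.ext rfl (by have := hk.2; simp at this ⊢; linarith)⟩
      rw [hr] at hk
      simp at hk
      have hbr : b = r * D.flatDir false k := by
        rw [← hr, mul_assoc, mul_comm (starRingEnd ℂ _), flatDir_mul_conj, mul_one]
      rcases hk.eq_or_lt with h1 | h1
      · left
        refine ⟨k, ?_⟩
        rw [hbr, ← h1]
        simp [flatDir]
      · right
        have hb0 : b ≠ 0 := by
          rw [hbr]
          exact mul_ne_zero (by exact_mod_cast (by linarith : r ≠ 0)) (D.flatDir_ne_zero _ _)
        refine ⟨true, b⁻¹, (stereo_not hb0 false).symm, fun l => Or.inl ?_⟩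
        have hn : ‖b⁻¹ * starRingEnd ℂ (D.flatDir true l)‖ < 1 := by
          rw [norm_mul, RCLike.norm_conj, norm_flatDir, mul_one, norm_inv, hbr, norm_mul,
            norm_flatDir, mul_one, Complex.norm_real, Real.norm_of_nonneg (by linarith)]
          exact inv_lt_one_of_one_lt₀ h1
        have := (Complex.re_le_norm _).trans_lt hn
        simpa using this
  · exact Or.inr ⟨true, 0, rfl, fun k => by simp⟩

variable (D)

lemma locally_injective_flatLabel (i : Bool) (a : ℂ × ℂ) :
    ∃ V ∈ 𝓝 a, Set.InjOn (D.flatLabel i) V := by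
  refine ⟨Metric.ball a (1 / 2), Metric.ball_mem_nhds _ (by norm_num), fun x hx y hy h => ?_⟩
  obtain ⟨h1, h2⟩ := (D.flatLabel_eq_iff i x y).1 h
  refine Prod.ext h1 (eq_of_torusExp_eq h2 ?_)
  have h3 : dist x y < 1 := by
    have := dist_triangle_right x y a
    rw [Metric.mem_ball] at hx hy
    linarith
  exact (le_max_right _ _).trans_lt h3

lemma locally_injective_nodalLabel (k : K) {a : ℂ × ℂ} (ha : a ∈ nodalDom) :
    ∃ V ∈ 𝓝 a, Set.InjOn (D.nodalLabel k) V := by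
  obtain ⟨h1, h2, h3⟩ := ha
  have hV : {x : ℂ × ℂ | ‖x.1‖ < ‖a.1‖ + 1 / 8 ∧ ‖x.2‖ < ‖a.2‖ + 1 / 8} ∈ 𝓝 a := by
    refine Filter.inter_mem ?_ ?_
    · exact continuousAt_fst.norm.eventually_lt continuousAt_const (by linarith)
    · exact continuousAt_snd.norm.eventually_lt continuousAt_const (by linarith)
  refine ⟨_, Filter.inter_mem hV (isOpen_nodalDom.mem_nhds ⟨h1, h2, h3⟩), ?_⟩
  rintro x ⟨⟨hx1, hx2⟩, hx⟩ y ⟨⟨hy1, hy2⟩, hy⟩ h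
  rw [norm_mul] at h3
  -- on this neighbourhood the products which are equal to `1` for shifted points are small
  have key : ∀ z w : ℂ, ‖z‖ < ‖a.1‖ + 1 / 8 → ‖w‖ < ‖a.2‖ + 1 / 8 →
      z * signConj (D.sign k) w ≠ 1 := by
    intro z w hz hw hzw
    have h4 : ‖z‖ * ‖w‖ = 1 := by
      rw [← norm_signConj (D.sign k) w, ← norm_mul, hzw, norm_one]
    nlinarith [norm_nonneg z, norm_nonneg w, norm_nonneg a.1, norm_nonneg a.2]
  rcases D.tateRel_of_label_eq (D.tateCoord_mem (k := k) hx) (D.tateCoord_mem (k := k) hy) h with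
    h | ⟨-, h⟩ | ⟨-, h⟩
  · rw [← D.tateCoord_tateCoord k x, h, tateCoord_tateCoord]
  · exact absurd h (key _ _ hx1 hy2)
  · exact absurd h (key _ _ hy1 hx2)

variable [Finite K]

/-- The gluing of the flat pieces and the nodal pieces. -/
noncomputable def gluing : LabelledGluing (Bool ⊕ K) (TwoSphere × TwoTorus × ℂ) where
  dom := Sum.elim D.flatDom fun _ => nodalDom
  label := Sum.elim D.flatLabel D.nodalLabel
  isOpen_dom := by
    rintro (i | k)
    · exact D.isOpen_flatDom i
    · exact isOpen_nodalDom
  nonempty := ⟨Sum.inl false, 0, fun k => by simp⟩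
  locally_injective := by
    rintro (i | k) a ha
    · exact D.locally_injective_flatLabel i a
    · exact D.locally_injective_nodalLabel k ha
  isTransition := by
    rintro (i | k) (j | l) a ha b hb h
    · cases i <;> cases j
      · exact D.isTransition_flat_same _ h
      · exact (D.isTransition_flat_true_false hb ha h.symm).symm
      · exact D.isTransition_flat_true_false ha hb h
      · exact D.isTransition_flat_same _ h
    · exact D.isTransition_flat_nodal ha hb h
    · exact (D.isTransition_flat_nodal hb ha h.symm).symm
    · exact D.isTransition_nodal ha hb h

/-- The total space of the fibration. -/
abbrev Total : Type := D.gluing.Space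

/-- The points of the total space that come from a flat piece. -/
noncomputable def flatPoint (i : Bool) (x : ℂ × ℂ) : D.Total := D.gluing.point (Sum.inl i) x

/-- The points of the total space that come from a nodal piece, in the holomorphic model. -/
noncomputable def nodalPoint (k : K) (x : ℂ × ℂ) : D.Total :=
  D.gluing.point (Sum.inr k) (D.tateCoord k x)

/-- The projection of the total space to the two-sphere. -/
noncomputable def proj (x : D.Total) : TwoSphere := x.val.1

variable {D}

lemma val_flatPoint {i : Bool} {x : ℂ × ℂ} (hx : x ∈ D.flatDom i) :
    (D.flatPoint i x).val = D.flatLabel i x :=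
  LabelledGluing.val_point (G := D.gluing) (i := Sum.inl i) hx

lemma val_nodalPoint {k : K} {x : ℂ × ℂ} (hx : x ∈ nodalDom) :
    (D.nodalPoint k x).val = D.tateLabel k x := by
  have h := LabelledGluing.val_point (G := D.gluing) (i := Sum.inr k) (D.tateCoord_mem (k := k) hx)
  rw [nodalPoint, h]
  change D.tateLabel k (D.tateCoord k (D.tateCoord k x)) = _
  rw [tateCoord_tateCoord]

lemma proj_flatPoint {i : Bool} {x : ℂ × ℂ} (hx : x ∈ D.flatDom i) :
    D.proj (D.flatPoint i x) = stereo i x.1 := by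
  rw [proj, val_flatPoint hx]; rfl

lemma proj_nodalPoint {k : K} {x : ℂ × ℂ} (hx : x ∈ nodalDom) :
    D.proj (D.nodalPoint k x) = stereo false (D.basePoint false k (x.1 * x.2)) := by
  rw [proj, val_nodalPoint hx, tateLabel_fst]

lemma flatPoint_eq_iff {i : Bool} {x y : ℂ × ℂ} (hx : x ∈ D.flatDom i) (hy : y ∈ D.flatDom i) :
    D.flatPoint i x = D.flatPoint i y ↔ x.1 = y.1 ∧ torusExp x.2 = torusExp y.2 := by
  rw [LabelledGluing.Space.ext_iff, val_flatPoint hx, val_flatPoint hy, flatLabel_eq_iff]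

lemma nodalPoint_eq_iff {k : K} {x y : ℂ × ℂ} (hx : x ∈ nodalDom) (hy : y ∈ nodalDom) :
    D.nodalPoint k x = D.nodalPoint k y ↔ TateRel x y := by
  rw [LabelledGluing.Space.ext_iff, val_nodalPoint hx, val_nodalPoint hy]
  exact ⟨D.tateRel_of_label_eq hx hy, D.tateLabel_eq_of_tateRel hx hy⟩

lemma isOpen_image_flatPoint {i : Bool} {W : Set (ℂ × ℂ)} (hW : IsOpen W)
    (hWi : W ⊆ D.flatDom i) : IsOpen (D.flatPoint i '' W) :=
  LabelledGluing.isOpen_image_point (i := Sum.inl i) hW hWi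

lemma isOpen_image_nodalPoint {k : K} {W : Set (ℂ × ℂ)} (hW : IsOpen W)
    (hWi : W ⊆ nodalDom) : IsOpen (D.nodalPoint k '' W) := by
  have h := LabelledGluing.isOpen_image_point (G := D.gluing) (i := Sum.inr k)
    (W := D.tateCoord k ⁻¹' W) (hW.preimage (D.continuous_tateCoord k)) fun x hx => by
      rw [← D.tateCoord_tateCoord k x]
      exact D.tateCoord_mem (hWi hx)
  convert h using 1
  ext p
  constructor
  · rintro ⟨x, hx, rfl⟩
    exact ⟨D.tateCoord k x, by rwa [Set.mem_preimage, tateCoord_tateCoord], rfl⟩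
  · rintro ⟨x, hx, rfl⟩
    exact ⟨D.tateCoord k x, hx, by rw [nodalPoint, tateCoord_tateCoord]⟩

lemma contMDiffAt_flatPoint {i : Bool} {x : ℂ × ℂ} (hx : x ∈ D.flatDom i) :
    ContMDiffAt 𝓘(ℝ, ℂ × ℂ) 𝓘(ℝ, ℂ × ℂ) ∞ (D.flatPoint i) x :=
  LabelledGluing.contMDiffAt_point (i := Sum.inl i) hx

lemma contMDiffAt_nodalPoint {k : K} {x : ℂ × ℂ} (hx : x ∈ nodalDom) :
    ContMDiffAt 𝓘(ℝ, ℂ × ℂ) 𝓘(ℝ, ℂ × ℂ) ∞ (D.nodalPoint k) x :=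
  ContMDiffAt.comp x (g := D.gluing.point (Sum.inr k)) (f := D.tateCoord k)
    (LabelledGluing.contMDiffAt_point (i := Sum.inr k) (D.tateCoord_mem hx))
    (D.hasJacobianSign_tateCoord k x).1.contMDiffAt

lemma continuousOn_nodalPoint (k : K) : ContinuousOn (D.nodalPoint k) nodalDom :=
  fun _ hx => (contMDiffAt_nodalPoint hx).continuousAt.continuousWithinAt

lemma continuousOn_flatPoint (i : Bool) : ContinuousOn (D.flatPoint i) (D.flatDom i) :=
  fun _ hx => (contMDiffAt_flatPoint hx).continuousAt.continuousWithinAt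

lemma exists_eq_flatPoint_or_nodalPoint (x : D.Total) :
    (∃ i, ∃ a ∈ D.flatDom i, x = D.flatPoint i a) ∨
      ∃ k, ∃ a ∈ nodalDom, x = D.nodalPoint k a := by
  obtain ⟨i | k, a, ha, rfl⟩ := LabelledGluing.exists_eq_point x
  · exact Or.inl ⟨i, a, ha, rfl⟩
  · refine Or.inr ⟨k, D.tateCoord k a, D.tateCoord_mem ha, ?_⟩
    rw [nodalPoint, tateCoord_tateCoord]

lemma contMDiff_proj : ContMDiff 𝓘(ℝ, ℂ × ℂ) (𝓡 2) ∞ D.proj := by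
  intro x
  obtain ⟨i | k, a, ha, rfl⟩ := LabelledGluing.exists_eq_point x
  · refine LabelledGluing.contMDiffAt_of_comp_point ha ?_
    have h : ContMDiffAt 𝓘(ℝ, ℂ × ℂ) (𝓡 2) ∞ (fun x : ℂ × ℂ => stereo i x.1) a :=
      (contMDiff_stereo i).contMDiffAt.comp a contDiffAt_fst.contMDiffAt
    refine h.congr_of_eventuallyEq ?_
    filter_upwards [(D.isOpen_flatDom i).mem_nhds ha] with x hx
    exact proj_flatPoint hx
  · refine LabelledGluing.contMDiffAt_of_comp_point ha ?_
    have h1 : ContDiffAt ℝ ∞ (fun x : ℂ × ℂ => D.basePoint false k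
        ((D.tateCoord k x).1 * (D.tateCoord k x).2)) a := by
      have h2 := (D.hasJacobianSign_tateCoord k a).1
      exact contDiffAt_const.mul (ContDiffAt.cexp (contDiffAt_const.mul
        (h2.fst.mul h2.snd)).neg)
    refine ((contMDiff_stereo false).contMDiffAt.comp a h1.contMDiffAt).congr_of_eventuallyEq ?_
    filter_upwards [isOpen_nodalDom.mem_nhds ha] with x hx
    rw [← D.tateCoord_tateCoord k x]
    have := proj_nodalPoint (D := D) (k := k) (D.tateCoord_mem (k := k) hx)
    rw [nodalPoint] at this
    rw [this]
    simp [tateCoord_tateCoord]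

lemma continuous_proj : Continuous D.proj := contMDiff_proj.continuous

/-- A point of the total space lies in a nodal fibre, or its label is of the kind used on the flat
pieces. -/
lemma nodal_or_flat_label (x : D.Total) :
    (∃ k, ∃ a ∈ nodalDom, a.1 * a.2 = 0 ∧ x = D.nodalPoint k a) ∨
      ((∀ k, D.proj x ≠ stereo false (D.dir k)) ∧ ∃ y, x.val.2 = (torusExp y, 0)) := by
  rcases exists_eq_flatPoint_or_nodalPoint x with ⟨i, a, ha, rfl⟩ | ⟨k, a, ha, rfl⟩
  · refine Or.inr ⟨fun k => ?_, _, by rw [val_flatPoint ha]; rfl⟩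
    rw [proj_flatPoint ha]
    exact stereo_ne_of_mem_flatDom ha k
  · by_cases h : a.1 * a.2 = 0
    · exact Or.inl ⟨k, a, ha, h, rfl⟩
    · refine Or.inr ⟨fun l hl => ?_, ?_⟩
      · rw [proj_nodalPoint ha] at hl
        have h1 : D.dir l = D.basePoint false l 0 := by rw [basePoint_zero]; rfl
        rw [h1] at hl
        exact h (basePoint_eq ha.2.2 (by simp) (stereo_injective _ hl)).2
      · rw [val_nodalPoint ha, tateLabel, if_neg h]
        exact ⟨_, rfl⟩

/-- The fibre over a regular point of the base is covered by the flat piece over this point. -/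
lemma exists_eq_flatPoint {i : Bool} {b : ℂ} (hb : (b, 0) ∈ D.flatDom i) {x : D.Total}
    (hx : D.proj x = stereo i b) : ∃ y, x = D.flatPoint i (b, y) := by
  rcases nodal_or_flat_label x with ⟨k, a, ha, ha0, rfl⟩ | ⟨-, t, ht⟩
  · rw [proj_nodalPoint ha, ha0, basePoint_zero] at hx
    exact absurd hx.symm (stereo_ne_of_mem_flatDom hb k)
  · obtain ⟨y, hy⟩ := surjective_latticeMap (D.det_flatFrame i b) t
    refine ⟨y, LabelledGluing.Space.ext ?_⟩
    rw [val_flatPoint (show (b, y) ∈ D.flatDom i from hb)]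
    exact Prod.ext hx (by rw [ht, ← hy]; rfl)

/-- The fibres over the neighbourhoods of the singular values are covered by a bounded part of the
nodal pieces. -/
lemma exists_eq_nodalPoint {k : K} {q : ℂ} (hq : ‖q‖ < 1 / 8) {x : D.Total}
    (hx : D.proj x = stereo false (D.basePoint false k q)) :
    ∃ z w, ‖z‖ ≤ 1 ∧ ‖w‖ ≤ 1 ∧ z * w = q ∧ x = D.nodalPoint k (z, w) := by
  rcases nodal_or_flat_label x with ⟨l, ⟨z, w⟩, ha, ha0, rfl⟩ | ⟨hne, t, ht⟩
  · have hx' := hx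
    rw [proj_nodalPoint ha] at hx'
    obtain ⟨rfl, hq'⟩ := basePoint_eq ha.2.2 hq (stereo_injective _ hx')
    simp only at ha0 hq'
    by_cases hz : ‖z‖ ≤ 1
    · by_cases hw : ‖w‖ ≤ 1
      · exact ⟨z, w, hz, hw, hq', rfl⟩
      · have hw0 : w ≠ 0 := by rintro rfl; simp at hw
        have hz0 : z = 0 := (mul_eq_zero.1 ha0).resolve_right hw0
        have h1 : ‖w⁻¹‖ ≤ 1 := by rw [norm_inv]; exact inv_le_one_of_one_le₀ (not_le.1 hw).le
        refine ⟨w⁻¹, 0, h1, by simp, by rw [← hq', ha0]; simp, ?_⟩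
        refine (nodalPoint_eq_iff ha ⟨?_, ?_, ?_⟩).2 (Or.inr (Or.inr ⟨by simp [hz0], ?_⟩))
        · simp only; linarith
        · simp
        · simp
        · simp [hw0]
    · have hz0 : z ≠ 0 := by rintro rfl; simp at hz
      have hw0 : w = 0 := (mul_eq_zero.1 ha0).resolve_left hz0
      have h1 : ‖z⁻¹‖ ≤ 1 := by rw [norm_inv]; exact inv_le_one_of_one_le₀ (not_le.1 hz).le
      refine ⟨0, z⁻¹, by simp, h1, by rw [← hq', ha0]; simp, ?_⟩
      refine (nodalPoint_eq_iff ha ⟨?_, ?_, ?_⟩).2 (Or.inr (Or.inl ⟨by simp [hw0], ?_⟩))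
      · simp
      · simp only; linarith
      · simp
      · simp [hz0]
  · have hq0 : q ≠ 0 := by
      rintro rfl
      exact hne k (by rw [hx, basePoint_zero]; rfl)
    set α := D.cycleCoord k t with hα
    set β := Int.fract (D.cocycleCoord k t) with hβ
    set ξ : ℂ := 2 * Real.pi * α * Complex.I + β * Complex.log q with hξ
    have hre : (Complex.log q).re < 0 := by
      rw [Complex.log_re]
      exact Real.log_neg (norm_pos_iff.2 hq0) (by linarith)
    have hξre : ξ.re = β * (Complex.log q).re := by rw [hξ]; simp
    have hβ0 : 0 ≤ β := Int.fract_nonneg _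
    have hβ1 : β < 1 := Int.fract_lt_one _
    have hz : ‖Complex.exp ξ‖ ≤ 1 := by
      rw [Complex.norm_exp, hξre, Real.exp_le_one_iff]
      nlinarith
    have hw : ‖Complex.exp (Complex.log q - ξ)‖ ≤ 1 := by
      rw [Complex.norm_exp, Complex.sub_re, hξre, Real.exp_le_one_iff]
      nlinarith
    have hzw : Complex.exp ξ * Complex.exp (Complex.log q - ξ) = q := by
      rw [← Complex.exp_add, add_sub_cancel, Complex.exp_log hq0]
    refine ⟨_, _, hz, hw, hzw, LabelledGluing.Space.ext ?_⟩
    rw [val_nodalPoint ⟨hz.trans_lt (by norm_num), hw.trans_lt (by norm_num), by rwa [hzw]⟩,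
      D.tateLabel_exp k (n := 0) (α := α) (β := β) hre (by rw [Complex.exp_log hq0]; simp) rfl,
      Complex.exp_log hq0]
    refine Prod.ext hx ?_
    rw [ht]
    simp only [Prod.mk.injEq, and_true]
    rw [← D.adapted_coords k t]
    refine (D.torusExp_adapted_eq_iff k _ _ _ _).2 ⟨(0, ⌊D.cocycleCoord k t⌋), ?_, ?_⟩
    · simp [hα]
    · simp [hβ]

end MonodromyDatum

namespace MonodromyDatum

variable {K : Type} (D : MonodromyDatum K)

/-! ### Coordinates near the singular values -/

lemma basePoint_eq_of_log {k : K} {b : ℂ} (hb : b ≠ 0) :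
    D.basePoint false k (-(Complex.log (b * starRingEnd ℂ (D.dir k)) / D.scale)) = b := by
  have hscale : (D.scale : ℂ) ≠ 0 := by exact_mod_cast D.scale_pos.ne'
  have h : -((D.scale : ℂ) * -(Complex.log (b * starRingEnd ℂ (D.dir k)) / D.scale)) =
      Complex.log (b * starRingEnd ℂ (D.dir k)) := by
    field_simp
  have h2 := D.flatDir_mul_conj false k
  simp only [flatDir, Bool.false_eq_true, if_false] at h2
  rw [basePoint_false, h, Complex.exp_log (mul_ne_zero hb (by simpa using D.dir_ne_zero k)),
    mul_left_comm, h2, mul_one]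

lemma log_div_basePoint {k : K} {q : ℂ} (hq : ‖q‖ < 1 / 8) :
    -(Complex.log (D.basePoint false k q * starRingEnd ℂ (D.dir k)) / D.scale) = q := by
  have hscale : (D.scale : ℂ) ≠ 0 := by exact_mod_cast D.scale_pos.ne'
  have h := D.log_basePoint false k hq
  simp only [flatDir, Bool.false_eq_true, if_false] at h
  rw [h]
  simp [poleSign]
  field_simp

lemma basePoint_mul_conj_mem_slitPlane {k : K} {q : ℂ} (hq : ‖q‖ < 1 / 8) :
    D.basePoint false k q * starRingEnd ℂ (D.dir k) ∈ Complex.slitPlane := by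
  have hpi := Real.pi_gt_three
  have h := D.log_basePoint false k hq
  simp only [flatDir, Bool.false_eq_true, if_false] at h
  rw [Complex.mem_slitPlane_iff_arg, ← Complex.log_im, h]
  refine ⟨?_, mul_ne_zero (D.basePoint_ne_zero false k q) (by simpa using D.dir_ne_zero k)⟩
  have h1 : ‖-((poleSign false : ℂ) * D.scale * q)‖ < 1 / 8 := by
    simpa [poleSign] using D.scale_mul_norm_lt hq
  have h2 := (Complex.abs_im_le_norm _).trans_lt h1
  rw [abs_lt] at h2
  intro hcon
  linarith

lemma isOpen_image_basePoint (k : K) :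
    IsOpen (D.basePoint false k '' Metric.ball 0 (1 / 8)) := by
  rw [isOpen_iff_mem_nhds]
  rintro _ ⟨q, hq, rfl⟩
  have hq' : ‖q‖ < 1 / 8 := by simpa using hq
  have hc : ContinuousAt (fun b : ℂ => b * starRingEnd ℂ (D.dir k)) (D.basePoint false k q) :=
    continuousAt_id.mul continuousAt_const
  have hc' := ((hc.clog (D.basePoint_mul_conj_mem_slitPlane hq')).div_const (D.scale : ℂ)).neg
  have h1 : ∀ᶠ b in 𝓝 (D.basePoint false k q),
      -(Complex.log (b * starRingEnd ℂ (D.dir k)) / D.scale) ∈ Metric.ball (0 : ℂ) (1 / 8) := by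
    refine hc'.eventually_mem (Metric.isOpen_ball.mem_nhds ?_)
    rw [Pi.neg_apply, D.log_div_basePoint hq']
    exact hq
  have h2 : ∀ᶠ b in 𝓝 (D.basePoint false k q), b ≠ 0 :=
    isOpen_ne.mem_nhds (D.basePoint_ne_zero false k q)
  filter_upwards [h1, h2] with b hb hb0
  exact ⟨-(Complex.log (b * starRingEnd ℂ (D.dir k)) / D.scale), hb, D.basePoint_eq_of_log hb0⟩

/-- The complex coordinate `q` of the sphere centred at a singular value. -/
noncomputable def nodeCoord (k : K) : OpenPartialHomeomorph TwoSphere ℂ where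
  toFun p := -(Complex.log (stereoInv false p * starRingEnd ℂ (D.dir k)) / D.scale)
  invFun q := stereo false (D.basePoint false k q)
  source := stereo false '' (D.basePoint false k '' Metric.ball 0 (1 / 8))
  target := Metric.ball 0 (1 / 8)
  map_source' := by
    rintro _ ⟨_, ⟨q, hq, rfl⟩, rfl⟩
    rwa [stereoInv_stereo, D.log_div_basePoint (by simpa using hq)]
  map_target' q hq := ⟨_, ⟨q, hq, rfl⟩, rfl⟩
  left_inv' := by
    rintro _ ⟨_, ⟨q, hq, rfl⟩, rfl⟩
    rw [stereoInv_stereo, D.log_div_basePoint (by simpa using hq)]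
  right_inv' q hq := by
    rw [stereoInv_stereo, D.log_div_basePoint (by simpa using hq)]
  open_target := Metric.isOpen_ball
  open_source := isOpen_image_stereo false (D.isOpen_image_basePoint k)
  continuousOn_toFun := by
    rintro _ ⟨_, ⟨q, hq, rfl⟩, rfl⟩
    have hq' : ‖q‖ < 1 / 8 := by simpa using hq
    refine ContinuousAt.continuousWithinAt ?_
    refine (ContinuousAt.div_const (ContinuousAt.clog ?_ ?_) _).neg
    · exact (contMDiffAt_stereoInv_stereo false _).continuousAt.mul continuousAt_const
    · rw [stereoInv_stereo]
      exact D.basePoint_mul_conj_mem_slitPlane hq'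
  continuousOn_invFun := by
    refine Continuous.continuousOn ((continuous_stereo false).comp ?_)
    unfold basePoint
    fun_prop

lemma isSphereCoordinate_nodeCoord (k : K) : IsSphereCoordinate (D.nodeCoord k) := by
  constructor
  · rintro _ ⟨_, ⟨q, hq, rfl⟩, rfl⟩
    have hq' : ‖q‖ < 1 / 8 := by simpa using hq
    refine ContMDiffAt.contMDiffWithinAt ?_
    have h1 := contMDiffAt_stereoInv_stereo false (D.basePoint false k q)
    have h2 : ContDiffAt ℂ ∞ (fun b : ℂ =>
        -(Complex.log (b * starRingEnd ℂ (D.dir k)) / D.scale)) (D.basePoint false k q) :=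
      ((ContDiffAt.comp (D.basePoint false k q) (g := Complex.log)
        (f := fun b => b * starRingEnd ℂ (D.dir k))
        (Complex.contDiffAt_log (D.basePoint_mul_conj_mem_slitPlane hq'))
        (contDiffAt_id.mul contDiffAt_const)).div_const _).neg
    exact ContMDiffAt.comp (stereo false (D.basePoint false k q)) (f := stereoInv false)
      (g := fun b : ℂ => -(Complex.log (b * starRingEnd ℂ (D.dir k)) / D.scale))
      (I' := 𝓘(ℝ, ℂ)) (by rw [stereoInv_stereo]; exact (h2.restrict_scalars ℝ).contMDiffAt) h1
  · refine ContMDiff.contMDiffOn ((contMDiff_stereo false).comp ?_)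
    have : ContDiff ℝ ∞ fun q : ℂ => D.basePoint false k q := by
      unfold basePoint
      exact contDiff_const.mul (ContDiff.cexp (contDiff_const.mul contDiff_id).neg)
    exact this.contMDiff

lemma mem_nodeCoord_source_iff {k : K} {p : TwoSphere} : p ∈ (D.nodeCoord k).source ↔
    ∃ q, ‖q‖ < 1 / 8 ∧ p = stereo false (D.basePoint false k q) := by
  constructor
  · rintro ⟨_, ⟨q, hq, rfl⟩, rfl⟩
    exact ⟨q, by simpa using hq, rfl⟩
  · rintro ⟨q, hq, rfl⟩
    exact ⟨_, ⟨q, by simpa using hq, rfl⟩, rfl⟩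

lemma nodeCoord_apply {k : K} {q : ℂ} (hq : ‖q‖ < 1 / 8) :
    D.nodeCoord k (stereo false (D.basePoint false k q)) = q :=
  (D.nodeCoord k).right_inv (show q ∈ Metric.ball 0 (1 / 8) by simpa using hq)

/-! ### Separation and compactness of the total space -/

variable [Finite K] {D}

lemma isClosed_tateRel : IsClosed {x : (ℂ × ℂ) × (ℂ × ℂ) | TateRel x.1 x.2} := by
  refine (isClosed_eq continuous_fst continuous_snd).union (IsClosed.union ?_ ?_)
  · exact (isClosed_eq (by fun_prop) (by fun_prop)).inter (isClosed_eq (by fun_prop) (by fun_prop))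
  · exact (isClosed_eq (by fun_prop) (by fun_prop)).inter (isClosed_eq (by fun_prop) (by fun_prop))

/-- Points of different fibres are separated in the base, points of one fibre in the piece which
contains the whole fibre: in a flat piece by the torus coordinate, in a nodal piece because its
equivalence relation is closed. -/
instance : T2Space D.Total := by
  refine ⟨fun x y hxy => ?_⟩
  by_cases hp : D.proj x = D.proj y
  · rcases D.singular_or_flat (D.proj x) with ⟨k, hk⟩ | ⟨i, b, hb, hbi⟩
    · have hk0 : stereo false (D.dir k) = stereo false (D.basePoint false k 0) := by
        rw [basePoint_zero]; rfl
      obtain ⟨z, w, hz, hw, hzw, rfl⟩ := exists_eq_nodalPoint (k := k) (q := 0) (by simp)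
        (hk.trans hk0)
      obtain ⟨z', w', hz', hw', hzw', rfl⟩ := exists_eq_nodalPoint (k := k) (q := 0) (by simp)
        ((hp.symm.trans hk).trans hk0)
      have hx : (z, w) ∈ nodalDom :=
        ⟨hz.trans_lt (by norm_num), hw.trans_lt (by norm_num), by simp [hzw]⟩
      have hy : (z', w') ∈ nodalDom :=
        ⟨hz'.trans_lt (by norm_num), hw'.trans_lt (by norm_num), by simp [hzw']⟩
      have hrel : ((z, w), (z', w')) ∈ {x : (ℂ × ℂ) × (ℂ × ℂ) | TateRel x.1 x.2}ᶜ :=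
        fun h => hxy ((nodalPoint_eq_iff hx hy).2 h)
      obtain ⟨U, V, hU, hV, hxU, hyV, hUV⟩ := isOpen_prod_iff.1 isClosed_tateRel.isOpen_compl _ _ hrel
      refine ⟨D.nodalPoint k '' (U ∩ nodalDom), D.nodalPoint k '' (V ∩ nodalDom),
        isOpen_image_nodalPoint (hU.inter isOpen_nodalDom) Set.inter_subset_right,
        isOpen_image_nodalPoint (hV.inter isOpen_nodalDom) Set.inter_subset_right,
        ⟨_, ⟨hxU, hx⟩, rfl⟩, ⟨_, ⟨hyV, hy⟩, rfl⟩, ?_⟩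
      rw [Set.disjoint_left]
      rintro _ ⟨a, ⟨haU, ha⟩, rfl⟩ ⟨c, ⟨hcV, hc⟩, hac⟩
      exact hUV (Set.mk_mem_prod haU hcV) ((nodalPoint_eq_iff ha hc).1 hac.symm)
    · obtain ⟨y₁, rfl⟩ := exists_eq_flatPoint hbi hb
      obtain ⟨y₂, rfl⟩ := exists_eq_flatPoint hbi (hp.symm.trans hb)
      have hy : torusExp y₁ ≠ torusExp y₂ := fun h =>
        hxy ((flatPoint_eq_iff (x := (b, y₁)) (y := (b, y₂)) hbi hbi).2 ⟨rfl, h⟩)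
      obtain ⟨U, V, hU, hV, hxU, hyV, hUV⟩ := t2_separation hy
      have hc : Continuous fun x : ℂ × ℂ => torusExp x.2 := continuous_torusExp.comp continuous_snd
      refine ⟨D.flatPoint i '' ((fun x : ℂ × ℂ => torusExp x.2) ⁻¹' U ∩ D.flatDom i),
        D.flatPoint i '' ((fun x : ℂ × ℂ => torusExp x.2) ⁻¹' V ∩ D.flatDom i),
        isOpen_image_flatPoint ((hU.preimage hc).inter (D.isOpen_flatDom i)) Set.inter_subset_right,
        isOpen_image_flatPoint ((hV.preimage hc).inter (D.isOpen_flatDom i)) Set.inter_subset_right,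
        ⟨(b, y₁), ⟨hxU, hbi⟩, rfl⟩, ⟨(b, y₂), ⟨hyV, hbi⟩, rfl⟩, ?_⟩
      rw [Set.disjoint_left]
      rintro _ ⟨a, ⟨haU, ha⟩, rfl⟩ ⟨c, ⟨hcV, hc⟩, hac⟩
      have h := ((flatPoint_eq_iff ha hc).1 hac.symm).2
      rw [Set.mem_preimage] at haU hcV
      rw [h] at haU
      exact Set.disjoint_left.1 hUV haU hcV
  · obtain ⟨U, V, hU, hV, hxU, hyV, hUV⟩ := t2_separation hp
    exact ⟨_, _, hU.preimage continuous_proj, hV.preimage continuous_proj, hxU, hyV,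
      hUV.preimage _⟩

/-- Fractional parts of the coordinates: every point of the torus has a representative in a bounded
part of the plane. -/
lemma exists_norm_le_torusExp_eq (y : ℂ) : ∃ y', ‖y'‖ ≤ 2 ∧ torusExp y' = torusExp y := by
  refine ⟨⟨Int.fract y.re, Int.fract y.im⟩, ?_, ?_⟩
  · refine (Complex.norm_le_abs_re_add_abs_im _).trans ?_
    simp only [abs_of_nonneg (Int.fract_nonneg y.re), abs_of_nonneg (Int.fract_nonneg y.im)]
    linarith [Int.fract_lt_one y.re, Int.fract_lt_one y.im]
  · symm
    rw [torusExp_eq_iff]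
    refine ⟨(⌊y.re⌋, ⌊y.im⌋), Complex.ext ?_ ?_⟩
    · rw [gaussian_re, Complex.sub_re, Int.self_sub_fract]
    · rw [gaussian_im, Complex.sub_im, Int.self_sub_fract]

/-- The projection is proper, locally over the base: a fibre and its neighbours are covered by a compact
part of one piece. -/
lemma exists_isCompact_preimage (p : TwoSphere) :
    ∃ V ∈ 𝓝 p, ∃ L : Set D.Total, IsCompact L ∧ D.proj ⁻¹' V ⊆ L := by
  rcases D.singular_or_flat p with ⟨k, rfl⟩ | ⟨i, b, rfl, hb⟩
  · set A : Set (ℂ × ℂ) := {x | ‖x.1‖ ≤ 1 ∧ ‖x.2‖ ≤ 1 ∧ ‖x.1 * x.2‖ ≤ 1 / 16} with hA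
    have hAc : IsCompact A := by
      have h1 : IsClosed {x : ℂ × ℂ | ‖x.1‖ ≤ 1} := isClosed_le (by fun_prop) continuous_const
      have h2 : IsClosed {x : ℂ × ℂ | ‖x.2‖ ≤ 1} := isClosed_le (by fun_prop) continuous_const
      have h3 : IsClosed {x : ℂ × ℂ | ‖x.1 * x.2‖ ≤ 1 / 16} :=
        isClosed_le (by fun_prop) continuous_const
      refine (isCompact_closedBall (0 : ℂ × ℂ) 1).of_isClosed_subset (h1.inter (h2.inter h3)) fun x hx => ?_
      rw [mem_closedBall_zero_iff]
      exact max_le hx.1 hx.2.1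
    have hAd : A ⊆ nodalDom := fun x hx =>
      ⟨hx.1.trans_lt (by norm_num), hx.2.1.trans_lt (by norm_num), hx.2.2.trans_lt (by norm_num)⟩
    have hsrc : stereo false (D.dir k) ∈ (D.nodeCoord k).source :=
      D.mem_nodeCoord_source_iff.2 ⟨0, by simp, by rw [basePoint_zero]; rfl⟩
    have hval : D.nodeCoord k (stereo false (D.dir k)) = 0 := by
      have : stereo false (D.dir k) = stereo false (D.basePoint false k 0) := by
        rw [basePoint_zero]; rfl
      rw [this, D.nodeCoord_apply (by simp)]
    refine ⟨(D.nodeCoord k).source ∩ D.nodeCoord k ⁻¹' Metric.ball 0 (1 / 16),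
      ((D.nodeCoord k).isOpen_inter_preimage Metric.isOpen_ball).mem_nhds
        ⟨hsrc, by rw [Set.mem_preimage, hval]; exact Metric.mem_ball_self (by norm_num)⟩,
      D.nodalPoint k '' A, hAc.image_of_continuousOn ((continuousOn_nodalPoint k).mono hAd), ?_⟩
    rintro x ⟨hx, hx'⟩
    obtain ⟨q, hq, hxq⟩ := D.mem_nodeCoord_source_iff.1 hx
    rw [Set.mem_preimage, hxq, D.nodeCoord_apply hq, mem_ball_zero_iff] at hx'
    obtain ⟨z, w, hz, hw, rfl, rfl⟩ := exists_eq_nodalPoint hq hxq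
    exact ⟨_, ⟨hz, hw, hx'.le⟩, rfl⟩
  · have hopen : IsOpen {b : ℂ | (b, (0 : ℂ)) ∈ D.flatDom i} :=
      (D.isOpen_flatDom i).preimage (by fun_prop : Continuous fun b : ℂ => (b, (0 : ℂ)))
    obtain ⟨r, hr, hball⟩ := Metric.nhds_basis_closedBall.mem_iff.1 (hopen.mem_nhds hb)
    refine ⟨stereo i '' Metric.ball b r, (isOpen_image_stereo i Metric.isOpen_ball).mem_nhds
      ⟨b, Metric.mem_ball_self hr, rfl⟩,
      D.flatPoint i '' (Metric.closedBall b r ×ˢ Metric.closedBall 0 2),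
      ((isCompact_closedBall b r).prod (isCompact_closedBall 0 2)).image_of_continuousOn
        ((continuousOn_flatPoint i).mono fun x hx => hball hx.1), ?_⟩
    rintro x ⟨b', hb', hx⟩
    have hb'i : (b', (0 : ℂ)) ∈ D.flatDom i := hball (Metric.ball_subset_closedBall hb')
    obtain ⟨y, rfl⟩ := exists_eq_flatPoint hb'i hx.symm
    obtain ⟨y', hy', hyy'⟩ := exists_norm_le_torusExp_eq y
    refine ⟨(b', y'), ⟨Metric.ball_subset_closedBall hb', by simpa using hy'⟩, ?_⟩
    exact (flatPoint_eq_iff (x := (b', y')) (y := (b', y)) hb'i hb'i).2 ⟨rfl, hyy'⟩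

instance : CompactSpace D.Total := by
  choose V hV L hL hVL using exists_isCompact_preimage (D := D)
  obtain ⟨t, -, ht⟩ := (isCompact_univ (X := TwoSphere)).elim_nhds_subcover V fun p _ => hV p
  refine ⟨?_⟩
  have h : (Set.univ : Set D.Total) = ⋃ p ∈ t, L p := by
    refine (Set.eq_univ_of_forall fun x => ?_).symm
    obtain ⟨p, hp, hxp⟩ := Set.mem_iUnion₂.1 (ht (Set.mem_univ (D.proj x)))
    exact Set.mem_iUnion₂.2 ⟨p, hp, hVL p hxp⟩
  rw [h]
  exact t.isCompact_biUnion fun p _ => hL p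

/-! ### The trivializations -/

variable (D)

/-- The part of the sphere over which the flat piece `i` lives. -/
def flatBase (i : Bool) : Set TwoSphere := stereo i '' {b | (b, 0) ∈ D.flatDom i}

lemma isOpen_flatBase (i : Bool) : IsOpen (D.flatBase i) :=
  isOpen_image_stereo i ((D.isOpen_flatDom i).preimage
    (by fun_prop : Continuous fun b : ℂ => (b, (0 : ℂ))))

open Classical in
/-- The point of the torus which corresponds to a point of the total space in the trivialization
given by a flat piece. -/
noncomputable def flatTorus (i : Bool) (x : D.Total) : TwoTorus :=
  if h : ∃ a ∈ D.flatDom i, D.flatPoint i a = x then torusExp h.choose.2 else 1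

variable {D}

lemma flatTorus_flatPoint {i : Bool} {a : ℂ × ℂ} (ha : a ∈ D.flatDom i) :
    D.flatTorus i (D.flatPoint i a) = torusExp a.2 := by
  have h : ∃ c ∈ D.flatDom i, D.flatPoint i c = D.flatPoint i a := ⟨a, ha, rfl⟩
  rw [flatTorus, dif_pos h]
  exact ((flatPoint_eq_iff h.choose_spec.1 ha).1 h.choose_spec.2).2

lemma flatPoint_torusLift {i : Bool} {b : ℂ} (hb : (b, 0) ∈ D.flatDom i) {y y' : ℂ}
    (h : torusExp y = torusExp y') : D.flatPoint i (b, y) = D.flatPoint i (b, y') :=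
  (flatPoint_eq_iff (x := (b, y)) (y := (b, y')) hb hb).2 ⟨rfl, h⟩

lemma contMDiffAt_trivialization {i : Bool} {x : TwoSphere × TwoTorus}
    (hx : x.1 ∈ D.flatBase i) :
    ContMDiffAt ((𝓡 2).prod ((𝓡 1).prod (𝓡 1))) 𝓘(ℝ, ℂ × ℂ) ∞
      (fun x : TwoSphere × TwoTorus => D.flatPoint i (stereoInv i x.1, torusLift 0 x.2)) x := by
  obtain ⟨p, t⟩ := x
  obtain ⟨b, hb, rfl⟩ := hx
  obtain ⟨y, rfl⟩ : ∃ y, torusExp y = t := ⟨_, torusExp_torusLift 0 t⟩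
  have h1 : ContMDiffAt ((𝓡 2).prod ((𝓡 1).prod (𝓡 1))) 𝓘(ℝ, ℂ × ℂ) ∞
      (fun x : TwoSphere × TwoTorus => (stereoInv i x.1, torusLift y x.2))
      (stereo i b, torusExp y) :=
    (ContMDiffAt.comp (stereo i b, torusExp y) (g := stereoInv i) (f := Prod.fst)
      (contMDiffAt_stereoInv_stereo i b) contMDiffAt_fst).prodMk_space
      (ContMDiffAt.comp (stereo i b, torusExp y) (g := torusLift y) (f := Prod.snd)
        (contMDiffAt_torusLift y) contMDiffAt_snd)
  have h2 := ContMDiffAt.comp (stereo i b, torusExp y) (g := D.flatPoint i)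
    (by rw [stereoInv_stereo]; exact contMDiffAt_flatPoint hb) h1
  refine h2.congr_of_eventuallyEq ?_
  have h3 : ContinuousAt (fun x : TwoSphere × TwoTorus => x.1) (stereo i b, torusExp y) :=
    continuousAt_fst
  filter_upwards [h3.preimage_mem_nhds ((D.isOpen_flatBase i).mem_nhds ⟨b, hb, rfl⟩)] with x hx
  obtain ⟨b', hb', hx'⟩ := hx
  simp only at hx'
  simp only [Function.comp_apply, ← hx', stereoInv_stereo]
  exact flatPoint_torusLift hb' (by rw [torusExp_torusLift, torusExp_torusLift])

lemma contMDiffAt_trivialization_symm {i : Bool} {a : ℂ × ℂ} (ha : a ∈ D.flatDom i) :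
    ContMDiffAt 𝓘(ℝ, ℂ × ℂ) ((𝓡 2).prod ((𝓡 1).prod (𝓡 1))) ∞
      (fun x => (D.proj x, D.flatTorus i x)) (D.flatPoint i a) := by
  refine LabelledGluing.contMDiffAt_of_comp_point (G := D.gluing) (i := Sum.inl i) ha ?_
  have h : ContMDiffAt 𝓘(ℝ, ℂ × ℂ) ((𝓡 2).prod ((𝓡 1).prod (𝓡 1))) ∞
      (fun x : ℂ × ℂ => (stereo i x.1, torusExp x.2)) a :=
    ((contMDiff_stereo i).contMDiffAt.comp a contDiffAt_fst.contMDiffAt).prodMk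
      (contMDiff_torusExp.contMDiffAt.comp a contDiffAt_snd.contMDiffAt)
  refine h.congr_of_eventuallyEq ?_
  filter_upwards [(D.isOpen_flatDom i).mem_nhds ha] with x hx
  exact Prod.ext (proj_flatPoint hx) (flatTorus_flatPoint hx)

lemma exists_eq_flatPoint_of_proj_mem {i : Bool} {x : D.Total} (hx : D.proj x ∈ D.flatBase i) :
    ∃ a ∈ D.flatDom i, x = D.flatPoint i a := by
  obtain ⟨b, hb, hbx⟩ := hx
  obtain ⟨y, rfl⟩ := exists_eq_flatPoint hb hbx.symm
  exact ⟨(b, y), hb, rfl⟩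

variable (D)

/-- The trivialization of the fibration over the base of a flat piece. -/
noncomputable def trivialization (i : Bool) :
    OpenPartialHomeomorph (TwoSphere × TwoTorus) D.Total where
  toFun x := D.flatPoint i (stereoInv i x.1, torusLift 0 x.2)
  invFun x := (D.proj x, D.flatTorus i x)
  source := D.flatBase i ×ˢ Set.univ
  target := D.proj ⁻¹' D.flatBase i
  map_source' := by
    rintro ⟨_, t⟩ ⟨⟨b, hb, rfl⟩, -⟩
    rw [Set.mem_preimage, stereoInv_stereo,
      proj_flatPoint (show (b, torusLift 0 t) ∈ D.flatDom i from hb)]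
    exact ⟨b, hb, rfl⟩
  map_target' x hx := ⟨hx, trivial⟩
  left_inv' := by
    rintro ⟨_, t⟩ ⟨⟨b, hb, rfl⟩, -⟩
    simp only [stereoInv_stereo]
    exact Prod.ext (proj_flatPoint (x := (b, torusLift 0 t)) hb)
      ((flatTorus_flatPoint (a := (b, torusLift 0 t)) hb).trans (torusExp_torusLift 0 t))
  right_inv' x hx := by
    obtain ⟨⟨b, y⟩, ha, rfl⟩ := exists_eq_flatPoint_of_proj_mem hx
    simp only [proj_flatPoint ha, flatTorus_flatPoint ha, stereoInv_stereo]
    exact flatPoint_torusLift ha (torusExp_torusLift 0 _)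
  open_source := (D.isOpen_flatBase i).prod isOpen_univ
  open_target := (D.isOpen_flatBase i).preimage continuous_proj
  continuousOn_toFun x hx := (contMDiffAt_trivialization hx.1).continuousAt.continuousWithinAt
  continuousOn_invFun x hx := by
    obtain ⟨a, ha, rfl⟩ := exists_eq_flatPoint_of_proj_mem hx
    exact (contMDiffAt_trivialization_symm ha).continuousAt.continuousWithinAt

lemma isTorusTrivialization (i : Bool) :
    IsTorusTrivialization D.proj (D.flatBase i) (D.trivialization i) where
  isOpen_base := D.isOpen_flatBase i
  source_eq := rfl
  target_eq := rfl
  over_base := by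
    rintro _ ⟨b, hb, rfl⟩ t
    change D.proj (D.flatPoint i (stereoInv i (stereo i b), torusLift 0 t)) = stereo i b
    rw [stereoInv_stereo, proj_flatPoint (show (b, torusLift 0 t) ∈ D.flatDom i from hb)]
  smooth x hx := (contMDiffAt_trivialization hx.1).contMDiffWithinAt
  smooth_symm x hx := by
    obtain ⟨a, ha, rfl⟩ := exists_eq_flatPoint_of_proj_mem hx
    exact (contMDiffAt_trivialization_symm ha).contMDiffWithinAt

lemma trivialization_apply {i : Bool} {b y : ℂ} (hb : (b, 0) ∈ D.flatDom i) :
    D.trivialization i (stereo i b, torusExp y) = D.flatPoint i (b, y) := by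
  change D.flatPoint i (stereoInv i (stereo i b), torusLift 0 (torusExp y)) = _
  rw [stereoInv_stereo]
  exact flatPoint_torusLift hb (torusExp_torusLift 0 _)

end MonodromyDatum

/-! ### The nodal fibres -/

lemma surjective_mfderiv_of_local_section {M : Type*} [TopologicalSpace M] [ChartedSpace (ℂ × ℂ) M]
    {f : M → TwoSphere} {σ : TwoSphere → M} {b : TwoSphere}
    (hf : MDifferentiableAt 𝓘(ℝ, ℂ × ℂ) (𝓡 2) f (σ b))
    (hσ : MDifferentiableAt (𝓡 2) 𝓘(ℝ, ℂ × ℂ) σ b) (h : ∀ᶠ b' in 𝓝 b, f (σ b') = b') :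
    Function.Surjective (mfderiv 𝓘(ℝ, ℂ × ℂ) (𝓡 2) f (σ b)) := by
  intro v
  have h1 := mfderiv_comp b hf hσ
  have h2 : mfderiv (𝓡 2) (𝓡 2) (f ∘ σ) b = mfderiv (𝓡 2) (𝓡 2) id b :=
    Filter.EventuallyEq.mfderiv_eq h
  rw [mfderiv_id] at h2
  refine ⟨mfderiv (𝓡 2) 𝓘(ℝ, ℂ × ℂ) σ b v, ?_⟩
  exact congrArg (fun T : EuclideanSpace ℝ (Fin 2) →L[ℝ] EuclideanSpace ℝ (Fin 2) => T v)
    (h1.symm.trans h2)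

namespace MonodromyDatum

variable {K : Type} (D : MonodromyDatum K)

lemma stereo_dir (k : K) : stereo false (D.dir k) = stereo false (D.basePoint false k 0) := by
  rw [basePoint_zero]; rfl

lemma tateLabel_axis_fst (k : K) (z : ℂ) : D.tateLabel k (z, 0) = (stereo false (D.dir k), 1, z) := by
  simp [tateLabel]

lemma tateLabel_axis_snd (k : K) (w : ℂ) :
    D.tateLabel k (0, w) = (stereo false (D.dir k), 1, w⁻¹) := by
  simp [tateLabel]

/-- The loop in the direction of a vanishing cycle, in the coordinates of the torus. -/
noncomputable def cycleLoop (k : K) (θ : Circle) : TwoTorus := (θ ^ (D.cycle k).2, θ ^ (D.cycle k).1)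

lemma torusExp_arg (k : K) (θ : Circle) :
    torusExp ((Complex.arg θ / (2 * Real.pi) : ℝ) * gaussian (D.cycle k)) = D.cycleLoop k θ := by
  have hpi : Real.pi ≠ 0 := Real.pi_ne_zero
  have h : ∀ n : ℤ, Circle.exp (2 * Real.pi * (Complex.arg θ / (2 * Real.pi) * n)) = θ ^ n := by
    intro n
    have : 2 * Real.pi * (Complex.arg θ / (2 * Real.pi) * n) = n * Complex.arg θ := by field_simp
    rw [this, Circle.exp_intCast_mul, Circle.exp_arg]
  simp only [torusExp, cycleLoop, Complex.re_ofReal_mul, Complex.im_ofReal_mul, gaussian_re,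
    gaussian_im, h]

lemma mul_dir_mem_flatDom (k : K) {t : ℝ} (h0 : 0 ≤ t) (h1 : t < 1) :
    ((t : ℂ) * D.dir k, 0) ∈ D.flatDom false := by
  intro l
  left
  have hn : ‖(t : ℂ) * D.dir k * starRingEnd ℂ (D.flatDir false l)‖ < 1 := by
    rw [norm_mul, RCLike.norm_conj, norm_flatDir, mul_one, norm_mul, D.norm_dir, mul_one,
      Complex.norm_real, Real.norm_of_nonneg h0]
    exact h1
  have := (Complex.re_le_norm _).trans_lt hn
  simpa using this

variable [Finite K]

/-- The node over the singular value `k`. -/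
noncomputable def node (k : K) : D.Total := D.nodalPoint k (0, 0)

lemma zero_mem_nodalDom : ((0, 0) : ℂ × ℂ) ∈ nodalDom := by simp [nodalDom]

lemma proj_node (k : K) : D.proj (D.node k) = stereo false (D.dir k) := by
  rw [node, proj_nodalPoint zero_mem_nodalDom, stereo_dir]
  simp

lemma isNode (k : K) : IsNode D.proj (D.node k) (D.sign k) := by
  have h0 : ((0, 0) : ℂ × ℂ) ∈ D.gluing.dom (Sum.inr k) := zero_mem_nodalDom
  obtain ⟨V, haV, hV, hVi, hinj, he⟩ := LabelledGluing.exists_chart h0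
  have hnode : D.node k = D.gluing.point (Sum.inr k) (0, 0) := by
    simp [node, nodalPoint, tateCoord, signConj_zero]
  have hpt : ∀ a : ℂ × ℂ, a ∈ V → D.proj (D.gluing.point (Sum.inr k) a) =
      stereo false (D.basePoint false k (a.1 * signConj (D.sign k) a.2)) ∧
        ‖a.1 * signConj (D.sign k) a.2‖ < 1 / 8 := by
    intro a ha
    have hm := D.tateCoord_mem (k := k) (hVi ha)
    have h := proj_nodalPoint (D := D) (k := k) hm
    rw [nodalPoint, tateCoord_tateCoord] at h
    exact ⟨h, hm.2.2⟩
  refine ⟨_, D.nodeCoord k, LabelledGluing.isPositiveChart he, D.isSphereCoordinate_nodeCoord k,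
    ?_, ?_, ?_, ?_, ?_⟩
  · rw [hnode]
    exact ⟨_, haV, rfl⟩
  · rw [hnode, LabelledGluing.chart_point hV hVi hinj haV]
    rfl
  · rw [proj_node, stereo_dir, D.nodeCoord_apply (by simp)]
  · rintro _ ⟨a, ha, rfl⟩
    exact D.mem_nodeCoord_source_iff.2 ⟨_, (hpt a ha).2, (hpt a ha).1⟩
  · refine (D.sign_eq k).imp (fun hs => ⟨hs, ?_⟩) fun hs => ⟨hs, ?_⟩
    · rintro _ ⟨a, ha, rfl⟩
      rw [LabelledGluing.chart_point hV hVi hinj ha, (hpt a ha).1, D.nodeCoord_apply (hpt a ha).2]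
      simp [signConj, hs]
    · rintro _ ⟨a, ha, rfl⟩
      rw [LabelledGluing.chart_point hV hVi hinj ha, (hpt a ha).1, D.nodeCoord_apply (hpt a ha).2]
      simp [signConj, hs]

variable {D}

lemma exists_eq_nodalPoint_of_proj_eq {k : K} {x : D.Total} (hx : D.proj x = D.proj (D.node k)) :
    ∃ z w, ‖z‖ ≤ 1 ∧ ‖w‖ ≤ 1 ∧ z * w = 0 ∧ (z, w) ∈ nodalDom ∧ x = D.nodalPoint k (z, w) := by
  obtain ⟨z, w, hz, hw, hzw, rfl⟩ := exists_eq_nodalPoint (k := k) (q := 0) (by simp)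
    (by rw [hx, proj_node, stereo_dir])
  exact ⟨z, w, hz, hw, hzw, ⟨hz.trans_lt (by norm_num), hw.trans_lt (by norm_num), by simp [hzw]⟩,
    rfl⟩

/-- A smooth section of the product map `z w` defines a smooth section of the projection. -/
lemma surjective_mfderiv_of_section {k : K} {s : ℂ → ℂ × ℂ} (hs : ContDiffAt ℝ ∞ s 0)
    (h0 : s 0 ∈ nodalDom) (hprod : ∀ q, (s q).1 * (s q).2 = q) :
    Function.Surjective (mfderiv 𝓘(ℝ, ℂ × ℂ) (𝓡 2) D.proj (D.nodalPoint k (s 0))) := by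
  have hval : D.nodeCoord k (stereo false (D.dir k)) = 0 := by
    rw [stereo_dir, D.nodeCoord_apply (by simp)]
  have hsrc : stereo false (D.dir k) ∈ (D.nodeCoord k).source :=
    D.mem_nodeCoord_source_iff.2 ⟨0, by simp, D.stereo_dir k⟩
  have hc : ContMDiffAt (𝓡 2) 𝓘(ℝ, ℂ) ∞ (D.nodeCoord k) (stereo false (D.dir k)) :=
    (D.isSphereCoordinate_nodeCoord k).1.contMDiffAt ((D.nodeCoord k).open_source.mem_nhds hsrc)
  have h1 : ContMDiffAt (𝓡 2) 𝓘(ℝ, ℂ × ℂ) ∞ (fun b => s (D.nodeCoord k b))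
      (stereo false (D.dir k)) :=
    ContMDiffAt.comp (stereo false (D.dir k)) (g := s) (f := D.nodeCoord k)
      (by rw [hval]; exact hs.contMDiffAt) hc
  have h2 : ContMDiffAt (𝓡 2) 𝓘(ℝ, ℂ × ℂ) ∞ (fun b => D.nodalPoint k (s (D.nodeCoord k b)))
      (stereo false (D.dir k)) :=
    ContMDiffAt.comp (stereo false (D.dir k)) (g := D.nodalPoint k)
      (f := fun b => s (D.nodeCoord k b)) (contMDiffAt_nodalPoint (by rw [hval]; exact h0)) h1
  have h3 := surjective_mfderiv_of_local_section (f := D.proj)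
    (σ := fun b => D.nodalPoint k (s (D.nodeCoord k b)))
    (contMDiff_proj.contMDiffAt.mdifferentiableAt (by simp)) (h2.mdifferentiableAt (by simp)) ?_
  · have e : D.nodalPoint k (s (D.nodeCoord k (stereo false (D.dir k)))) = D.nodalPoint k (s 0) := by
      rw [hval]
    exact e ▸ h3
  · have hmem : ∀ᶠ b in 𝓝 (stereo false (D.dir k)), s (D.nodeCoord k b) ∈ nodalDom :=
      h1.continuousAt.eventually_mem (isOpen_nodalDom.mem_nhds (by rw [hval]; exact h0))
    filter_upwards [hmem, (D.nodeCoord k).open_source.mem_nhds hsrc] with b hb hb'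
    rw [proj_nodalPoint hb, hprod]
    exact (D.nodeCoord k).left_inv hb'

/-- Along each branch of the nodal fibre, one of the coordinates `z`, `w` is invertible, and then the
other one is a function of `q`. -/
lemma submersion_off_node {k : K} {x : D.Total} (hx : D.proj x = D.proj (D.node k))
    (hne : x ≠ D.node k) :
    Function.Surjective (mfderiv 𝓘(ℝ, ℂ × ℂ) (𝓡 2) D.proj x) := by
  obtain ⟨z, w, -, -, hzw, hm, rfl⟩ := exists_eq_nodalPoint_of_proj_eq hx
  by_cases hz : z = 0
  · subst hz
    have hw : w ≠ 0 := by
      rintro rfl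
      exact hne rfl
    have h := surjective_mfderiv_of_section (D := D) (k := k) (s := fun q => (q / w, w))
      ((contDiffAt_id.div_const w).prodMk contDiffAt_const) (by simpa using hm)
      fun q => div_mul_cancel₀ q hw
    have e : D.nodalPoint k (0 / w, w) = D.nodalPoint k (0, w) := by rw [zero_div]
    exact e ▸ h
  · have hw : w = 0 := (mul_eq_zero.1 hzw).resolve_left hz
    subst hw
    have h := surjective_mfderiv_of_section (D := D) (k := k) (s := fun q => (z, q / z))
      (contDiffAt_const.prodMk (contDiffAt_id.div_const z)) (by simpa using hm)
      fun q => mul_div_cancel₀ q hz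
    have e : D.nodalPoint k (z, 0 / z) = D.nodalPoint k (z, 0) := by rw [zero_div]
    exact e ▸ h

variable (D)

lemma axis_fst_mem {z : ℂ} (hz : ‖z‖ < 2) : (z, (0 : ℂ)) ∈ nodalDom := ⟨hz, by simp, by simp⟩

lemma axis_snd_mem {w : ℂ} (hw : ‖w‖ < 2) : ((0 : ℂ), w) ∈ nodalDom := ⟨by simp, hw, by simp⟩

lemma stereoInv_false_stereo_true (w : ℂ) : stereoInv false (stereo true w) = w⁻¹ := by
  by_cases hw : w = 0
  · subst hw
    apply Complex.ext <;> simp [stereoInv, stereo_zero, stereo_one]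
  · rw [← stereo_not hw true]
    exact stereoInv_stereo false _

lemma exists_stereo_norm_lt (p : TwoSphere) :
    (∃ z, ‖z‖ < 2 ∧ p = stereo false z) ∨ ∃ w, ‖w‖ < 2 ∧ p = stereo true w := by
  rcases exists_eq_stereo p with ⟨z, rfl⟩ | rfl
  · by_cases hz : ‖z‖ < 2
    · exact Or.inl ⟨z, hz, rfl⟩
    · have hz0 : z ≠ 0 := by rintro rfl; simp at hz
      refine Or.inr ⟨z⁻¹, ?_, (stereo_not hz0 false).symm⟩
      rw [norm_inv]
      exact (inv_le_one_of_one_le₀ (by linarith)).trans_lt (by norm_num)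
  · exact Or.inr ⟨0, by simp, rfl⟩

/-- The parametrization of a nodal fibre by the two-sphere.  The first axis of the nodal piece
corresponds to the stereographic coordinate `z`, and the second one to its inverse; both poles are
mapped to the node, since the coordinate `stereoInv false` has the junk value `0` at its centre. -/
noncomputable def nodalSphere (k : K) (p : TwoSphere) : D.Total where
  val := (stereo false (D.dir k), 1, stereoInv false p)
  exists_label_eq := by
    rcases exists_stereo_norm_lt p with ⟨z, hz, rfl⟩ | ⟨w, hw, rfl⟩
    · refine ⟨Sum.inr k, D.tateCoord k (z, 0), D.tateCoord_mem (axis_fst_mem hz), ?_⟩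
      change D.tateLabel k (D.tateCoord k (D.tateCoord k (z, 0))) = _
      rw [tateCoord_tateCoord, tateLabel_axis_fst, stereoInv_stereo]
    · refine ⟨Sum.inr k, D.tateCoord k (0, w), D.tateCoord_mem (axis_snd_mem hw), ?_⟩
      change D.tateLabel k (D.tateCoord k (D.tateCoord k (0, w))) = _
      rw [tateCoord_tateCoord, tateLabel_axis_snd, stereoInv_false_stereo_true]

lemma nodalSphere_stereo_false (k : K) {z : ℂ} (hz : ‖z‖ < 2) :
    D.nodalSphere k (stereo false z) = D.nodalPoint k (z, 0) := by
  apply LabelledGluing.Space.ext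
  rw [val_nodalPoint (axis_fst_mem hz), tateLabel_axis_fst]
  simp [nodalSphere, stereoInv_stereo]

lemma nodalSphere_stereo_true (k : K) {w : ℂ} (hw : ‖w‖ < 2) :
    D.nodalSphere k (stereo true w) = D.nodalPoint k (0, w) := by
  apply LabelledGluing.Space.ext
  rw [val_nodalPoint (axis_snd_mem hw), tateLabel_axis_snd]
  simp [nodalSphere, stereoInv_false_stereo_true]

lemma continuousAt_stereo_of_comp {N : Type*} [TopologicalSpace N] {i : Bool} {h : TwoSphere → N}
    {g : ℂ → N} {b : ℂ} (hg : ContinuousAt g b) (hh : ∀ᶠ z in 𝓝 b, h (stereo i z) = g z) :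
    ContinuousAt h (stereo i b) := by
  obtain ⟨U, hU, hUo, hbU⟩ := mem_nhds_iff.1 hh
  have h1 : ContinuousAt (fun p => g (stereoInv i p)) (stereo i b) :=
    ContinuousAt.comp (g := g) (f := stereoInv i) (by rwa [stereoInv_stereo])
      (contMDiffAt_stereoInv_stereo i b).continuousAt
  refine h1.congr ?_
  filter_upwards [(isOpen_image_stereo i hUo).mem_nhds ⟨b, hbU, rfl⟩]
  rintro _ ⟨z, hz, rfl⟩
  rw [stereoInv_stereo]
  exact (hU hz).symm

lemma continuous_nodalSphere (k : K) : Continuous (D.nodalSphere k) := by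
  rw [continuous_iff_continuousAt]
  have hopen : ∀ z : ℂ, ‖z‖ < 2 → ∀ᶠ y in 𝓝 z, ‖y‖ < 2 := fun z hz =>
    continuous_norm.continuousAt.eventually_lt continuousAt_const hz
  have hcont : ∀ a : ℂ × ℂ, a ∈ nodalDom → ContinuousAt (D.nodalPoint k) a := fun a ha =>
    (contMDiffAt_nodalPoint ha).continuousAt
  intro p
  rcases exists_stereo_norm_lt p with ⟨z, hz, rfl⟩ | ⟨w, hw, rfl⟩
  · refine continuousAt_stereo_of_comp (g := fun z => D.nodalPoint k (z, 0)) ?_ ?_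
    · exact ContinuousAt.comp (g := D.nodalPoint k) (f := fun z : ℂ => (z, (0 : ℂ)))
        (hcont _ (axis_fst_mem hz)) (by fun_prop)
    · filter_upwards [hopen z hz] with y hy
      exact D.nodalSphere_stereo_false k hy
  · refine continuousAt_stereo_of_comp (g := fun w => D.nodalPoint k (0, w)) ?_ ?_
    · exact ContinuousAt.comp (g := D.nodalPoint k) (f := fun w : ℂ => ((0 : ℂ), w))
        (hcont _ (axis_snd_mem hw)) (by fun_prop)
    · filter_upwards [hopen w hw] with y hy
      exact D.nodalSphere_stereo_true k hy

lemma isSimpleNodalFiber (k : K) : IsSimpleNodalFiber D.proj (D.node k) (D.sign k) where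
  node := D.isNode k
  submersion _ hx hne := submersion_off_node hx hne
  nodal_sphere := by
    refine ⟨D.nodalSphere k, stereo false 0, stereo true 0, D.continuous_nodalSphere k, ?_,
      (stereo_true_zero_ne 0).symm, D.nodalSphere_stereo_false k (by simp),
      D.nodalSphere_stereo_true k (by simp), ?_⟩
    · ext x
      rw [Set.mem_preimage, Set.mem_singleton_iff]
      constructor
      · rintro ⟨p, rfl⟩
        rw [proj_node]
        rfl
      · intro hx
        obtain ⟨z, w, hz, hw, hzw, -, rfl⟩ := exists_eq_nodalPoint_of_proj_eq hx
        rcases mul_eq_zero.1 hzw with rfl | rfl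
        · exact ⟨stereo true w, D.nodalSphere_stereo_true k (by linarith)⟩
        · exact ⟨stereo false z, D.nodalSphere_stereo_false k (by linarith)⟩
    · intro x y hxy
      have h : stereoInv false x = stereoInv false y := by
        have := congrArg (fun s : D.Total => s.val.2.2) hxy
        exact this
      rcases exists_eq_stereo x with ⟨z, rfl⟩ | rfl <;> rcases exists_eq_stereo y with ⟨z', rfl⟩ | rfl
      · rw [stereoInv_stereo, stereoInv_stereo] at h
        exact Or.inl (by rw [h])
      · rw [stereoInv_stereo, stereoInv_false_stereo_true, inv_zero] at h
        exact Or.inr (Or.inl ⟨by rw [h], rfl⟩)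
      · rw [stereoInv_stereo, stereoInv_false_stereo_true, inv_zero] at h
        exact Or.inr (Or.inr ⟨rfl, by rw [← h]⟩)
      · exact Or.inl rfl

lemma injective_proj_node : Function.Injective fun k => D.proj (D.node k) := by
  intro k l h
  simp only [proj_node, stereo_dir] at h
  exact (basePoint_eq (by simp) (by simp) (stereo_injective _ h)).1

lemma isNodalTorusFibration : IsNodalTorusFibration D.proj (Set.range D.node) where
  smooth := contMDiff_proj
  finite := Set.finite_range _
  nodal := by
    rintro _ ⟨k, rfl⟩
    have h := D.isSimpleNodalFiber k
    rcases D.sign_eq k with hs | hs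
    · exact Or.inl (hs ▸ h)
    · exact Or.inr (hs ▸ h)
  bundle b hb := by
    rcases D.singular_or_flat b with ⟨k, rfl⟩ | ⟨i, b', rfl, hb'⟩
    · exact absurd ⟨D.node k, ⟨k, rfl⟩, D.proj_node k⟩ hb
    · exact ⟨D.flatBase i, D.trivialization i, ⟨b', hb', rfl⟩, D.isTorusTrivialization i⟩

/-! ### The collapse of the vanishing cycles -/

open Classical in
/-- The disc swept out by the vanishing cycle on its way to the node.  While the cycle moves along the
ray to the singular value, it is translated transversally so that it passes through the neck
`|z| = |w|` of the fibres near the node. -/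
noncomputable def collapse (k : K) (x : unitInterval × Circle) : D.Total :=
  if (x.1 : ℝ) = 1 then D.node k
  else D.trivialization false (stereo false ((x.1 : ℝ) * D.dir k),
    D.cycleLoop k x.2 * torusExp (((x.1 : ℝ) / 2 : ℝ) * gaussian (D.cocycle k)))

/-- Near the end of the ray, the collapsing cycle is `|z| = q ^ (t / 2)`, `|w| = q ^ (1 - t / 2)`. -/
lemma collapse_eq_nodalPoint (k : K) {t : unitInterval} (θ : Circle) (ht : 0 < (t : ℝ))
    (hq : ‖-(Real.log t / D.scale)‖ < 1 / 8) :
    D.collapse k (t, θ) = D.nodalPoint k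
      (θ * ((-(Real.log t / D.scale)) ^ ((t : ℝ) / 2) : ℝ),
        (θ : ℂ)⁻¹ * ((-(Real.log t / D.scale)) ^ (1 - (t : ℝ) / 2) : ℝ)) := by
  have hpi : (Real.pi : ℂ) ≠ 0 := by exact_mod_cast Real.pi_ne_zero
  rw [collapse]
  split_ifs with h1
  · simp only at h1
    norm_num [h1, node, Real.zero_rpow]
  · simp only at h1 ⊢
    have ht1 : (t : ℝ) < 1 := lt_of_le_of_ne t.2.2 h1
    set q : ℝ := -(Real.log t / D.scale) with hqdef
    have hq0 : 0 < q := by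
      rw [hqdef, neg_pos]
      exact div_neg_of_neg_of_pos (Real.log_neg ht ht1) D.scale_pos
    have hq' : ‖(q : ℂ)‖ < 1 / 8 := by rwa [Complex.norm_real]
    have hlog : Complex.log (q : ℂ) = (Real.log q : ℝ) := (Complex.ofReal_log hq0.le).symm
    have hb : (t : ℂ) * D.dir k = D.basePoint false k q := by
      rw [basePoint_false, mul_comm]
      congr 1
      have : -((D.scale : ℂ) * q) = ((Real.log t : ℝ) : ℂ) := by
        rw [hqdef]
        have := D.scale_pos.ne'
        have h2 : -(D.scale * -(Real.log t / D.scale)) = Real.log t := by field_simp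
        exact_mod_cast h2
      rw [this, ← Complex.ofReal_exp, Real.exp_log ht]
    set α : ℝ := Complex.arg θ / (2 * Real.pi) with hα
    have htor : D.cycleLoop k θ * torusExp (((t : ℝ) / 2 : ℝ) * gaussian (D.cocycle k)) =
        torusExp (D.adapted k α ((t : ℝ) / 2)) := by
      rw [adapted, torusExp_add, ← torusExp_arg]
    have hdom := D.mul_dir_mem_flatDom k t.2.1 ht1
    rw [htor, D.trivialization_apply hdom]
    set ξ : ℂ := 2 * Real.pi * α * Complex.I + ((t : ℝ) / 2 : ℝ) * Complex.log q with hξ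
    have hθ : Complex.exp (2 * Real.pi * α * Complex.I) = θ := by
      have h2 : 2 * (Real.pi : ℂ) * α * Complex.I = Complex.arg θ * Complex.I := by
        rw [hα]
        push_cast
        field_simp
      rw [h2, ← Circle.coe_exp, Circle.exp_arg]
    have hz : Complex.exp ξ = θ * (q ^ ((t : ℝ) / 2) : ℝ) := by
      rw [hξ, Complex.exp_add, hθ, hlog, Real.rpow_def_of_pos hq0]
      push_cast
      congr 2
      ring
    have hqc : (q : ℂ) ≠ 0 := by exact_mod_cast hq0.ne'
    have hw : Complex.exp (Complex.log q - ξ) =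
        (θ : ℂ)⁻¹ * (q ^ (1 - (t : ℝ) / 2) : ℝ) := by
      have h3 : Complex.log q - ξ = -(2 * Real.pi * α * Complex.I) +
          ((Real.log q * (1 - (t : ℝ) / 2) : ℝ) : ℂ) := by
        rw [hξ, hlog]
        push_cast
        ring
      rw [h3, Complex.exp_add, Complex.exp_neg, hθ, Real.rpow_def_of_pos hq0, Complex.ofReal_exp]
    have hre : (Complex.log (q : ℂ)).re < 0 := by
      rw [hlog, Complex.ofReal_re]
      rw [Real.norm_of_nonneg hq0.le] at hq
      exact Real.log_neg hq0 (by linarith)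
    have hq1 : q ≤ 1 := by
      rw [Real.norm_of_nonneg hq0.le] at hq
      linarith
    have hmem : (Complex.exp ξ, Complex.exp (Complex.log q - ξ)) ∈ nodalDom := by
      have ht0 : 0 ≤ (t : ℝ) := t.2.1
      refine ⟨?_, ?_, ?_⟩
      · simp only [hz]
        rw [norm_mul, Circle.norm_coe, one_mul, Complex.norm_real,
          Real.norm_of_nonneg (Real.rpow_nonneg hq0.le _)]
        exact (Real.rpow_le_one hq0.le hq1 (by linarith)).trans_lt (by norm_num)
      · simp only [hw]
        rw [norm_mul, norm_inv, Circle.norm_coe, inv_one, one_mul, Complex.norm_real,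
          Real.norm_of_nonneg (Real.rpow_nonneg hq0.le _)]
        exact (Real.rpow_le_one hq0.le hq1 (by linarith)).trans_lt (by norm_num)
      · simp only
        rw [← Complex.exp_add, add_sub_cancel, Complex.exp_log hqc]
        exact hq'
    rw [← hz, ← hw]
    apply LabelledGluing.Space.ext
    rw [val_nodalPoint hmem, val_flatPoint (x := ((t : ℂ) * D.dir k, D.adapted k α ((t : ℝ) / 2))) hdom,
      D.tateLabel_exp k (n := 0) hre (by rw [Complex.exp_log hqc]; simp) hξ, Complex.exp_log hqc,
      flatLabel, latticeMap_flatFrame_false]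
    simp [hb]

lemma continuous_collapse (k : K) : Continuous (D.collapse k) := by
  rw [continuous_iff_continuousAt]
  rintro ⟨t, θ⟩
  have hval : Continuous fun x : unitInterval × Circle => (x.1 : ℝ) :=
    continuous_subtype_val.comp continuous_fst
  by_cases h1 : (t : ℝ) = 1
  · -- near the node, the disc is described in the nodal piece
    have hq : ContinuousAt (fun x : unitInterval × Circle => -(Real.log x.1 / D.scale)) (t, θ) :=
      ((hval.continuousAt.log (by simp [h1])).div_const _).neg
    have hθ : Continuous fun x : unitInterval × Circle => (x.2 : ℂ) :=
      continuous_subtype_val.comp continuous_snd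
    have hpow : ∀ s : unitInterval × Circle → ℝ, Continuous s → 0 < s (t, θ) →
        ContinuousAt (fun x : unitInterval × Circle =>
          (((-(Real.log x.1 / D.scale)) ^ (s x) : ℝ) : ℂ)) (t, θ) := fun s hs hs0 =>
      Complex.continuous_ofReal.continuousAt.comp
        (hq.rpow hs.continuousAt (Or.inr hs0))
    have hz := (hθ.continuousAt (x := (t, θ))).mul (hpow (fun x => (x.1 : ℝ) / 2) (hval.div_const 2)
      (by simp [h1]))
    have hw := ((hθ.continuousAt (x := (t, θ))).inv₀ (by simp)).mul
      (hpow (fun x => 1 - (x.1 : ℝ) / 2) (continuous_const.sub (hval.div_const 2))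
        (by norm_num [h1]))
    have hpt : ContinuousAt (D.nodalPoint k)
        ((θ : ℂ) * ((-(Real.log t / D.scale)) ^ ((t : ℝ) / 2) : ℝ),
          (θ : ℂ)⁻¹ * ((-(Real.log t / D.scale)) ^ (1 - (t : ℝ) / 2) : ℝ)) := by
      refine (contMDiffAt_nodalPoint ?_).continuousAt
      norm_num [h1, Real.zero_rpow, nodalDom]
    have hcomp := ContinuousAt.comp (x := (t, θ)) (g := D.nodalPoint k) hpt (hz.prodMk hw)
    refine hcomp.congr ?_
    have hev : ∀ᶠ x : unitInterval × Circle in 𝓝 (t, θ), ‖-(Real.log x.1 / D.scale)‖ < 1 / 8 :=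
      hq.norm.eventually_lt continuousAt_const (by norm_num [h1])
    have hev' : ∀ᶠ x : unitInterval × Circle in 𝓝 (t, θ), 0 < (x.1 : ℝ) :=
      continuousAt_const.eventually_lt hval.continuousAt (by norm_num [h1])
    filter_upwards [hev, hev'] with x hx hx'
    exact (D.collapse_eq_nodalPoint k x.2 hx' hx).symm
  · have ht1 : (t : ℝ) < 1 := lt_of_le_of_ne t.2.2 h1
    have hloop : Continuous fun x : unitInterval × Circle => D.cycleLoop k x.2 :=
      (continuous_snd.zpow _).prodMk (continuous_snd.zpow _)
    have harg : Continuous fun x : unitInterval × Circle =>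
        (stereo false ((x.1 : ℝ) * D.dir k),
          D.cycleLoop k x.2 * torusExp (((x.1 : ℝ) / 2 : ℝ) * gaussian (D.cocycle k))) := by
      refine ((continuous_stereo false).comp ?_).prodMk (hloop.mul (continuous_torusExp.comp ?_))
      · exact (Complex.continuous_ofReal.comp hval).mul continuous_const
      · exact (Complex.continuous_ofReal.comp (hval.div_const 2)).mul continuous_const
    have hsrc : (stereo false ((t : ℝ) * D.dir k),
        D.cycleLoop k θ * torusExp (((t : ℝ) / 2 : ℝ) * gaussian (D.cocycle k))) ∈
          (D.trivialization false).source :=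
      ⟨⟨_, D.mul_dir_mem_flatDom k t.2.1 ht1, rfl⟩, trivial⟩
    have hcomp := ContinuousAt.comp (x := (t, θ)) (g := D.trivialization false)
      ((D.trivialization false).continuousAt hsrc) harg.continuousAt
    refine hcomp.congr ?_
    filter_upwards [hval.continuousAt.eventually_ne (x := (t, θ)) h1] with x hx
    rw [collapse, if_neg hx]
    rfl

lemma collapsesAlong (k : K) : CollapsesAlong D.proj (fun t => stereo false ((t : ℝ) * D.dir k))
    (fun θ => D.trivialization false (stereo false 0, D.cycleLoop k θ)) (D.node k) := by
  refine ⟨D.collapse k, D.continuous_collapse k, fun t θ => ?_, fun θ => ?_, fun θ => ?_⟩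
  · rw [collapse]
    split_ifs with h1
    · simp only at h1 ⊢
      rw [proj_node, h1]
      simp
    · have ht1 : (t : ℝ) < 1 := lt_of_le_of_ne t.2.2 h1
      exact (D.isTorusTrivialization false).over_base _
        ⟨_, D.mul_dir_mem_flatDom k t.2.1 ht1, rfl⟩ _
  · have : torusExp 0 = 1 := (torusExp_eq_one_iff 0).2 ⟨(0, 0), by simp [gaussian]⟩
    simp [collapse, this]
  · simp [collapse]

end MonodromyDatum

/-! ### Monodromy data from angles -/

/-- The argument of a complex number in full turns, normalized to lie in `(0, 1]`. -/
noncomputable def turn (b : ℂ) : ℝ := 1 / 2 + Complex.arg (-b) / (2 * Real.pi)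

lemma turn_pos (b : ℂ) : 0 < turn b := by
  have h : 0 < (Real.pi + Complex.arg (-b)) / (2 * Real.pi) :=
    div_pos (by linarith [Complex.neg_pi_lt_arg (-b)]) Real.two_pi_pos
  have : (Real.pi + Complex.arg (-b)) / (2 * Real.pi) = turn b := by
    rw [turn]
    field_simp
  rwa [this] at h

lemma turn_le_one (b : ℂ) : turn b ≤ 1 := by
  have h : Complex.arg (-b) / (2 * Real.pi) ≤ 1 / 2 := by
    rw [div_le_iff₀ Real.two_pi_pos]
    linarith [Complex.arg_le_pi (-b)]
  rw [turn]
  linarith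

lemma norm_mul_exp_turn (b : ℂ) :
    (‖b‖ : ℂ) * Complex.exp (2 * Real.pi * turn b * Complex.I) = b := by
  have h : (2 * Real.pi * turn b * Complex.I : ℂ) =
      Complex.arg (-b) * Complex.I + Real.pi * Complex.I := by
    have : (Real.pi : ℂ) ≠ 0 := by exact_mod_cast Real.pi_ne_zero
    rw [turn]
    push_cast
    field_simp
    ring
  rw [h, Complex.exp_add, Complex.exp_pi_mul_I, ← mul_assoc, ← norm_neg,
    Complex.norm_mul_exp_arg_mul_I]
  ring

/-- Polar coordinates with an angle in `(0, 1]` are unique. -/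
lemma turn_mul_exp {r t : ℝ} (hr : 0 < r) (h0 : 0 < t) (h1 : t ≤ 1) :
    turn (r * Complex.exp (2 * Real.pi * t * Complex.I)) = t := by
  have hpi := Real.pi_pos
  have h : -((r : ℂ) * Complex.exp (2 * Real.pi * t * Complex.I)) =
      r * Complex.exp ((2 * Real.pi * t - Real.pi : ℝ) * Complex.I) := by
    push_cast
    rw [sub_mul, Complex.exp_sub, Complex.exp_pi_mul_I]
    ring
  rw [turn, h, Complex.exp_mul_I, ← Complex.ofReal_cos, ← Complex.ofReal_sin,
    Complex.ofReal_cos, Complex.ofReal_sin, Complex.arg_mul_cos_add_sin_mul_I hr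
      ⟨by linarith [mul_pos Real.two_pi_pos h0], by nlinarith⟩]
  field_simp
  ring

lemma turn_eq_or (b : ℂ) (hb : b ≠ 0) : turn b = Complex.arg b / (2 * Real.pi) ∨
    turn b = 1 + Complex.arg b / (2 * Real.pi) := by
  have hpi := Real.pi_pos
  have hb' : 0 < ‖b‖ := norm_pos_iff.2 hb
  have hle := Complex.arg_le_pi b
  have hlt := Complex.neg_pi_lt_arg b
  have h := Complex.norm_mul_exp_arg_mul_I b
  rcases lt_or_ge 0 (Complex.arg b) with h0 | h0
  · left
    conv_lhs => rw [← h]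
    rw [← turn_mul_exp hb' (t := Complex.arg b / (2 * Real.pi)) (by positivity)
      (by rw [div_le_one (by positivity)]; linarith)]
    congr 3
    push_cast
    field_simp
  · right
    have h2 : -(1 / 2) < Complex.arg b / (2 * Real.pi) := by
      rw [lt_div_iff₀ (by positivity)]
      linarith
    have h3 : Complex.arg b / (2 * Real.pi) ≤ 0 :=
      div_nonpos_of_nonpos_of_nonneg h0 (by positivity)
    conv_lhs => rw [← h]
    rw [← turn_mul_exp hb' (t := 1 + Complex.arg b / (2 * Real.pi)) (by linarith) (by linarith)]
    have h4 : (2 * Real.pi * (1 + Complex.arg b / (2 * Real.pi) : ℝ) * Complex.I : ℂ) =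
        2 * Real.pi * Complex.I + Complex.arg b * Complex.I := by
      have : (Real.pi : ℂ) ≠ 0 := by exact_mod_cast Real.pi_ne_zero
      push_cast
      field_simp
    rw [h4, Complex.exp_add, Complex.exp_two_pi_mul_I, one_mul]

lemma continuousAt_turn {b : ℂ} (hb : -b ∈ Complex.slitPlane) : ContinuousAt turn b :=
  continuousAt_const.add
    ((ContinuousAt.comp (g := Complex.arg) (Complex.continuousAt_arg hb)
      continuous_neg.continuousAt).div_const _)

/-- Rays at given angles, with signs and cycles, together with a family of lattice frames that jumps at
these angles only, and there by the Picard–Lefschetz transvections.  The frame at the angle `t` may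
only depend on the set of rays that precede `t`. -/
structure AngularDatum (K : Type) where
  /-- The angles of the rays, in turns. -/
  angle : K → ℝ
  angle_pos : ∀ k, 0 < angle k
  angle_lt_one : ∀ k, angle k < 1
  angle_injective : Function.Injective angle
  /-- The signs of the nodes. -/
  sign : K → ℤ
  sign_eq : ∀ k, sign k = 1 ∨ sign k = -1
  /-- The vanishing cycles. -/
  cycle : K → ℤ × ℤ
  primitive : ∀ k, IsPrimitiveVector (cycle k)
  /-- The frame at an angle. -/
  frame : ℝ → (ℤ × ℤ) × (ℤ × ℤ)
  det_frame : ∀ t, 0 < t → t ≤ 1 → latticeDet (frame t).1 (frame t).2 = 1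
  frame_congr : ∀ t t', (∀ k, angle k < t ↔ angle k < t') → frame t = frame t'
  frame_zero : frame 0 = frame 1
  frame_jump : ∀ k t, (∀ l, angle l < t ↔ angle l ≤ angle k) →
    frame t = (picardLefschetz (sign k) (cycle k) (frame (angle k)).1,
      picardLefschetz (sign k) (cycle k) (frame (angle k)).2)

namespace AngularDatum

variable {K : Type} (A : AngularDatum K)

lemma exists_scale [Finite K] : ∃ δ : ℝ, 0 < δ ∧ δ ≤ 1 ∧
    (∀ k, δ ≤ A.angle k ∧ δ ≤ 1 - A.angle k) ∧
    ∀ k l, A.angle k < A.angle l → 2 * δ ≤ A.angle l - A.angle k := by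
  have hlt : ∀ c : ℝ, 0 < c → ∀ᶠ δ : ℝ in 𝓝[>] 0, δ ≤ c := fun c hc =>
    nhdsWithin_le_nhds (Iic_mem_nhds hc)
  have h1 : ∀ᶠ δ : ℝ in 𝓝[>] 0, ∀ k, δ ≤ A.angle k ∧ δ ≤ 1 - A.angle k :=
    Filter.eventually_all.2 fun k => (hlt _ (A.angle_pos k)).and
      (hlt _ (sub_pos.2 (A.angle_lt_one k)))
  have h2 : ∀ᶠ δ : ℝ in 𝓝[>] 0, ∀ k l, A.angle k < A.angle l → 2 * δ ≤ A.angle l - A.angle k := by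
    refine Filter.eventually_all.2 fun k => Filter.eventually_all.2 fun l => ?_
    by_cases h : A.angle k < A.angle l
    · filter_upwards [hlt ((A.angle l - A.angle k) / 2) (by linarith)] with δ hδ _
      linarith
    · exact Filter.Eventually.of_forall fun _ h' => absurd h' h
  obtain ⟨δ, h⟩ := ((hlt 1 one_pos).and (h1.and (h2.and self_mem_nhdsWithin))).exists
  exact ⟨δ, h.2.2.2, h.1, h.2.1, h.2.2.1⟩

/-- The unit vector on the ray `k`. -/
noncomputable def dir (k : K) : ℂ := Complex.exp (2 * Real.pi * A.angle k * Complex.I)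

lemma norm_dir (k : K) : ‖A.dir k‖ = 1 := by
  have : (2 * Real.pi * A.angle k * Complex.I : ℂ) =
      (2 * Real.pi * A.angle k : ℝ) * Complex.I := by push_cast; ring
  rw [dir, this, Complex.norm_exp_ofReal_mul_I]

/-- A width of disjoint angular neighbourhoods of the rays. -/
noncomputable def scale [Finite K] : ℝ := A.exists_scale.choose

lemma scale_pos [Finite K] : 0 < A.scale := A.exists_scale.choose_spec.1

lemma scale_le [Finite K] : A.scale ≤ 1 := A.exists_scale.choose_spec.2.1

lemma scale_le_angle [Finite K] (k : K) : A.scale ≤ A.angle k ∧ A.scale ≤ 1 - A.angle k :=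
  A.exists_scale.choose_spec.2.2.1 k

lemma two_mul_scale_le [Finite K] {k l : K} (h : A.angle k < A.angle l) :
    2 * A.scale ≤ A.angle l - A.angle k :=
  A.exists_scale.choose_spec.2.2.2 k l h

lemma abs_offset_lt [Finite K] {q : ℂ} (hq : ‖q‖ < 1 / 8) :
    |A.scale * q.im / (2 * Real.pi)| < A.scale := by
  have h1 : |q.im| < 1 / 8 := (Complex.abs_im_le_norm q).trans_lt hq
  have h2 := A.scale_pos
  rw [abs_div, abs_mul, abs_of_pos h2, abs_of_pos Real.two_pi_pos, div_lt_iff₀ Real.two_pi_pos]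
  exact mul_lt_mul_of_pos_left (by linarith [Real.pi_gt_three]) h2

lemma turn_dir_mul_exp [Finite K] (k : K) {q : ℂ} (hq : ‖q‖ < 1 / 8) :
    turn (A.dir k * Complex.exp (-(A.scale * q))) =
      A.angle k - A.scale * q.im / (2 * Real.pi) := by
  have h := abs_lt.1 (A.abs_offset_lt hq)
  have h2 := A.scale_le_angle k
  rw [← turn_mul_exp (Real.exp_pos (-(A.scale * q.re)))
    (t := A.angle k - A.scale * q.im / (2 * Real.pi)) (by linarith) (by linarith)]
  have : (Real.pi : ℂ) ≠ 0 := by exact_mod_cast Real.pi_ne_zero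
  rw [dir, ← Complex.exp_add, Complex.ofReal_exp, ← Complex.exp_add]
  congr 2
  conv_lhs => rw [← Complex.re_add_im q]
  push_cast
  field_simp
  ring

/-- The frame is locally constant off the rays.  This includes the positive real axis, where the frames
at the beginning and at the end of a full turn agree. -/
lemma frame_turn_eventually [Finite K] {b : ℂ} (hb : b ≠ 0)
    (h : ∀ k (r : ℝ), 0 < r → b ≠ r * A.dir k) :
    ∀ᶠ b' in 𝓝 b, A.frame (turn b') = A.frame (turn b) := by
  have hpi := Real.two_pi_pos
  by_cases hs : -b ∈ Complex.slitPlane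
  · have hev : ∀ᶠ b' in 𝓝 b, ∀ k, A.angle k < turn b' ↔ A.angle k < turn b := by
      refine Filter.eventually_all.2 fun k => ?_
      rcases lt_trichotomy (A.angle k) (turn b) with h1 | h1 | h1
      · filter_upwards [(continuousAt_turn hs).eventually (lt_mem_nhds h1)] with b' hb'
        exact iff_of_true hb' h1
      · refine absurd ?_ (h k ‖b‖ (norm_pos_iff.2 hb))
        rw [dir, h1, norm_mul_exp_turn]
      · filter_upwards [(continuousAt_turn hs).eventually (gt_mem_nhds h1)] with b' hb'
        exact iff_of_false (not_lt.2 hb'.le) (not_lt.2 h1.le)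
    filter_upwards [hev] with b' hb'
    exact A.frame_congr _ _ hb'
  · -- on the positive real axis the angle jumps by a full turn, which does not change the frame
    have hre : 0 ≤ b.re ∧ b.im = 0 := by
      simpa [Complex.mem_slitPlane_iff, not_or] using hs
    have hre' : 0 < b.re :=
      lt_of_le_of_ne hre.1 fun h0 => hb (Complex.ext h0.symm hre.2)
    have harg : Complex.arg b = 0 := Complex.arg_eq_zero_iff.2 hre
    have hcont : ContinuousAt Complex.arg b := Complex.continuousAt_arg (Or.inl hre')
    have hframe : ∀ b' : ℂ, b' ≠ 0 → |Complex.arg b' / (2 * Real.pi)| < A.scale →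
        A.frame (turn b') = A.frame 1 := by
      intro b' hb' hlt
      rw [abs_lt] at hlt
      rcases turn_eq_or b' hb' with h1 | h1
      · rw [← A.frame_zero]
        refine A.frame_congr _ _ fun k => iff_of_false ?_ (not_lt.2 (A.angle_pos k).le)
        rw [h1]
        linarith [(A.scale_le_angle k).1]
      · refine A.frame_congr _ _ fun k => iff_of_true ?_ (A.angle_lt_one k)
        rw [h1]
        linarith [(A.scale_le_angle k).2]
    have hev : ∀ᶠ b' in 𝓝 b, |Complex.arg b' / (2 * Real.pi)| < A.scale :=
      (hcont.div_const _).abs.eventually_lt continuousAt_const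
        (by simp [harg, A.scale_pos])
    filter_upwards [hev, isOpen_ne.mem_nhds hb] with b' h1 h2
    rw [hframe b' h2 h1, hframe b hb hev.self_of_nhds]

/-- The monodromy datum of an angular datum: the frame at a point of the plane is the one at its
angle. -/
noncomputable def toMonodromyDatum [Finite K] : MonodromyDatum K where
  dir := A.dir
  norm_dir := A.norm_dir
  sign := A.sign
  sign_eq := A.sign_eq
  cycle := A.cycle
  cocycle k := (-(A.sign k * (A.primitive k).choose_spec.choose), A.sign k * (A.primitive k).choose)
  det_cycle k := by
    have h := (A.primitive k).choose_spec.choose_spec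
    simp only [latticeDet]
    linear_combination A.sign k * h
  scale := A.scale
  scale_pos := A.scale_pos
  scale_le := A.scale_le
  disjoint k l q q' hq hq' h := by
    have h1 := congrArg turn h
    rw [A.turn_dir_mul_exp k hq, A.turn_dir_mul_exp l hq'] at h1
    have h2 := abs_lt.1 (A.abs_offset_lt hq)
    have h3 := abs_lt.1 (A.abs_offset_lt hq')
    apply A.angle_injective
    rcases lt_trichotomy (A.angle k) (A.angle l) with h4 | h4 | h4
    · linarith [A.two_mul_scale_le h4]
    · exact h4
    · linarith [A.two_mul_scale_le h4]
  frame b := A.frame (turn b)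
  det_frame b := A.det_frame _ (turn_pos b) (turn_le_one b)
  frame_eventually _ hb h := A.frame_turn_eventually hb h
  frame_of_nonneg k q hq h0 := by
    have hd := A.turn_dir_mul_exp k (q := 0) (by simp)
    have h2 := abs_lt.1 (A.abs_offset_lt hq)
    have h3 : 0 ≤ A.scale * q.im / (2 * Real.pi) :=
      div_nonneg (mul_nonneg A.scale_pos.le h0) Real.two_pi_pos.le
    simp only [mul_zero, neg_zero, Complex.exp_zero, mul_one, Complex.zero_im, zero_div,
      sub_zero] at hd
    rw [A.turn_dir_mul_exp k hq, hd]
    refine A.frame_congr _ _ fun l => ⟨fun h => by linarith, fun h => ?_⟩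
    linarith [A.two_mul_scale_le h]
  frame_of_neg k q hq h0 := by
    have hd := A.turn_dir_mul_exp k (q := 0) (by simp)
    have h2 := abs_lt.1 (A.abs_offset_lt hq)
    have h3 : A.scale * q.im / (2 * Real.pi) < 0 :=
      div_neg_of_neg_of_pos (mul_neg_of_pos_of_neg A.scale_pos h0) Real.two_pi_pos
    simp only [mul_zero, neg_zero, Complex.exp_zero, mul_one, Complex.zero_im, zero_div,
      sub_zero] at hd
    rw [A.turn_dir_mul_exp k hq, hd]
    refine A.frame_jump k _ fun l => ⟨fun h => ?_, fun h => by linarith⟩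
    by_contra! h4
    linarith [A.two_mul_scale_le h4, A.scale_pos]

end AngularDatum

/-! ### The arithmetic of a legal loop -/

lemma mem_interior_originTriangle {a b q : ℤ × ℤ} (h1 : 0 < latticeDet q b)
    (h2 : 0 < latticeDet a q) (h3 : latticeDet q b + latticeDet a q < latticeDet a b) :
    latticePoint q ∈ interior (originTriangle a b) := by
  have hD : (0 : ℝ) < latticeDet a b := by exact_mod_cast (by linarith)
  -- the open triangle is described by the barycentric coordinates
  let S : Set (ℝ × ℝ) := {p | 0 < p.1 * b.2 - p.2 * b.1} ∩ {p | 0 < a.1 * p.2 - a.2 * p.1} ∩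
    {p | (p.1 * b.2 - p.2 * b.1) + (a.1 * p.2 - a.2 * p.1) < latticeDet a b}
  have hS : IsOpen S :=
    ((isOpen_lt (by fun_prop) (by fun_prop)).inter (isOpen_lt (by fun_prop) (by fun_prop))).inter
      (isOpen_lt (by fun_prop) (by fun_prop))
  have hsub : S ⊆ originTriangle a b := by
    rintro p ⟨⟨hp1, hp2⟩, hp3⟩
    simp only [Set.mem_ofPred_eq] at hp1 hp2 hp3
    set s : ℝ := p.1 * b.2 - p.2 * b.1 with hs
    set t : ℝ := a.1 * p.2 - a.2 * p.1 with ht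
    have hconv := convex_convexHull ℝ ({0, latticePoint a, latticePoint b} : Set (ℝ × ℝ))
    have h0 : (0 : ℝ × ℝ) ∈ originTriangle a b := subset_convexHull ℝ _ (by simp)
    have ha : latticePoint a ∈ originTriangle a b := subset_convexHull ℝ _ (by simp)
    have hb : latticePoint b ∈ originTriangle a b := subset_convexHull ℝ _ (by simp)
    have hst : 0 < s + t := add_pos hp1 hp2
    have hq := hconv ha hb (a := s / (s + t)) (b := t / (s + t)) (by positivity) (by positivity)
      (by field_simp)
    have hr := hconv hq h0 (a := (s + t) / latticeDet a b) (b := 1 - (s + t) / latticeDet a b)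
      (by positivity) (sub_nonneg.2 ((div_le_one hD).2 hp3.le)) (by ring)
    have hmem : ∀ p', p = p' → p' ∈ originTriangle a b → p ∈ originTriangle a b :=
      fun p' h h' => h ▸ h'
    refine hmem _ ?_ hr
    have hdet : (latticeDet a b : ℝ) = a.1 * b.2 - a.2 * b.1 := by simp [latticeDet]
    have hne : (a.1 * b.2 - a.2 * b.1 : ℝ) ≠ 0 := hdet ▸ hD.ne'
    apply Prod.ext
    · simp only [latticePoint, Prod.fst_add, Prod.smul_fst, smul_eq_mul, Prod.fst_zero, mul_zero,
        add_zero, hdet]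
      field_simp
      rw [hs, ht]
      ring
    · simp only [latticePoint, Prod.snd_add, Prod.smul_snd, smul_eq_mul, Prod.snd_zero, mul_zero,
        add_zero, hdet]
      field_simp
      rw [hs, ht]
      ring
  refine interior_maximal hsub hS ⟨⟨?_, ?_⟩, ?_⟩ <;>
    simp only [latticePoint, Set.mem_ofPred_eq] <;>
    norm_cast

lemma originTriangle_comm (a b : ℤ × ℤ) : originTriangle a b = originTriangle b a := by
  rw [originTriangle, originTriangle, Set.pair_comm]

/-- In a lattice triangle with vertices `(0, 0)`, `(α, h)`, `(β, h)`, the last two primitive, of height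
`h ≥ 2`, there is an interior lattice point `(x, y)`: it has height `1`, or, if there is none, height `h - 1`. -/
lemma exists_interior_point_of_lt {α β h : ℤ} (hα : IsCoprime α h) (hβ : IsCoprime β h)
    (hh : 2 ≤ h) (hlt : α < β) : ∃ x y : ℤ, x * h < y * β ∧ α * y < h * x ∧ y < h := by
  have hdvd : ∀ γ : ℤ, IsCoprime γ h → ¬ h ∣ γ := fun γ hγ hd => by
    have := Int.isUnit_iff.1 (hγ.symm.isUnit_of_dvd' dvd_rfl hd)
    omega
  set n := α / h with hn
  have h1 : n * h < α := lt_of_le_of_ne (Int.ediv_mul_le α (by omega)) fun he =>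
    hdvd α hα ⟨n, by rw [← he]; ring⟩
  have h2 : α < (n + 1) * h := Int.lt_ediv_add_one_mul_self α (by omega)
  rcases lt_trichotomy ((n + 1) * h) β with h3 | h3 | h3
  · exact ⟨n + 1, 1, by linarith, by linarith, by omega⟩
  · exact absurd ⟨n + 1, by rw [← h3]; ring⟩ (hdvd β hβ)
  · -- reflect the point of height one between the two sides in the side `α`
    refine ⟨α - n, h - 1, ?_, by nlinarith, by omega⟩
    have : h * 1 ≤ h * (β - α) := mul_le_mul_of_nonneg_left (by omega) (by omega)
    nlinarith

/-- The side opposite to the origin of a triangle of a legal loop has lattice distance one from the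
origin. -/
lemma IsOutwardPrimitiveNormal.height_eq_one {u a b : ℤ × ℤ} (hu : IsOutwardPrimitiveNormal u a b)
    (ha : IsPrimitiveVector a) (hb : IsPrimitiveVector b) (hdet : latticeDet a b ≠ 0)
    (hint : ∀ q : ℤ × ℤ, latticePoint q ∉ interior (originTriangle a b)) :
    u.1 * a.1 + u.2 * a.2 = 1 := by
  obtain ⟨r, s, hrs⟩ := hu.primitive
  have hpos := hu.outward
  have hnor := hu.normal
  set h := u.1 * a.1 + u.2 * a.2 with hh
  have hb' : u.1 * b.1 + u.2 * b.2 = h := by linarith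
  -- coordinates with respect to the basis `(-u.2, u.1)`, `(r, s)`
  have hco : ∀ c : ℤ × ℤ, IsPrimitiveVector c → u.1 * c.1 + u.2 * c.2 = h →
      IsCoprime (c.2 * r - c.1 * s) h := by
    rintro c ⟨x, y, hxy⟩ hc
    refine ⟨y * u.1 - x * u.2, x * r + y * s, ?_⟩
    rw [← hc]
    linear_combination hxy + (x * c.1 + y * c.2) * hrs
  have hcoord : ∀ c : ℤ × ℤ, u.1 * c.1 + u.2 * c.2 = h →
      c.1 = -(c.2 * r - c.1 * s) * u.2 + h * r ∧ c.2 = (c.2 * r - c.1 * s) * u.1 + h * s := by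
    intro c hc
    constructor
    · linear_combination -c.1 * hrs + r * hc
    · linear_combination -c.2 * hrs + s * hc
  obtain ⟨ha1, ha2⟩ := hcoord a rfl
  obtain ⟨hb1, hb2⟩ := hcoord b hb'
  have hca := hco a ha rfl
  have hcb := hco b hb hb'
  generalize a.2 * r - a.1 * s = α at *
  generalize b.2 * r - b.1 * s = β at *
  by_contra hne
  have h2 : 2 ≤ h := by omega
  have hfac : r * u.1 + s * u.2 = 1 := hrs
  have key : ∀ x y γ : ℤ, (-x * u.2 + y * r) * (γ * u.1 + h * s) -
      (x * u.1 + y * s) * (-γ * u.2 + h * r) = y * γ - x * h := fun x y γ => by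
    linear_combination (y * γ - x * h) * hrs
  have hab : latticeDet a b = h * β - α * h := by rw [latticeDet, ha1, ha2, hb1, hb2, key]
  rcases lt_trichotomy α β with hlt | heq | hlt
  · obtain ⟨x, y, h3, h4, h5⟩ := exists_interior_point_of_lt hca hcb h2 hlt
    refine hint (-x * u.2 + y * r, x * u.1 + y * s) (mem_interior_originTriangle ?_ ?_ ?_)
    · rw [latticeDet, hb1, hb2, key]
      linarith
    · rw [latticeDet, ha1, ha2]
      nlinarith [key x y α]
    · rw [hab, latticeDet, latticeDet, hb1, hb2, ha1, ha2, key]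
      nlinarith [key x y α]
  · exact hdet (by rw [hab, heq]; ring)
  · obtain ⟨x, y, h3, h4, h5⟩ := exists_interior_point_of_lt hcb hca h2 hlt
    refine hint (-x * u.2 + y * r, x * u.1 + y * s)
      (originTriangle_comm b a ▸ mem_interior_originTriangle ?_ ?_ ?_)
    · rw [latticeDet, ha1, ha2, key]
      linarith
    · rw [latticeDet, hb1, hb2]
      nlinarith [key x y β]
    · have hba : latticeDet b a = h * α - β * h := by rw [latticeDet, ha1, ha2, hb1, hb2, key]
      rw [hba, latticeDet, latticeDet, hb1, hb2, ha1, ha2, key]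
      nlinarith [key x y β]

/-- The vector `(v.1, -v.2)`: the covector `(-v.2, v.1)` that annihilates `v`, with coordinates
swapped. -/
def swapAnnihilator (v : ℤ × ℤ) : ℤ × ℤ := (v.1, -v.2)

lemma swapAnnihilator_next {u a b : ℤ × ℤ} (hu : IsOutwardPrimitiveNormal u a b)
    (h1 : u.1 * a.1 + u.2 * a.2 = 1) :
    swapAnnihilator b = swapAnnihilator a - latticeDet a b • u.swap := by
  have hn := hu.normal
  apply Prod.ext
  · simp only [swapAnnihilator, latticeDet, Prod.fst_sub, Prod.smul_fst, Prod.fst_swap, smul_eq_mul]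
    linear_combination (a.1 - b.1) * h1 + a.1 * hn
  · simp only [swapAnnihilator, latticeDet, Prod.snd_sub, Prod.smul_snd, Prod.snd_swap, smul_eq_mul]
    linear_combination (b.2 - a.2) * h1 - a.2 * hn

lemma normal_next {u u' a : ℤ × ℤ} (h : u.1 * a.1 + u.2 * a.2 = 1)
    (h' : u'.1 * a.1 + u'.2 * a.2 = 1) :
    u'.swap = u.swap + latticeDet u u' • swapAnnihilator a := by
  apply Prod.ext
  · simp only [swapAnnihilator, latticeDet, Prod.fst_add, Prod.smul_fst, Prod.fst_swap, smul_eq_mul]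
    linear_combination u.2 * h' - u'.2 * h
  · simp only [swapAnnihilator, latticeDet, Prod.snd_add, Prod.smul_snd, Prod.snd_swap, smul_eq_mul]
    linear_combination u.1 * h' - u'.1 * h

/-! ### The monodromy datum of a legal loop -/

lemma sum_Iio_of_succ {n : ℕ} {G : Type*} [AddCommGroup G] {a b : Fin (n + 1) → G}
    (h : ∀ i, a (i + 1) = a i + b i) (i : Fin (n + 1)) :
    a 0 + ∑ j ∈ Finset.Iio i, b j = a i := by
  induction i using Fin.induction with
  | zero =>
    rw [Finset.Iio_eq_empty.2 fun j _ => Fin.zero_le j, Finset.sum_empty, add_zero]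
  | succ i ih =>
    have hset : Finset.Iio i.succ = insert i.castSucc (Finset.Iio i.castSucc) := by
      ext j
      simp only [Finset.mem_Iio, Finset.mem_insert, Fin.lt_def, Fin.ext_iff, Fin.val_succ,
        Fin.val_castSucc]
      omega
    rw [hset, Finset.sum_insert (by simp), add_left_comm, ih, ← Fin.coeSucc_eq_succ, h, add_comm]

/-- A cyclic sequence whose `i`-th step is made of `N i` equal jumps `s i`.  If all jumps before the
step `i`, none of the jumps after it and `c` of the jumps of this step have been made, then the
value `a i + c • s i` is reached. -/
lemma add_sum_jumps {m : ℕ} [NeZero m] {G : Type*} [AddCommGroup G] {a : Fin m → G} {N : Fin m → ℕ}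
    {s : Fin m → G} (h : ∀ i, a (i + 1) = a i + N i • s i) {p : ∀ i, Fin (N i) → Prop}
    [∀ i, DecidablePred (p i)] (i : Fin m) (hlt : ∀ l < i, ∀ j, p l j) (hgt : ∀ l, i < l → ∀ j, ¬ p l j) :
    a 0 + ∑ l, ∑ j, (if p l j then s l else 0) =
      a i + (Finset.univ.filter (p i)).card • s i := by
  obtain ⟨n, rfl⟩ : ∃ n, m = n + 1 := ⟨m - 1, (Nat.succ_pred_eq_of_ne_zero (NeZero.ne m)).symm⟩
  have hinner : ∀ l, ∑ j, (if p l j then s l else 0) = (Finset.univ.filter (p l)).card • s l :=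
    fun l => by rw [← Finset.sum_filter, Finset.sum_const]
  simp only [hinner]
  have hsplit : (Finset.univ : Finset (Fin (n + 1))) =
      (Finset.Iio i ∪ {i}) ∪ Finset.Ioi i := by
    ext l
    simp only [Finset.mem_univ, Finset.mem_union, Finset.mem_Iio, Finset.mem_singleton,
      Finset.mem_Ioi, true_iff]
    exact (lt_trichotomy l i).elim (fun h => Or.inl (Or.inl h))
      fun h => h.elim (fun h => Or.inl (Or.inr h)) Or.inr
  rw [hsplit, Finset.sum_union, Finset.sum_union, Finset.sum_singleton, ← add_assoc, ← add_assoc]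
  · have h1 : ∑ l ∈ Finset.Iio i, (Finset.univ.filter (p l)).card • s l =
        ∑ l ∈ Finset.Iio i, N l • s l := by
      refine Finset.sum_congr rfl fun l hl => ?_
      rw [Finset.filter_true_of_mem fun j _ => hlt l (Finset.mem_Iio.1 hl) j, Finset.card_univ,
        Fintype.card_fin]
    have h2 : ∑ l ∈ Finset.Ioi i, (Finset.univ.filter (p l)).card • s l = 0 := by
      refine Finset.sum_eq_zero fun l hl => ?_
      rw [Finset.filter_false_of_mem fun j _ => hgt l (Finset.mem_Ioi.1 hl) j, Finset.card_empty,
        zero_smul]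
    rw [h1, h2, sum_Iio_of_succ h, add_zero]
  · simp
  · rw [Finset.disjoint_union_left]
    refine ⟨Finset.disjoint_left.2 fun l h1 h2 => ?_, by simp⟩
    exact lt_asymm (Finset.mem_Iio.1 h1) (Finset.mem_Ioi.1 h2)

section LoopData

variable {m : ℕ} [NeZero m] (v u : Fin m → ℤ × ℤ)

/-- The position of a singular value in turns: the singular values of a vertex or an edge are
equidistributed in its sector. -/
noncomputable def loopAngle : SingularFiberIndex v u → ℝ
  | Sum.inl k => ((k.1 : ℝ) +
      ((k.2 : ℝ) + 1) / ((latticeDet (u (k.1 - 1)) (u k.1)).natAbs + 1) / 2) / m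
  | Sum.inr k => ((k.1 : ℝ) + 1 / 2 +
      ((k.2 : ℝ) + 1) / ((latticeDet (v k.1) (v (k.1 + 1))).natAbs + 1) / 2) / m

/-- The signs of the singular fibres. -/
def loopSign : SingularFiberIndex v u → ℤ
  | Sum.inl k => (latticeDet (u (k.1 - 1)) (u k.1)).sign
  | Sum.inr k => (latticeDet (v k.1) (v (k.1 + 1))).sign

/-- The vanishing cycles, with coordinates swapped. -/
def loopCycle (k : SingularFiberIndex v u) : ℤ × ℤ := (vanishingCovector v u k).swap

/-- The change of the frame at a singular value: at a vertex the second vector jumps, at an edge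
the first one. -/
def loopJump : SingularFiberIndex v u → (ℤ × ℤ) × (ℤ × ℤ)
  | Sum.inl k => (0, loopSign v u (Sum.inl k) • loopCycle v u (Sum.inl k))
  | Sum.inr k => (-(loopSign v u (Sum.inr k) • loopCycle v u (Sum.inr k)), 0)

open Classical in
/-- The frame at the angle `t`, which starts with the annihilator of `v 0` and the normal `u (-1)`
and has jumped at all singular values before `t`. -/
noncomputable def loopFrame (t : ℝ) : (ℤ × ℤ) × (ℤ × ℤ) :=
  (swapAnnihilator (v 0), (u (0 - 1)).swap) +
    ∑ k, if loopAngle v u k < t then loopJump v u k else 0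

variable {v u}

lemma fraction_mem {N : ℕ} (j : Fin N) : ((j : ℝ) + 1) / (N + 1) ∈ Set.Ioo (0 : ℝ) 1 := by
  have : ((j : ℕ) : ℝ) < N := by exact_mod_cast j.2
  exact ⟨by positivity, by rw [div_lt_one (by positivity)]; linarith⟩

lemma cast_pos_of_neZero : (0 : ℝ) < m := by exact_mod_cast NeZero.pos m

lemma loopAngle_mem (k : SingularFiberIndex v u) : loopAngle v u k ∈ angularSector v u k := by
  have hm : (0 : ℝ) < m := cast_pos_of_neZero
  rcases k with ⟨i, j⟩ | ⟨i, j⟩ <;>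
  · have h := fraction_mem j
    simp only [loopAngle, angularSector, Set.mem_Ioo] at h ⊢
    exact ⟨div_lt_div_of_pos_right (by linarith) hm, div_lt_div_of_pos_right (by linarith) hm⟩

lemma loopAngle_injective : Function.Injective (loopAngle v u) := by
  have hm : (0 : ℝ) < m := cast_pos_of_neZero
  have hcast : ∀ {i l : Fin m} {s t : ℝ}, s ∈ Set.Ioo (0 : ℝ) 1 → t ∈ Set.Ioo (0 : ℝ) 1 →
      (i : ℝ) + s = l + t → i = l := by
    intro i l s t hs ht h
    have h1 : ((i : ℕ) : ℝ) < (l : ℕ) + 1 := by linarith [hs.1, ht.2]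
    have h2 : ((l : ℕ) : ℝ) < (i : ℕ) + 1 := by linarith [hs.2, ht.1]
    have h1' : (i : ℕ) < l + 1 := by exact_mod_cast h1
    have h2' : (l : ℕ) < i + 1 := by exact_mod_cast h2
    exact Fin.ext (by omega)
  have hfrac : ∀ {N : ℕ} {j l : Fin N}, ((j : ℝ) + 1) / (N + 1) = (l + 1) / (N + 1) → j = l := by
    intro N j l h
    have : ((j : ℕ) : ℝ) = (l : ℕ) := by
      have hN : (N : ℝ) + 1 ≠ 0 := by positivity
      have := (div_left_inj' hN).1 h
      linarith
    exact Fin.ext (by exact_mod_cast this)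
  rintro (⟨i, j⟩ | ⟨i, j⟩) (⟨l, j'⟩ | ⟨l, j'⟩) h <;>
    simp only [loopAngle, div_left_inj' hm.ne'] at h <;>
    have h1 := fraction_mem j <;> have h2 := fraction_mem j' <;>
    simp only [Set.mem_Ioo] at h1 h2
  · obtain rfl := hcast ⟨by linarith, by linarith⟩ ⟨by linarith, by linarith⟩ h
    have hj : j = j' := hfrac (by linarith)
    rw [hj]
  · obtain rfl := hcast ⟨by linarith, by linarith⟩ ⟨by linarith, by linarith⟩ (h.trans (add_assoc _ _ _))
    generalize ((j : ℝ) + 1) / _ = s at h h1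
    generalize ((j' : ℝ) + 1) / _ = s' at h h2
    linarith
  · obtain rfl := hcast ⟨by linarith, by linarith⟩ ⟨by linarith, by linarith⟩ ((add_assoc _ _ _).symm.trans h)
    generalize ((j : ℝ) + 1) / _ = s at h h1
    generalize ((j' : ℝ) + 1) / _ = s' at h h2
    linarith
  · obtain rfl := hcast ⟨by linarith, by linarith⟩ ⟨by linarith, by linarith⟩
      ((add_assoc _ _ _).symm.trans (h.trans (add_assoc _ _ _)))
    have hj : j = j' := hfrac (by linarith)
    rw [hj]

lemma loopAngle_inl_mem (i : Fin m) (j) :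
    loopAngle v u (Sum.inl ⟨i, j⟩) ∈ Set.Ioo ((i : ℝ) / m) (((i : ℝ) + 1 / 2) / m) :=
  loopAngle_mem (v := v) (u := u) (Sum.inl ⟨i, j⟩)

lemma loopAngle_inr_mem (i : Fin m) (j) :
    loopAngle v u (Sum.inr ⟨i, j⟩) ∈ Set.Ioo (((i : ℝ) + 1 / 2) / m) (((i : ℝ) + 1) / m) :=
  loopAngle_mem (v := v) (u := u) (Sum.inr ⟨i, j⟩)

lemma loopAngle_mem_Ioo (k : SingularFiberIndex v u) : loopAngle v u k ∈ Set.Ioo (0 : ℝ) 1 := by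
  have hm : (0 : ℝ) < m := cast_pos_of_neZero
  have hle : ∀ i : Fin m, ((i : ℝ) + 1) / m ≤ 1 := fun i => by
    rw [div_le_one hm]
    exact_mod_cast i.2
  have h := loopAngle_mem k
  rcases k with ⟨i, j⟩ | ⟨i, j⟩ <;> simp only [angularSector] at h
  · refine ⟨lt_of_le_of_lt (by positivity) h.1, h.2.trans_le (le_trans ?_ (hle i))⟩
    exact div_le_div_of_nonneg_right (by linarith) hm.le
  · exact ⟨lt_of_le_of_lt (by positivity) h.1, h.2.trans_le (hle i)⟩

lemma loopSign_eq (k : SingularFiberIndex v u) : loopSign v u k = 1 ∨ loopSign v u k = -1 := by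
  rcases k with ⟨i, j⟩ | ⟨i, j⟩ <;>
  · have h0 := Int.natAbs_pos.1 j.pos
    rcases lt_or_gt_of_ne h0 with h | h
    · exact Or.inr (Int.sign_eq_neg_one_of_neg h)
    · exact Or.inl (Int.sign_eq_one_of_pos h)

lemma loopFrame_congr {t t' : ℝ} (h : ∀ k, loopAngle v u k < t ↔ loopAngle v u k < t') :
    loopFrame v u t = loopFrame v u t' := by
  simp only [loopFrame, h]

lemma loopFrame_eq_add_jump {k : SingularFiberIndex v u} {t : ℝ}
    (h : ∀ l, loopAngle v u l < t ↔ loopAngle v u l ≤ loopAngle v u k) :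
    loopFrame v u t = loopFrame v u (loopAngle v u k) + loopJump v u k := by
  classical
  rw [loopFrame, loopFrame, add_assoc]
  congr 1
  have hk : loopJump v u k = ∑ l, if l = k then loopJump v u l else 0 := by simp
  rw [hk, ← Finset.sum_add_distrib]
  refine Finset.sum_congr rfl fun l _ => ?_
  simp only [h]
  by_cases hl : l = k
  · simp [hl]
  · have hne : loopAngle v u l ≠ loopAngle v u k := fun he => hl (loopAngle_injective he)
    simp [hl, le_iff_lt_or_eq, hne]

/-- The vectors in `ℤ²` that annihilate the vertices turn into each other by the jumps at the edges,
the normals of the edges by the jumps at the vertices. -/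
structure IsUnimodularLoop (v u : Fin m → ℤ × ℤ) : Prop where
  height : ∀ i, (u i).1 * (v i).1 + (u i).2 * (v i).2 = 1
  height_next : ∀ i, (u (i - 1)).1 * (v i).1 + (u (i - 1)).2 * (v i).2 = 1
  annihilator_next : ∀ i, swapAnnihilator (v (i + 1)) =
    swapAnnihilator (v i) - latticeDet (v i) (v (i + 1)) • (u i).swap
  normal_next : ∀ i, (u i).swap =
    (u (i - 1)).swap + latticeDet (u (i - 1)) (u i) • swapAnnihilator (v i)

lemma IsLegalLoop.isUnimodularLoop (hv : IsLegalLoop v)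
    (hu : ∀ i, IsOutwardPrimitiveNormal (u i) (v i) (v (i + 1))) : IsUnimodularLoop v u := by
  have h1 : ∀ i, (u i).1 * (v i).1 + (u i).2 * (v i).2 = 1 := fun i =>
    (hu i).height_eq_one (hv.primitive i) (hv.primitive (i + 1)) (hv.nondegenerate i)
      (hv.no_interior_point i)
  have h2 : ∀ i, (u (i - 1)).1 * (v i).1 + (u (i - 1)).2 * (v i).2 = 1 := fun i => by
    have h3 := (hu (i - 1)).normal
    have h4 := h1 (i - 1)
    rw [sub_add_cancel] at h3
    linarith
  exact ⟨h1, h2, fun i => swapAnnihilator_next (hu i) (h1 i), fun i => normal_next (h2 i) (h1 i)⟩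

lemma natAbs_smul_sign_smul (d : ℤ) (w : ℤ × ℤ) : d.natAbs • (d.sign • w) = d • w := by
  rw [← natCast_zsmul, smul_smul, mul_comm, Int.sign_mul_natAbs]

open Classical in
/-- The sums over the jumps before the sector of `i` telescope around the loop. -/
lemma loopFrame_eq_sectors (h : IsUnimodularLoop v u) {t : ℝ} {i : Fin m}
    (h0 : (i : ℝ) / m ≤ t) (h1 : t ≤ ((i : ℝ) + 1) / m) :
    loopFrame v u t =
      (swapAnnihilator (v i) - (Finset.univ.filter fun j => loopAngle v u (Sum.inr ⟨i, j⟩) < t).card •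
          ((latticeDet (v i) (v (i + 1))).sign • (u i).swap),
        (u (i - 1)).swap + (Finset.univ.filter fun j => loopAngle v u (Sum.inl ⟨i, j⟩) < t).card •
          ((latticeDet (u (i - 1)) (u i)).sign • swapAnnihilator (v i))) := by
  have hm : (0 : ℝ) < m := cast_pos_of_neZero
  have hlow : ∀ {l : Fin m}, l < i → ((l : ℝ) + 1) / m ≤ t := fun {l} hl => by
    refine le_trans (div_le_div_of_nonneg_right ?_ hm.le) h0
    exact_mod_cast Nat.succ_le_of_lt hl
  have hhigh : ∀ {l : Fin m}, i < l → t ≤ (l : ℝ) / m := fun {l} hl => by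
    refine h1.trans (div_le_div_of_nonneg_right ?_ hm.le)
    exact_mod_cast Nat.succ_le_of_lt hl
  have hhalf : ∀ l : Fin m, ((l : ℝ)) / m ≤ ((l : ℝ) + 1 / 2) / m ∧
      ((l : ℝ) + 1 / 2) / m ≤ ((l : ℝ) + 1) / m := fun l =>
    ⟨div_le_div_of_nonneg_right (by linarith) hm.le,
      div_le_div_of_nonneg_right (by linarith) hm.le⟩
  have hedge := add_sum_jumps (a := fun i => (swapAnnihilator (v i), (0 : ℤ × ℤ)))
    (N := fun i => (latticeDet (v i) (v (i + 1))).natAbs)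
    (s := fun i => (-((latticeDet (v i) (v (i + 1))).sign • (u i).swap), 0))
    (p := fun i j => loopAngle v u (Sum.inr ⟨i, j⟩) < t)
    (fun i => by
      simp only [Prod.smul_mk, smul_neg, natAbs_smul_sign_smul, smul_zero, Prod.mk_add_mk, add_zero,
        ← sub_eq_add_neg, h.annihilator_next i]) i
    (fun l hl j => (loopAngle_inr_mem l j).2.trans_le (hlow hl))
    (fun l hl j => not_lt.2 ((hhigh hl).trans ((hhalf l).1.trans (loopAngle_inr_mem l j).1.le)))
  have hvert := add_sum_jumps (a := fun i => ((0 : ℤ × ℤ), (u (i - 1)).swap))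
    (N := fun i => (latticeDet (u (i - 1)) (u i)).natAbs)
    (s := fun i => (0, (latticeDet (u (i - 1)) (u i)).sign • swapAnnihilator (v i)))
    (p := fun i j => loopAngle v u (Sum.inl ⟨i, j⟩) < t)
    (fun i => by
      simp only [Prod.smul_mk, natAbs_smul_sign_smul, smul_zero, Prod.mk_add_mk, add_zero,
        add_sub_cancel_right, ← h.normal_next i]) i
    (fun l hl j => (loopAngle_inl_mem l j).2.trans_le ((hhalf l).2.trans (hlow hl)))
    (fun l hl j => not_lt.2 ((hhigh hl).trans (loopAngle_inl_mem l j).1.le))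
  have hsum : loopFrame v u t =
      ((swapAnnihilator (v 0), (0 : ℤ × ℤ)) +
        ∑ i, ∑ j, if loopAngle v u (Sum.inr ⟨i, j⟩) < t then
          (-((latticeDet (v i) (v (i + 1))).sign • (u i).swap), (0 : ℤ × ℤ)) else 0) +
      (((0 : ℤ × ℤ), (u (0 - 1)).swap) +
        ∑ i, ∑ j, if loopAngle v u (Sum.inl ⟨i, j⟩) < t then
          ((0 : ℤ × ℤ), (latticeDet (u (i - 1)) (u i)).sign • swapAnnihilator (v i)) else 0) := by
    have hstart : (swapAnnihilator (v 0), (u (0 - 1)).swap) =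
        (swapAnnihilator (v 0), (0 : ℤ × ℤ)) + ((0 : ℤ × ℤ), (u (0 - 1)).swap) := by simp
    rw [add_add_add_comm, ← hstart, add_comm (∑ i, ∑ j, _), loopFrame, Fintype.sum_sum_type,
      Fintype.sum_sigma, Fintype.sum_sigma]
    rfl
  rw [hsum, hedge, hvert]
  simp only [Prod.smul_mk, smul_zero, Prod.mk_add_mk, add_zero, zero_add, smul_neg, sub_eq_add_neg]

lemma loopFrame_of_vertex_sector (h : IsUnimodularLoop v u) {t : ℝ} {i : Fin m}
    (h0 : (i : ℝ) / m ≤ t) (h1 : t ≤ ((i : ℝ) + 1 / 2) / m) :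
    ∃ c : ℤ, loopFrame v u t =
      (swapAnnihilator (v i), (u (i - 1)).swap + c • swapAnnihilator (v i)) := by
  classical
  have hm : (0 : ℝ) < m := cast_pos_of_neZero
  refine ⟨(Finset.univ.filter fun j => loopAngle v u (Sum.inl ⟨i, j⟩) < t).card *
    (latticeDet (u (i - 1)) (u i)).sign, ?_⟩
  rw [loopFrame_eq_sectors h h0
    (h1.trans (div_le_div_of_nonneg_right (by linarith) hm.le)),
    Finset.filter_false_of_mem fun j _ => not_lt.2 (h1.trans (loopAngle_inr_mem i j).1.le),
    Finset.card_empty, zero_smul, sub_zero, mul_smul, natCast_zsmul]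

lemma loopFrame_of_edge_sector (h : IsUnimodularLoop v u) {t : ℝ} {i : Fin m}
    (h0 : ((i : ℝ) + 1 / 2) / m ≤ t) (h1 : t ≤ ((i : ℝ) + 1) / m) :
    ∃ c : ℤ, loopFrame v u t = (swapAnnihilator (v i) - c • (u i).swap, (u i).swap) := by
  classical
  have hm : (0 : ℝ) < m := cast_pos_of_neZero
  refine ⟨(Finset.univ.filter fun j => loopAngle v u (Sum.inr ⟨i, j⟩) < t).card *
    (latticeDet (v i) (v (i + 1))).sign, ?_⟩
  rw [loopFrame_eq_sectors h
    ((div_le_div_of_nonneg_right (by linarith) hm.le).trans h0) h1,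
    Finset.filter_true_of_mem (s := Finset.univ)
      (p := fun j => loopAngle v u (Sum.inl ⟨i, j⟩) < t)
      fun j _ => (loopAngle_inl_mem i j).2.trans_le h0,
    Finset.card_univ, Fintype.card_fin, natAbs_smul_sign_smul, ← h.normal_next i, mul_smul,
    natCast_zsmul]

lemma exists_sector {t : ℝ} (h0 : 0 < t) (h1 : t ≤ 1) :
    ∃ i : Fin m, (i : ℝ) / m ≤ t ∧ t ≤ ((i : ℝ) + 1) / m := by
  have hm : (0 : ℝ) < m := cast_pos_of_neZero
  have hpos : 0 < ⌈t * m⌉₊ := Nat.ceil_pos.2 (mul_pos h0 hm)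
  have hle : ⌈t * m⌉₊ ≤ m := Nat.ceil_le.2 (by nlinarith)
  have hlt := Nat.ceil_lt_add_one (mul_pos h0 hm).le
  have hge := Nat.le_ceil (t * m)
  refine ⟨⟨⌈t * m⌉₊ - 1, by omega⟩, ?_, ?_⟩
  · rw [div_le_iff₀ hm, Nat.cast_sub hpos]
    push_cast
    linarith
  · rw [le_div_iff₀ hm, Nat.cast_sub hpos]
    push_cast
    linarith

lemma det_loopFrame (h : IsUnimodularLoop v u) {t : ℝ} (h0 : 0 < t) (h1 : t ≤ 1) :
    latticeDet (loopFrame v u t).1 (loopFrame v u t).2 = 1 := by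
  obtain ⟨i, hi0, hi1⟩ := exists_sector (m := m) h0 h1
  have hh := h.height i
  have hh' := h.height_next i
  rcases le_total t (((i : ℝ) + 1 / 2) / m) with ht | ht
  · obtain ⟨c, hc⟩ := loopFrame_of_vertex_sector h hi0 ht
    rw [hc]
    simp only [latticeDet, swapAnnihilator, Prod.fst_add, Prod.snd_add, Prod.smul_fst,
      Prod.smul_snd, Prod.fst_swap, Prod.snd_swap, smul_eq_mul]
    linear_combination hh'
  · obtain ⟨c, hc⟩ := loopFrame_of_edge_sector h ht hi1
    rw [hc]
    simp only [latticeDet, swapAnnihilator, Prod.fst_sub, Prod.snd_sub, Prod.smul_fst,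
      Prod.smul_snd, Prod.fst_swap, Prod.snd_swap, smul_eq_mul]
    linear_combination hh

lemma loopFrame_zero (h : IsUnimodularLoop v u) : loopFrame v u 0 = loopFrame v u 1 := by
  have hm : (0 : ℝ) < m := cast_pos_of_neZero
  have hlast : (-1 : Fin m) + 1 = 0 := neg_add_cancel 1
  have hval : (((-1 : Fin m) : ℕ) : ℝ) + 1 = m := by
    obtain ⟨n, rfl⟩ : ∃ n, m = n + 1 := ⟨m - 1, (Nat.succ_pred_eq_of_ne_zero (NeZero.ne m)).symm⟩
    have : (-1 : Fin (n + 1)) = Fin.last n := neg_eq_of_add_eq_zero_left (Fin.last_add_one n)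
    simp [this]
  classical
  rw [loopFrame_eq_sectors h (t := 0) (i := 0) (by simp) (by positivity),
    loopFrame_eq_sectors h (t := 1) (i := -1)
      ((div_le_one hm).2 (by linarith)) (by rw [hval, div_self hm.ne'])]
  rw [Finset.filter_false_of_mem fun j _ => not_lt.2 (loopAngle_mem_Ioo (Sum.inr ⟨0, j⟩)).1.le,
    Finset.filter_false_of_mem fun j _ => not_lt.2 (loopAngle_mem_Ioo (Sum.inl ⟨0, j⟩)).1.le,
    Finset.filter_true_of_mem fun j _ => (loopAngle_mem_Ioo (Sum.inr ⟨-1, j⟩)).2,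
    Finset.filter_true_of_mem fun j _ => (loopAngle_mem_Ioo (Sum.inl ⟨-1, j⟩)).2]
  have hnext := h.annihilator_next (-1)
  rw [hlast] at hnext
  simp only [Finset.card_univ, Fintype.card_fin, natAbs_smul_sign_smul, Finset.card_empty, zero_smul,
    sub_zero, add_zero, ← h.normal_next, hlast, zero_sub, hnext]

/-- In the sector of a singular value, one of the two vectors of the frame is its vanishing cycle, so
that the Picard–Lefschetz transformation changes the other one only. -/
lemma loopFrame_jump (h : IsUnimodularLoop v u) {k : SingularFiberIndex v u} {t : ℝ}
    (hk : ∀ l, loopAngle v u l < t ↔ loopAngle v u l ≤ loopAngle v u k) :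
    loopFrame v u t =
      (picardLefschetz (loopSign v u k) (loopCycle v u k) (loopFrame v u (loopAngle v u k)).1,
        picardLefschetz (loopSign v u k) (loopCycle v u k)
          (loopFrame v u (loopAngle v u k)).2) := by
  rw [loopFrame_eq_add_jump hk]
  have hdet := det_loopFrame h (loopAngle_mem_Ioo k).1 (loopAngle_mem_Ioo k).2.le
  have hcol : ∀ (ε : ℤ) (P Q : ℤ × ℤ), latticeDet P Q = 1 →
      P = picardLefschetz ε P P ∧ Q + ε • P = picardLefschetz ε P Q ∧
        P - ε • Q = picardLefschetz ε Q P := by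
    intro ε P Q h1
    have h2 : latticeDet Q P = -1 := by
      rw [← h1]
      simp only [latticeDet]
      ring
    have h3 : latticeDet P P = 0 := by
      simp only [latticeDet]
      ring
    refine ⟨?_, ?_, ?_⟩ <;> apply Prod.ext <;> simp [picardLefschetz, h1, h2, h3] <;> ring
  rcases k with ⟨i, j⟩ | ⟨i, j⟩
  · have hi := loopAngle_inl_mem (v := v) (u := u) i j
    obtain ⟨c, hc⟩ := loopFrame_of_vertex_sector h hi.1.le hi.2.le
    have hcyc : loopCycle v u (Sum.inl ⟨i, j⟩) =
        (loopFrame v u (loopAngle v u (Sum.inl ⟨i, j⟩))).1 := by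
      rw [hc]
      rfl
    obtain ⟨e1, e2, -⟩ := hcol (loopSign v u (Sum.inl ⟨i, j⟩)) _ _ hdet
    rw [loopJump, hcyc, ← e1, ← e2]
    apply Prod.ext <;> simp
  · have hi := loopAngle_inr_mem (v := v) (u := u) i j
    obtain ⟨c, hc⟩ := loopFrame_of_edge_sector h hi.1.le hi.2.le
    have hcyc : loopCycle v u (Sum.inr ⟨i, j⟩) =
        (loopFrame v u (loopAngle v u (Sum.inr ⟨i, j⟩))).2 := by
      rw [hc]
      rfl
    have hdet' : latticeDet (loopFrame v u (loopAngle v u (Sum.inr ⟨i, j⟩))).2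
        (-(loopFrame v u (loopAngle v u (Sum.inr ⟨i, j⟩))).1) = 1 := by
      rw [← hdet]
      simp only [latticeDet, Prod.fst_neg, Prod.snd_neg]
      ring
    obtain ⟨-, -, e3⟩ := hcol (loopSign v u (Sum.inr ⟨i, j⟩)) _ _ hdet
    obtain ⟨e1, -, -⟩ := hcol (loopSign v u (Sum.inr ⟨i, j⟩)) _ _ hdet'
    rw [loopJump, hcyc, ← e1, ← e3]
    apply Prod.ext <;> simp [sub_eq_add_neg]

/-- The angular datum of a legal loop. -/
noncomputable def loopDatum (hv : IsLegalLoop v)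
    (hu : ∀ i, IsOutwardPrimitiveNormal (u i) (v i) (v (i + 1))) :
    AngularDatum (SingularFiberIndex v u) where
  angle := loopAngle v u
  angle_pos k := (loopAngle_mem_Ioo k).1
  angle_lt_one k := (loopAngle_mem_Ioo k).2
  angle_injective := loopAngle_injective
  sign := loopSign v u
  sign_eq := loopSign_eq
  cycle := loopCycle v u
  primitive k := by
    rcases k with ⟨i, j⟩ | ⟨i, j⟩
    · exact (hv.primitive i).neg_right
    · exact (hu i).primitive.symm
  frame := loopFrame v u
  det_frame _ := det_loopFrame (hv.isUnimodularLoop hu)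
  frame_congr _ _ := loopFrame_congr
  frame_zero := loopFrame_zero (hv.isUnimodularLoop hu)
  frame_jump _ _ := loopFrame_jump (hv.isUnimodularLoop hu)

end LoopData

theorem mainTheorem5 {m : ℕ} [NeZero m] (v u : Fin m → ℤ × ℤ) (hv : IsLegalLoop v)
    (hu : ∀ i, IsOutwardPrimitiveNormal (u i) (v i) (v (i + 1))) :
    ∃ (M : Type) (_ : TopologicalSpace M) (_ : ChartedSpace (ℂ × ℂ) M)
      (_ : IsManifold 𝓘(ℝ, ℂ × ℂ) ∞ M),
      T2Space M ∧ CompactSpace M ∧ HasOrientedAtlas M ∧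
      ∃ (f : M → TwoSphere) (p : SingularFiberIndex v u → M),
        IsNodalTorusFibration f (Set.range p) ∧
        Function.Injective (fun k => f (p k)) ∧
        (∀ (i : Fin m) (j : Fin (latticeDet (u (i - 1)) (u i)).natAbs),
          IsSimpleNodalFiber f (p (Sum.inl ⟨i, j⟩)) (Int.sign (latticeDet (u (i - 1)) (u i)))) ∧
        (∀ (i : Fin m) (j : Fin (latticeDet (v i) (v (i + 1))).natAbs),
          IsSimpleNodalFiber f (p (Sum.inr ⟨i, j⟩)) (Int.sign (latticeDet (v i) (v (i + 1))))) ∧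
        IsMarkedByLoop v u f p := by
  let A := loopDatum hv hu
  let D := A.toMonodromyDatum
  have hdir : ∀ k, ((1 : ℝ) : ℂ) * Complex.exp (2 * Real.pi * loopAngle v u k * Complex.I) =
      D.dir k := fun k => by rw [Complex.ofReal_one, one_mul]; rfl
  refine ⟨D.Total, inferInstance, inferInstance, inferInstance, inferInstance, inferInstance,
    LabelledGluing.hasOrientedAtlas, D.proj, D.node, D.isNodalTorusFibration, D.injective_proj_node,
    fun i j => D.isSimpleNodalFiber _, fun i j => D.isSimpleNodalFiber _, D.flatBase false,
    D.trivialization false, fun _ => 1, loopAngle v u, ?_, D.isTorusTrivialization false,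
    fun _ => one_pos, loopAngle_injective, loopAngle_mem, fun k => ?_, fun k => ?_⟩
  · exact ⟨0, fun l => Or.inl (by simp), stereo_false 0⟩
  · rw [hdir, D.proj_node, stereo_false]
  · have h := D.collapsesAlong k
    simp only [hdir, ← stereo_false]
    exact h
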